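/- Let $\mathbb T=\mathbb R/2\pi\mathbb Z$. Let $p(k)=-(k^4+k^2)$ or $p(k)=k^4-k^2$ ($k\in\mathbb Z$), the statement being made for each of these two phase functions. Write $\langle y\rangle=\sqrt{1+|y|^2}$. For $b,s\in\mathbb R$, let $X_{b,s}$ be the completion of the Schwartz functions on $\mathbb T\times\mathbb R$ under the norm $$\|u\|_{X_{b,s}}=\Big(\sum_{k\in\mathbb Z}\int_{\mathbb R}\langle k\rangle^{2s}\langle\tau-p(k)\rangle^{2b}\,|\hat u(k,\tau)|^2\,d\tau\Big)^{1/2},$$ where $\hat u(k,\tau)=\frac1{2\pi}\int_{\mathbb R}\int_{\mathbb T}u(x,t)e^{-i(kx+t\tau)}\,dx\,dt$. For $T>0$, let $X^T_{b,s}$ be the space of restrictions to $\mathbb T\times(0,T)$ of elements of $X_{b,s}$, with the norm $\|u\|_{X^T_{b,s}}=\inf\{\|\tilde u\|_{X_{b,s}}:\tilde u=u\text{ on }\mathbb T\times(0,T)\}$ (which is $\infty$ if $u\notin X^T_{b,s}$). **Proposition (propagation of compactness).** Let $T>0$ and $0\le b'\le b\le 1$. Let $u_n\in X^T_{b,0}$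 and $f_n\in X^T_{-b,-3+3b}$ satisfy $$i\partial_t u_n+\partial_x^2u_n-\partial_x^4u_n=f_n$$ in the sense of distributions on $\mathbb T\times(0,T)$, for $n=1,2,3,\dots$. Assume that there is a constant $C>0$ such that $\|u_n\|_{X^T_{b,0}}\le C$ for all $n$, and that $$\|u_n\|_{X^T_{-b,-3+3b}}+\|f_n\|_{X^T_{-b,-3+3b}}+\|u_n\|_{X^T_{-b',-1+3b'}}\to0\quad\text{as }n\to\infty.$$ Assume in addition that, for some nonempty open set $\omega\subset\mathbb T$, $u_n\to0$ strongly in $L^2(0,T;L^2(\omega))$. Then $u_n\to0$ strongly in $L^2_{loc}([0,T];L^2(\mathbb T))$, that is (as $[0,T]$ is compact), in $L^2(0,T;L^2(\mathbb T))$. -/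

import Mathlib

open MeasureTheory Filter Topology Set
open scoped ENNReal NNReal

noncomputable section

namespace FourthOrderNLS

/-- The one-dimensional torus `𝕋 = ℝ / 2πℤ`. -/
abbrev Torus : Type := AddCircle (2 * Real.pi)

/-- The test functions on `(0,T) × 𝕋`: smooth functions `φ(t, x)`, `2π`-periodic in `x`, whose
support in time is contained in a compact subinterval of `(0,T)`. Points are `z = (t, x)`. -/
def testSpace (T : ℝ) : Submodule ℂ (ℝ × ℝ → ℂ) where
  carrier := {φ | ContDiff ℝ (⊤ : ℕ∞) φ ∧ (∀ t x, φ (t, x + 2 * Real.pi) = φ (t, x)) ∧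
    ∃ a c : ℝ, 0 < a ∧ c < T ∧ ∀ t x, t ∉ Icc a c → φ (t, x) = 0}
  add_mem' := by
    rintro φ ψ ⟨h1, h2, a, c, ha, hc, h3⟩ ⟨k1, k2, a', c', ha', hc', k3⟩
    refine ⟨h1.add k1, fun t x => by simp [h2, k2], min a a', max c c', lt_min ha ha',
      max_lt hc hc', fun t x ht => ?_⟩
    have e1 : φ (t, x) = 0 := h3 t x fun h =>
      ht ⟨(min_le_left _ _).trans h.1, h.2.trans (le_max_left _ _)⟩
    have e2 : ψ (t, x) = 0 := k3 t x fun h =>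
      ht ⟨(min_le_right _ _).trans h.1, h.2.trans (le_max_right _ _)⟩
    simp [e1, e2]
  zero_mem' := by
    exact ⟨contDiff_const, fun _ _ => rfl, 1, T - 1, one_pos, sub_one_lt T, fun _ _ _ => rfl⟩
  smul_mem' := by
    rintro r φ ⟨h1, h2, a, c, ha, hc, h3⟩
    exact ⟨contDiff_const.smul h1, fun t x => by simp [h2], a, c, ha, hc,
      fun t x ht => by simp [h3 t x ht]⟩

/-- Directional derivatives of test functions are test functions. -/
theorem fderiv_mem_testSpace {T : ℝ} (v : ℝ × ℝ) {φ : ℝ × ℝ → ℂ} (h : φ ∈ testSpace T) :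
    (fun z => fderiv ℝ φ z v) ∈ testSpace T := by
  obtain ⟨h1, h2, a, c, ha, hc, h3⟩ := h
  refine ⟨?_, fun t x => ?_, a, c, ha, hc, fun t x ht => ?_⟩
  · exact (h1.fderiv_right (m := ((⊤ : ℕ∞) : WithTop ℕ∞)) (by simp)).clm_apply contDiff_const
  · have hshift : (fun z : ℝ × ℝ => φ (z + (0, 2 * Real.pi))) = φ := by
      funext z
      obtain ⟨t, x⟩ := z
      simpa using h2 t x
    have := fderiv_comp_add_right (𝕜 := ℝ) (f := φ) (x := (t, x)) ((0, 2 * Real.pi) : ℝ × ℝ)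
    rw [hshift] at this
    simp only [Prod.mk_add_mk, add_zero] at this
    change fderiv ℝ φ (t, x + 2 * Real.pi) v = fderiv ℝ φ (t, x) v
    rw [this]
  · have hev : φ =ᶠ[𝓝 (t, x)] fun _ => (0 : ℂ) := by
      have hopen : IsOpen {z : ℝ × ℝ | z.1 ∉ Icc a c} :=
        isClosed_Icc.isOpen_compl.preimage continuous_fst
      filter_upwards [hopen.mem_nhds (show (t, x) ∈ {z : ℝ × ℝ | z.1 ∉ Icc a c} from ht)] with z hz
      exact h3 z.1 z.2 hz
    change fderiv ℝ φ (t, x) v = 0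
    rw [hev.fderiv_eq]
    simp

/-- Directional derivative in the direction `v`, as an operator on test functions. -/
def testDeriv (T : ℝ) (v : ℝ × ℝ) : testSpace T →ₗ[ℂ] testSpace T where
  toFun φ := ⟨fun z => fderiv ℝ (φ : ℝ × ℝ → ℂ) z v, fderiv_mem_testSpace v φ.2⟩
  map_add' φ ψ := by
    ext z
    have h1 := (φ.2.1.differentiable (by simp)) z
    have h2 := (ψ.2.1.differentiable (by simp)) z
    simp [fderiv_add h1 h2]
  map_smul' r φ := by
    ext z
    have h1 := (φ.2.1.differentiable (by simp)) z
    simp [fderiv_const_smul h1 r]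

/-- Generalized functions on `(0,T) × 𝕋`, as functionals on test functions. (No continuity is
imposed here: every functional of finite Bourgain norm below is automatically a distribution.) -/
abbrev GenFun (T : ℝ) : Type := testSpace T →ₗ[ℂ] ℂ

/-- The distributional time derivative `∂ₜ u`. -/
def GenFun.dt {T : ℝ} (u : GenFun T) : GenFun T := -(u ∘ₗ testDeriv T (1, 0))

/-- The distributional space derivative `∂ₓ u`. -/
def GenFun.dx {T : ℝ} (u : GenFun T) : GenFun T := -(u ∘ₗ testDeriv T (0, 1))

/-- `L u = i ∂ₜ u + ∂ₓ² u - ∂ₓ⁴ u`, in the sense of distributions on `(0,T) × 𝕋`. -/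
def schrodinger4 {T : ℝ} (u : GenFun T) : GenFun T :=
  Complex.I • u.dt + u.dx.dx - u.dx.dx.dx.dx

/-- The Japanese bracket `⟨y⟩ = √(1 + |y|²)`. -/
def bracket (y : ℝ) : ℝ := Real.sqrt (1 + y ^ 2)

/-- The unitary space-time Fourier transform
`φ̂(k,τ) = (2π)⁻¹ ∫_ℝ ∫_𝕋 φ(t,x) exp(-i(kx + tτ)) dx dt` on `ℝ × 𝕋`. -/
def fourier (φ : ℝ × ℝ → ℂ) (k : ℤ) (τ : ℝ) : ℂ :=
  (2 * Real.pi : ℂ)⁻¹ * ∫ z in (univ : Set ℝ) ×ˢ Ioc 0 (2 * Real.pi),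
    φ z * Complex.exp (-Complex.I * ((k : ℂ) * (z.2 : ℂ) + (z.1 : ℂ) * (τ : ℂ)))

/-- The norm of `X_{b,s}` (with phase function `p`), read on the Fourier transform `F = û`:
`(∑ₖ ∫ ⟨k⟩^{2s} ⟨τ - p(k)⟩^{2b} |F(k,τ)|² dτ)^{1/2}`. The space `X_{b,s}` over `ℝ × 𝕋`, the
completion of the Schwartz space, consists of the tempered distributions whose Fourier transform
is a measurable function `F` for which this is finite. -/
def bourgainNorm (p : ℤ → ℝ) (b s : ℝ) (F : ℤ → ℝ → ℂ) : ℝ≥0∞ :=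
  (∑' k : ℤ, ∫⁻ τ : ℝ, ENNReal.ofReal (bracket (k : ℝ) ^ (2 * s) * bracket (τ - p k) ^ (2 * b)) *
    ‖F k τ‖ₑ ^ 2) ^ (1 / 2 : ℝ)

/-- The distribution on `ℝ × 𝕋` with Fourier transform `F` coincides with `u` on `(0,T) × 𝕋`:
`⟨u, φ⟩ = ∑ₖ ∫ F(k,τ) φ̂(-k,-τ) dτ` for all test functions `φ` on `(0,T) × 𝕋`. -/
def Extends {T : ℝ} (F : ℤ → ℝ → ℂ) (u : GenFun T) : Prop :=
  ∀ φ : testSpace T, u φ = ∑' k : ℤ, ∫ τ : ℝ, F k τ * fourier (φ : ℝ × ℝ → ℂ) (-k) (-τ)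

/-- The norm of the restriction space `X_{b,s}^T`: the infimum of the `X_{b,s}` norms of all
extensions of `u` to `ℝ × 𝕋`. It is `∞` exactly when `u ∉ X_{b,s}^T`. -/
def restrictedNorm (p : ℤ → ℝ) (b s : ℝ) {T : ℝ} (u : GenFun T) : ℝ≥0∞ :=
  ⨅ (F : ℤ → ℝ → ℂ) (_ : ∀ k, AEStronglyMeasurable (F k) volume) (_ : Extends F u),
    bourgainNorm p b s F

/-- Membership in `X_{b,s}^T`. -/
def MemBourgain (p : ℤ → ℝ) (b s : ℝ) {T : ℝ} (u : GenFun T) : Prop :=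
  restrictedNorm p b s u < ∞

/-- Lebesgue measure on `(0,T) × ω`, for `ω ⊆ 𝕋`, on the fundamental domain `(0,2π]` of `𝕋`. -/
def cylinderMeasure (T : ℝ) (ω : Set Torus) : Measure (ℝ × ℝ) :=
  volume.restrict (Ioo 0 T ×ˢ {x : ℝ | x ∈ Ioc 0 (2 * Real.pi) ∧ (x : Torus) ∈ ω})

/-- The function `g` represents `u` on `(0,T) × ω`: `⟨u, φ⟩ = ∫∫ g φ` for all test functions `φ`
with compact support in `(0,T) × ω`. -/
def Represents {T : ℝ} (ω : Set Torus) (g : ℝ × ℝ → ℂ) (u : GenFun T) : Prop :=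
  ∀ φ : testSpace T,
    (∃ K : Set Torus, IsCompact K ∧ K ⊆ ω ∧
      ∀ t x : ℝ, (φ : ℝ × ℝ → ℂ) (t, x) ≠ 0 → (x : Torus) ∈ K) →
    u φ = ∫ z, g z * (φ : ℝ × ℝ → ℂ) z ∂(cylinderMeasure T ω)

/-- The norm of `u` in `L²(0,T; L²(ω))`, for open `ω ⊆ 𝕋`: the `L²` norm of the function that
represents `u` on `(0,T) × ω` (unique almost everywhere), and `∞` if there is no such function in
`L²`. -/
def l2Norm {T : ℝ} (ω : Set Torus) (u : GenFun T) : ℝ≥0∞ :=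
  ⨅ (g : ℝ × ℝ → ℂ) (_ : MemLp g 2 (cylinderMeasure T ω)) (_ : Represents ω g u),
    eLpNorm g 2 (cylinderMeasure T ω)

end FourthOrderNLS

end

noncomputable section

namespace FourthOrderNLS

open scoped FourierTransform ComplexConjugate

/-! The mechanism is that |uₙ|², integrated in time, equidistributes in x. Mass that is
asymptotically uniform in space and disappears on ω must disappear everywhere.

Let a_k(t) be the spatial Fourier coefficients of a solution on (0,T). By Parseval in x, the m-th
spatial coefficient of the time-integrated density is, up to a constant, ∑_k ∫₀ᵀ a_k conj(a_{k+m})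
dt. Each mode solves i a_k' + l_k a_k = g_k with l_k = -(k⁴+k²), so the product a_k conj(a_{k+m})
oscillates at the frequency l_k - l_{k+m} = m(2k+m)((k+m)²+k²+1). For m ≠ 0 this has size at least a
constant times ⟨k⟩³ unless 2k+m = 0, and integration by parts in time divides by it. Pairing the
weights ⟨τ-p(k)⟩^{-b} and ⟨τ-p(k+m)⟩^b, whose centres differ, costs ⟨p(k)-p(k+m)⟩^b ≲ ⟨k⟩^{3b}. The
balance ⟨k⟩^{-3+3b} is exactly the weight of the norm in which uₙ and fₙ tend to zero, while the
other factor stays bounded in X_{b,0}. The resonant mode 2k+m = 0 uses the same pairing without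
division. These steps are `interior_estimate`, `resonance_bound` and `sum_interior_le`.

The integration by parts needs a cutoff vanishing near t = 0 and t = T. For b > 0 the missing end
pieces are small uniformly in n, because the weight ⟨τ-p(k)⟩^b makes the modes equiintegrable in
time (`lintegral_transform_le`, `sum_tail_le`). For b = 0 this fails, but then g_k is an honest L²
function, and an energy identity bounds the endpoint values directly (`endpoint_estimate`,
`boundary_estimate`). Both cases meet in `exists_correlation_le`.

A restricted norm is an infimum over extensions, and the extension F that is bounded in X_{b,0} need
not be the extension F₁ that is small in X_{-b,-3+3b}. They agree only on (0,T), and the equation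
holds only there. All manipulations are therefore made after mollifying in time, where agreement of
distributions on (0,T) becomes pointwise agreement slightly inside.

Finally, trigonometric polynomials are dense in the continuous functions on the torus, which gives
equidistribution against every continuous function (`tendsto_deviation`). Testing with θ², where θ
is a cutoff supported in ω, gives zero in the limit and also the limiting total mass times the
positive mean of θ². -/

/-! ### Fourier integrals and L² transforms on the line. -/

/-- The Fourier integral `∫ ψ(t) exp(itτ) dt`. -/
def ft (ψ : ℝ → ℂ) (τ : ℝ) : ℂ := ∫ t : ℝ, ψ t * Complex.exp (Complex.I * (t * τ))

theorem norm_exp_I_mul (t τ : ℝ) : ‖Complex.exp (Complex.I * (t * τ))‖ = 1 := by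
  rw [← Complex.ofReal_mul, Complex.norm_exp_I_mul_ofReal]

theorem integrable_mul_exp {ψ : ℝ → ℂ} (hψ : Integrable ψ) (τ : ℝ) :
    Integrable fun t : ℝ => ψ t * Complex.exp (Complex.I * (t * τ)) := by
  refine hψ.mul_bdd (c := 1) ?_ ?_
  · exact (by fun_prop : Continuous fun t : ℝ =>
      Complex.exp (Complex.I * (t * τ))).aestronglyMeasurable
  · exact ae_of_all _ fun t => (norm_exp_I_mul t τ).le

theorem ft_eq_fourierInv (ψ : ℝ → ℂ) (τ : ℝ) : ft ψ τ = 𝓕⁻ ψ (τ / (2 * Real.pi)) := by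
  rw [Real.fourierInv_eq']
  refine integral_congr_ae (ae_of_all _ fun t => ?_)
  have h : (2 * Real.pi * inner ℝ t (τ / (2 * Real.pi)) : ℝ) = t * τ := by
    simp
    field_simp
  simp only [h, smul_eq_mul]
  rw [mul_comm]
  congr 2
  push_cast
  ring

theorem norm_ft_le (ψ : ℝ → ℂ) (τ : ℝ) : ‖ft ψ τ‖ ≤ ∫ t, ‖ψ t‖ := by
  refine (norm_integral_le_integral_norm _).trans_eq ?_
  simp [norm_exp_I_mul]

theorem continuous_ft {ψ : ℝ → ℂ} (hψ : Integrable ψ) : Continuous (ft ψ) := by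
  refine continuous_of_dominated (bound := fun t => ‖ψ t‖) (fun τ => ?_) (fun τ => ?_) hψ.norm ?_
  · exact (integrable_mul_exp hψ τ).aestronglyMeasurable
  · exact ae_of_all _ fun t => by simp [norm_exp_I_mul]
  · exact ae_of_all _ fun t => by fun_prop

theorem integral_mul_ft {A h : ℝ → ℂ} (hA : Integrable A) (hh : Integrable h) :
    ∫ t, h t * ft A t = ∫ τ, A τ * ft h τ := by
  have hi : Integrable (Function.uncurry fun (t τ : ℝ) =>
      h t * (A τ * Complex.exp (Complex.I * (τ * t)))) (volume.prod volume) := by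
    have h1 : Integrable (fun z : ℝ × ℝ => h z.1 * A z.2) (volume.prod volume) := hh.mul_prod hA
    refine (h1.mul_bdd (g := fun z : ℝ × ℝ => Complex.exp (Complex.I * (z.2 * z.1)))
      (c := 1) ?_ ?_).congr ?_
    · exact (by fun_prop : Continuous fun z : ℝ × ℝ =>
        Complex.exp (Complex.I * (z.2 * z.1))).aestronglyMeasurable
    · exact ae_of_all _ fun z => (norm_exp_I_mul _ _).le
    · exact ae_of_all _ fun z => by simp [Function.uncurry, mul_assoc]
  simp only [ft, ← integral_const_mul]
  rw [integral_integral_swap hi]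
  congr 1; ext τ; congr 1; ext t
  rw [mul_comm (τ : ℂ) t]; ring

theorem ft_conj (ψ : ℝ → ℂ) (τ : ℝ) : ft (fun t => conj (ψ t)) τ = conj (ft ψ (-τ)) := by
  rw [ft, ft, ← integral_conj]
  congr 1; ext t
  rw [map_mul, ← Complex.exp_conj]
  simp

/-- Smooth compactly supported functions on the line. -/
def IsTest (ψ : ℝ → ℂ) : Prop := ContDiff ℝ (⊤ : ℕ∞) ψ ∧ HasCompactSupport ψ

theorem IsTest.integrable {ψ : ℝ → ℂ} (h : IsTest ψ) : Integrable ψ :=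
  h.1.continuous.integrable_of_hasCompactSupport h.2

theorem IsTest.deriv {ψ : ℝ → ℂ} (h : IsTest ψ) : IsTest (deriv ψ) :=
  ⟨(contDiff_infty_iff_deriv.1 h.1).2, h.2.deriv⟩

theorem IsTest.hasDerivAt {ψ : ℝ → ℂ} (h : IsTest ψ) (t : ℝ) : HasDerivAt ψ (_root_.deriv ψ t) t :=
  ((h.1.differentiable (by simp)) t).hasDerivAt

/-- Fourth-order decay suffices for everything below: pairing with a `Tempered` function costs one
bracket, a time derivative costs one factor τ, and O(⟨τ⟩⁻²) is left. -/
theorem IsTest.ft_decay {ψ : ℝ → ℂ} (h : IsTest ψ) :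
    ∃ C, 0 < C ∧ ∀ τ, ‖ft ψ τ‖ ≤ C * ((1 + τ ^ 2) ^ 2)⁻¹ := by
  set S : SchwartzMap ℝ ℂ := 𝓕⁻ (h.2.toSchwartzMap h.1) with hS
  have hft : ∀ τ, ft ψ τ = S (τ / (2 * Real.pi)) := fun τ => by
    rw [ft_eq_fourierInv, hS, SchwartzMap.fourierInv_coe]; rfl
  obtain ⟨C0, h0, hC0⟩ := S.decay 0 0
  obtain ⟨C4, h4, hC4⟩ := S.decay 4 0
  simp only [pow_zero, one_mul, norm_iteratedFDeriv_zero] at hC0 hC4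
  -- Since (1+τ²)² ≤ 2 + 2τ⁴, the seminorms of orders 0 and 4 are enough; (2π)⁴ undoes the rescaling
  -- of the frequency.
  refine ⟨2 * C0 + 2 * (2 * Real.pi) ^ 4 * C4, by positivity, fun τ => ?_⟩
  rw [hft, ← div_eq_mul_inv, le_div_iff₀ (by positivity)]
  have e4 := hC4 (τ / (2 * Real.pi))
  have e0 := hC0 (τ / (2 * Real.pi))
  have e : τ ^ 4 * ‖S (τ / (2 * Real.pi))‖ ≤ (2 * Real.pi) ^ 4 * C4 := by
    have : τ ^ 4 = (2 * Real.pi) ^ 4 * ‖τ / (2 * Real.pi)‖ ^ 4 := by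
      rw [Real.norm_eq_abs, (by decide : Even 4).pow_abs, ← mul_pow]
      congr 1; field_simp
    rw [this, mul_assoc]; gcongr
  nlinarith [norm_nonneg (S (τ / (2 * Real.pi))), sq_nonneg (τ ^ 2 - 1)]

/-- `a` is the (unnormalised) `L²` Fourier transform of `F`. -/
structure IsL2Transform (F a : ℝ → ℂ) : Prop where
  memLp : MemLp a 2 volume
  pairing : ∀ ψ, IsTest ψ → ∫ t, a t * ψ t = ∫ τ, F τ * ft ψ τ
  norm_eq : eLpNorm a 2 volume = ENNReal.ofReal (Real.sqrt (2 * Real.pi)) * eLpNorm F 2 volume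

theorem eLpNorm_two_sq {α : Type*} [MeasurableSpace α] (f : α → ℂ) (μ : Measure α) :
    eLpNorm f 2 μ ^ 2 = ∫⁻ x, ‖f x‖ₑ ^ 2 ∂μ := by
  rw [eLpNorm_eq_lintegral_rpow_enorm_toReal (by simp) (by simp)]
  simp only [ENNReal.toReal_ofNat, ENNReal.rpow_ofNat]
  rw [← ENNReal.rpow_natCast, ← ENNReal.rpow_mul]
  simp

/-- The integral need not converge for F merely in L², so the transform is the L² inverse Fourier
transform dilated by 2π, to pass from exp(2πitτ) to exp(itτ). Plancherel and the dilation give the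
factor √(2π); the pairing is compatibility with tempered distributions. -/
theorem exists_isL2Transform {F : ℝ → ℂ} (hF : MemLp F 2 volume) : ∃ a, IsL2Transform F a := by
  set f : Lp ℂ 2 (volume : Measure ℝ) := hF.toLp F
  set g : Lp ℂ 2 (volume : Measure ℝ) := 𝓕⁻ f with hg
  have hpi : (0 : ℝ) < 2 * Real.pi := by positivity
  have hc : (2 * Real.pi)⁻¹ ≠ (0 : ℝ) := by positivity
  have hmap := Real.map_volume_mul_right hc
  have hae : AEMeasurable (fun t : ℝ => t * (2 * Real.pi)⁻¹) volume := by fun_prop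
  have hmeas : AEStronglyMeasurable (g : ℝ → ℂ)
      (Measure.map (fun t : ℝ => t * (2 * Real.pi)⁻¹) volume) := by
    rw [hmap]
    exact (Lp.memLp g).1.smul_measure _
  have hnorm : eLpNorm (fun t => (g : ℝ → ℂ) (t * (2 * Real.pi)⁻¹)) 2 volume =
      ENNReal.ofReal (Real.sqrt (2 * Real.pi)) * eLpNorm F 2 volume := by
    have h1 := eLpNorm_map_measure (p := 2) hmeas hae
    rw [Function.comp_def] at h1
    rw [← h1, hmap, eLpNorm_smul_measure_of_ne_zero (by simp)]
    have h2 : eLpNorm (g : ℝ → ℂ) 2 volume = eLpNorm F 2 volume := by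
      have h3 : ‖g‖ = ‖f‖ := by
        rw [hg, ← Lp.norm_fourier_eq, FourierTransform.fourier_fourierInv_eq]
      rw [← Lp.enorm_def, ← eLpNorm_congr_ae hF.coeFn_toLp, ← Lp.enorm_def, ← ofReal_norm,
        ← ofReal_norm, h3]
    rw [h2, smul_eq_mul]
    congr 1
    simp only [inv_inv, abs_of_pos hpi, one_div, ENNReal.toReal_inv, ENNReal.toReal_ofNat]
    rw [ENNReal.ofReal_rpow_of_pos hpi, Real.sqrt_eq_rpow]
    norm_num
  refine ⟨fun t => (g : ℝ → ℂ) (t * (2 * Real.pi)⁻¹), ⟨⟨?_, ?_⟩, fun ψ hψ => ?_, hnorm⟩⟩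
  · exact hmeas.comp_aemeasurable hae
  · rw [hnorm]; exact ENNReal.mul_lt_top ENNReal.ofReal_lt_top hF.2
  · have hψ' : IsTest fun t => ψ (2 * Real.pi * t) := by
      refine ⟨hψ.1.comp (contDiff_const.mul contDiff_id), ?_⟩
      exact hψ.2.comp_homeomorph (Homeomorph.mulLeft₀ _ hpi.ne')
    set S : SchwartzMap ℝ ℂ := hψ'.2.toSchwartzMap hψ'.1 with hS
    have key := congrArg (fun D : TemperedDistribution ℝ ℂ => D S)
      (Lp.fourierInv_toTemperedDistribution_eq f)
    simp only [TemperedDistribution.fourierInv_apply, Lp.toTemperedDistribution_apply] at key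
    have hcv : ∫ t, (g : ℝ → ℂ) (t * (2 * Real.pi)⁻¹) * ψ t =
        (2 * Real.pi : ℝ) • ∫ t, S t • (g : ℝ → ℂ) t := by
      have := Measure.integral_comp_mul_right (fun t => S t • (g : ℝ → ℂ) t) (2 * Real.pi)⁻¹
      rw [inv_inv, abs_of_pos hpi] at this
      rw [← this]
      congr 1; ext t
      have : S (t * (2 * Real.pi)⁻¹) = ψ t := by
        change ψ (2 * Real.pi * (t * (2 * Real.pi)⁻¹)) = ψ t
        congr 1; field_simp
      rw [this, smul_eq_mul, mul_comm]
    rw [hcv, ← key, ← integral_smul]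
    refine integral_congr_ae ?_
    filter_upwards [hF.coeFn_toLp] with τ hτ
    rw [hτ]
    have h3 : (𝓕⁻ S : SchwartzMap ℝ ℂ) τ = ((2 * Real.pi)⁻¹ : ℝ) • ft ψ τ := by
      have : (𝓕⁻ S : SchwartzMap ℝ ℂ) τ = ft (fun t => ψ (2 * Real.pi * t)) (2 * Real.pi * τ) := by
        rw [ft_eq_fourierInv, SchwartzMap.fourierInv_coe, mul_div_cancel_left₀ _ hpi.ne']; rfl
      rw [this, ft]
      have := Measure.integral_comp_mul_left
        (fun t : ℝ => ψ t * Complex.exp (Complex.I * (t * τ))) (2 * Real.pi)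
      rw [abs_of_pos (by positivity)] at this
      rw [ft, ← this]
      congr 1; ext t; congr 3
      push_cast; ring
    rw [h3]
    simp only [Complex.real_smul, smul_eq_mul]
    push_cast
    have : (Real.pi : ℂ) ≠ 0 := by exact_mod_cast Real.pi_ne_zero
    field_simp

/-- The fundamental lemma of the calculus of variations. The open set is left free because some
functions can be compared only on (0,T). -/
theorem IsL2Transform.ae_eq_on {a a' : ℝ → ℂ} (ha : MemLp a 2 volume) (ha' : MemLp a' 2 volume)
    {U : Set ℝ} (hU : IsOpen U)
    (h : ∀ ψ, IsTest ψ → tsupport ψ ⊆ U → ∫ t, a t * ψ t = ∫ t, a' t * ψ t) :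
    ∀ᵐ t, t ∈ U → a t = a' t := by
  have hl : LocallyIntegrable (fun t => a t - a' t) volume :=
    (ha.sub ha').locallyIntegrable (by norm_num)
  have := hU.ae_eq_zero_of_integral_contDiff_smul_eq_zero (μ := volume)
    (f := fun t => a t - a' t) (hl.locallyIntegrableOn U) fun χ hχ hc hs => ?_
  · filter_upwards [this] with t ht htU using sub_eq_zero.1 (ht htU)
  · have hT : IsTest fun t => (χ t : ℂ) :=
      ⟨Complex.ofRealCLM.contDiff.comp hχ, hc.comp_left (g := fun x : ℝ => (x : ℂ)) (by simp)⟩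
    have hs' : tsupport (fun t => (χ t : ℂ)) ⊆ U :=
      (closure_mono fun t ht => by simpa using ht).trans hs
    have e := h _ hT hs'
    have hm : MemLp (fun t => (χ t : ℂ)) 2 volume :=
      hT.1.continuous.memLp_of_hasCompactSupport hT.2
    have i1 : Integrable (fun t => a t * (χ t : ℂ)) := ha.integrable_mul hm
    have i2 : Integrable (fun t => a' t * (χ t : ℂ)) := ha'.integrable_mul hm
    rw [← sub_eq_zero, ← integral_sub i1 i2] at e
    rw [← e]
    congr 1; ext t
    rw [Complex.real_smul]; ring

theorem isL2Transform_ft {A : ℝ → ℂ} (h1 : Integrable A) (h2 : MemLp A 2 volume) :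
    IsL2Transform A (ft A) := by
  obtain ⟨a, ha⟩ := exists_isL2Transform h2
  have hl1 : LocallyIntegrable a volume := ha.memLp.locallyIntegrable (by norm_num)
  have hl2 : LocallyIntegrable (ft A) volume := (continuous_ft h1).locallyIntegrable
  have hp : ∀ ψ, IsTest ψ → ∫ t, ft A t * ψ t = ∫ τ, A τ * ft ψ τ := fun ψ hψ => by
    rw [← integral_mul_ft h1 hψ.integrable]; simp only [mul_comm]
  have key : ∀ᵐ t, a t = ft A t := by
    refine ae_eq_of_integral_contDiff_smul_eq hl1 hl2 fun χ hχ hc => ?_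
    have hT : IsTest fun t => (χ t : ℂ) :=
      ⟨Complex.ofRealCLM.contDiff.comp hχ, hc.comp_left (g := fun x : ℝ => (x : ℂ)) (by simp)⟩
    have := (ha.pairing _ hT).trans (hp _ hT).symm
    simpa only [Complex.real_smul, mul_comm] using this
  exact ⟨ha.memLp.ae_eq key, hp, by rw [← ha.norm_eq]; exact (eLpNorm_congr_ae key).symm⟩

/-! ### Japanese brackets and weighted L² norms in τ. -/

theorem bracket_pos (x : ℝ) : 0 < bracket x := Real.sqrt_pos.2 (by positivity)

theorem one_le_bracket (x : ℝ) : 1 ≤ bracket x :=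
  Real.one_le_sqrt.2 (le_add_of_nonneg_right (sq_nonneg x))

theorem bracket_sq (x : ℝ) : bracket x ^ 2 = 1 + x ^ 2 := Real.sq_sqrt (by positivity)

theorem bracket_neg (x : ℝ) : bracket (-x) = bracket x := by simp [bracket]

theorem continuous_bracket : Continuous bracket := by unfold bracket; fun_prop

theorem abs_le_bracket (x : ℝ) : |x| ≤ bracket x :=
  Real.abs_le_sqrt (le_add_of_nonneg_left zero_le_one)

theorem bracket_le_one_add_abs (x : ℝ) : bracket x ≤ 1 + |x| := by
  refine Real.sqrt_le_iff.2 ⟨by positivity, ?_⟩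
  nlinarith [sq_abs x, abs_nonneg x]

theorem bracket_add_le (x y : ℝ) : bracket (x + y) ≤ 2 * (bracket x * bracket y) := by
  refine Real.sqrt_le_iff.2 ⟨by have := bracket_pos x; have := bracket_pos y; positivity, ?_⟩
  rw [mul_pow, mul_pow, bracket_sq, bracket_sq]
  nlinarith [sq_nonneg (x - y), sq_nonneg (x * y), sq_nonneg x, sq_nonneg y]

/-- Peetre's inequality. -/
theorem bracket_rpow_le {s : ℝ} (hs : |s| ≤ 1) (x y : ℝ) :
    bracket x ^ s ≤ 2 * (bracket y ^ s * bracket (x - y) ^ |s|) := by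
  have key : ∀ r : ℝ, 0 ≤ r → r ≤ 1 → ∀ x y : ℝ,
      bracket x ^ r ≤ 2 * (bracket y ^ r * bracket (x - y) ^ r) := by
    intro r h0 h1 x y
    have hx := bracket_pos x; have hy := bracket_pos y; have hxy := bracket_pos (x - y)
    have h := bracket_add_le y (x - y)
    rw [add_sub_cancel] at h
    refine (Real.rpow_le_rpow hx.le h h0).trans ?_
    rw [Real.mul_rpow (by norm_num) (by positivity), Real.mul_rpow hy.le hxy.le]
    gcongr
    exact (Real.rpow_le_rpow_of_exponent_le (by norm_num) h1).trans_eq (Real.rpow_one 2)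
  rcases le_total 0 s with h | h
  · rw [abs_of_nonneg h]
    rw [abs_of_nonneg h] at hs
    exact key s h hs x y
  · rw [abs_of_nonpos h] at hs ⊢
    have := key (-s) (by linarith) hs y x
    rw [← neg_sub x y, bracket_neg] at this
    have hx := Real.rpow_pos_of_pos (bracket_pos x) s
    have hy := Real.rpow_pos_of_pos (bracket_pos y) s
    have e1 : bracket x ^ s * bracket x ^ (-s) = 1 := by
      rw [← Real.rpow_add (bracket_pos x)]; simp
    have e2 : bracket y ^ s * bracket y ^ (-s) = 1 := by
      rw [← Real.rpow_add (bracket_pos y)]; simp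
    calc bracket x ^ s = bracket x ^ s * bracket y ^ s * bracket y ^ (-s) := by
          rw [mul_assoc, e2, mul_one]
      _ ≤ bracket x ^ s * bracket y ^ s * (2 * (bracket x ^ (-s) * bracket (x - y) ^ (-s))) := by
          gcongr
      _ = 2 * (bracket y ^ s * bracket (x - y) ^ (-s)) * (bracket x ^ s * bracket x ^ (-s)) := by
          ring
      _ = _ := by rw [e1, mul_one]

/-- `A` multiplied by the weight `⟨τ - c⟩ ^ s`. -/
def weighted (s c : ℝ) (A : ℝ → ℂ) (τ : ℝ) : ℂ := ((bracket (τ - c) ^ s : ℝ) : ℂ) * A τ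

/-- The `L²` norm with weight `⟨τ - c⟩ ^ s`. -/
def modeNorm (s c : ℝ) (A : ℝ → ℂ) : ℝ≥0∞ := eLpNorm (weighted s c A) 2 volume

theorem enorm_weighted (s c : ℝ) (A : ℝ → ℂ) (τ : ℝ) :
    ‖weighted s c A τ‖ₑ = ENNReal.ofReal (bracket (τ - c) ^ s) * ‖A τ‖ₑ := by
  have := Real.rpow_nonneg (bracket_pos (τ - c)).le s
  rw [weighted, enorm_mul, ← ofReal_norm, Complex.norm_real, Real.norm_of_nonneg this]

theorem modeNorm_sq (s c : ℝ) (A : ℝ → ℂ) : modeNorm s c A ^ 2 =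
    ∫⁻ τ, ENNReal.ofReal (bracket (τ - c) ^ (2 * s)) * ‖A τ‖ₑ ^ 2 := by
  rw [modeNorm, eLpNorm_two_sq]
  congr 1; ext τ
  rw [enorm_weighted, mul_pow, ← ENNReal.ofReal_pow (Real.rpow_nonneg (bracket_pos _).le _),
    ← Real.rpow_natCast, ← Real.rpow_mul (bracket_pos _).le, mul_comm s]
  norm_num

theorem weighted_zero (c : ℝ) (A : ℝ → ℂ) : weighted 0 c A = A := by
  ext τ; simp [weighted]

theorem modeNorm_zero (c : ℝ) (A : ℝ → ℂ) : modeNorm 0 c A = eLpNorm A 2 volume := by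
  rw [modeNorm, weighted_zero]

theorem continuous_bracket_rpow (s c : ℝ) : Continuous fun τ => bracket (τ - c) ^ s :=
  (continuous_bracket.comp (continuous_sub_right c)).rpow_const fun _ => .inl (bracket_pos _).ne'

theorem aestronglyMeasurable_weighted {A : ℝ → ℂ} (hA : AEStronglyMeasurable A volume) (s c : ℝ) :
    AEStronglyMeasurable (weighted s c A) volume :=
  (Complex.continuous_ofReal.comp (continuous_bracket_rpow s c)).aestronglyMeasurable.mul hA

theorem modeNorm_mul_le {A m : ℝ → ℂ} (hm : ∀ τ, ‖m τ‖ ≤ 1) (s c : ℝ) :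
    modeNorm s c (fun τ => A τ * m τ) ≤ modeNorm s c A := by
  refine eLpNorm_mono fun τ => ?_
  simp only [weighted, norm_mul]
  gcongr
  exact mul_le_of_le_one_right (norm_nonneg _) (hm τ)

/-! ### Tempered frequency profiles and time derivatives. -/

/-- Measurable functions that are square integrable with weight `⟨τ⟩⁻¹`. -/
def Tempered (H : ℝ → ℂ) : Prop := MemLp (weighted (-1) 0 H) 2 volume

/-- Peetre's inequality moves the centre of the weight from c to 0 at the price of a factor ⟨c⟩,
harmless since only finiteness is wanted. The bound s ≥ -1 is where b ≤ 1 enters for the weights of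
order -b. -/
theorem Tempered.of_modeNorm {H : ℝ → ℂ} (hH : AEStronglyMeasurable H volume) {s c : ℝ}
    (hs : -1 ≤ s) (h : modeNorm s c H < ∞) : Tempered H := by
  refine ⟨aestronglyMeasurable_weighted hH _ _, ?_⟩
  have hb : ∀ τ, ‖weighted (-1) 0 H τ‖ ≤ (2 * bracket c) * ‖weighted s c H τ‖ := fun τ => by
    have h0 := bracket_pos (τ - c)
    simp only [weighted, norm_mul, Complex.norm_real,
      Real.norm_of_nonneg (Real.rpow_nonneg (bracket_pos _).le _)]
    rw [← mul_assoc]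
    gcongr
    have := bracket_rpow_le (s := -1) (by norm_num) (τ - 0) (τ - c)
    simp only [abs_neg, abs_one, Real.rpow_one] at this
    rw [show τ - 0 - (τ - c) = c by ring] at this
    have h2 : bracket (τ - c) ^ (-1 : ℝ) ≤ bracket (τ - c) ^ s :=
      Real.rpow_le_rpow_of_exponent_le (one_le_bracket _) hs
    have h3 := bracket_pos c
    calc _ ≤ _ := this
      _ = 2 * bracket c * bracket (τ - c) ^ (-1 : ℝ) := by ring
      _ ≤ _ := by gcongr
  refine (eLpNorm_le_mul_eLpNorm_of_ae_le_mul (ae_of_all _ hb) 2).trans_lt ?_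
  exact ENNReal.mul_lt_top ENNReal.ofReal_lt_top h

theorem memLp_of_decay {k : ℝ → ℂ} (hk : Continuous k) {C : ℝ}
    (hC : ∀ τ, ‖k τ‖ ≤ C * (1 + τ ^ 2)⁻¹) : MemLp k 2 volume := by
  have h1 : MemLp (fun τ : ℝ => C * (1 + τ ^ 2)⁻¹) 2 volume := by
    have hc : Continuous fun τ : ℝ => C * (1 + τ ^ 2)⁻¹ :=
      continuous_const.mul ((by fun_prop : Continuous fun τ : ℝ => 1 + τ ^ 2).inv₀
        fun τ => by positivity)
    rw [memLp_two_iff_integrable_sq hc.aestronglyMeasurable]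
    refine (integrable_inv_one_add_sq.const_mul (C ^ 2)).mono'
      (hc.pow 2).aestronglyMeasurable (ae_of_all _ fun τ => ?_)
    rw [Real.norm_of_nonneg (sq_nonneg _), mul_pow]
    gcongr
    rw [sq]
    exact mul_le_of_le_one_right (by positivity) (inv_le_one_of_one_le₀ (by nlinarith))
  refine h1.mono' hk.aestronglyMeasurable (ae_of_all _ hC)

theorem Tempered.integrable_mul {H k : ℝ → ℂ} (hH : Tempered H) (hk : Continuous k) {C : ℝ}
    (hC : ∀ τ, ‖k τ‖ * bracket τ ≤ C * (1 + τ ^ 2)⁻¹) : Integrable fun τ => H τ * k τ := by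
  have h1 : MemLp (fun τ => (bracket τ : ℂ) * k τ) 2 volume := by
    refine memLp_of_decay
      ((Complex.continuous_ofReal.comp continuous_bracket).mul hk) (C := C) fun τ => ?_
    rw [norm_mul, Complex.norm_real, Real.norm_of_nonneg (bracket_pos τ).le, mul_comm]
    exact hC τ
  refine (MemLp.integrable_mul hH h1).congr (ae_of_all _ fun τ => ?_)
  simp only [weighted, sub_zero, Real.rpow_neg_one, Complex.ofReal_inv, Pi.mul_apply]
  have : (bracket τ : ℂ) ≠ 0 := by exact_mod_cast (bracket_pos τ).ne'
  field_simp

theorem bracket_le_one_add_sq (τ : ℝ) : bracket τ ≤ 1 + τ ^ 2 := by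
  rw [← bracket_sq]
  nlinarith [one_le_bracket τ]

theorem abs_mul_bracket_le (τ : ℝ) : |τ| * bracket τ ≤ 1 + τ ^ 2 := by
  rw [← bracket_sq, sq]
  exact mul_le_mul_of_nonneg_right (abs_le_bracket τ) (bracket_pos τ).le

theorem Tempered.integrable_mul_ft {H ψ : ℝ → ℂ} (hH : Tempered H) (hψ : IsTest ψ) :
    Integrable fun τ => H τ * ft ψ τ := by
  obtain ⟨C, hC0, hC⟩ := hψ.ft_decay
  refine hH.integrable_mul (continuous_ft hψ.integrable) (C := C) fun τ => ?_
  calc _ ≤ C * ((1 + τ ^ 2) ^ 2)⁻¹ * (1 + τ ^ 2) := by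
        exact mul_le_mul (hC τ) (bracket_le_one_add_sq τ) (bracket_pos τ).le (by positivity)
    _ = _ := by field_simp

theorem Tempered.integrable_mul_mul_ft {H ψ : ℝ → ℂ} (hH : Tempered H) (hψ : IsTest ψ) :
    Integrable fun τ : ℝ => (τ : ℂ) * (H τ * ft ψ τ) := by
  obtain ⟨C, hC0, hC⟩ := hψ.ft_decay
  have := hH.integrable_mul (k := fun τ : ℝ => τ * ft ψ τ)
    (Complex.continuous_ofReal.mul (continuous_ft hψ.integrable)) (C := C) fun τ => ?_
  · refine this.congr (ae_of_all _ fun τ => ?_)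
    ring
  · calc _ = ‖ft ψ τ‖ * (|τ| * bracket τ) := by
          rw [norm_mul, Complex.norm_real, Real.norm_eq_abs]; ring
      _ ≤ C * ((1 + τ ^ 2) ^ 2)⁻¹ * (1 + τ ^ 2) := by
          exact mul_le_mul (hC τ) (abs_mul_bracket_le τ)
            (mul_nonneg (abs_nonneg τ) (bracket_pos τ).le) (by positivity)
      _ = _ := by field_simp

theorem ft_deriv {ψ : ℝ → ℂ} (hψ : IsTest ψ) (τ : ℝ) :
    ft (deriv ψ) τ = -(Complex.I * τ) * ft ψ τ := by
  have he : ∀ t : ℝ, HasDerivAt (fun t : ℝ => Complex.exp (Complex.I * (t * τ)))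
      (Complex.I * τ * Complex.exp (Complex.I * (t * τ))) t := fun t => by
    have h1 : HasDerivAt (fun t : ℝ => Complex.I * ((t : ℂ) * τ)) (Complex.I * τ) t := by
      simpa using ((Complex.ofRealCLM.hasDerivAt (x := t)).mul_const (τ : ℂ)).const_mul Complex.I
    convert h1.cexp using 1
    ring
  have := integral_mul_deriv_eq_deriv_mul_of_integrable (u := ψ) (u' := deriv ψ)
    (v := fun t : ℝ => Complex.exp (Complex.I * (t * τ)))
    (v' := fun t : ℝ => Complex.I * τ * Complex.exp (Complex.I * (t * τ)))
    (fun t _ => hψ.hasDerivAt t) (fun t _ => he t) ?_ (integrable_mul_exp hψ.deriv.integrable τ)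
    (integrable_mul_exp hψ.integrable τ)
  · rw [ft, ← neg_neg (∫ t : ℝ, deriv ψ t * _), ← this, ft, neg_mul, ← integral_const_mul]
    congr 2; ext t; ring
  · refine ((integrable_mul_exp hψ.integrable τ).const_mul (Complex.I * τ)).congr
      (ae_of_all _ fun t => ?_)
    simp only [Pi.mul_apply]; ring

theorem hasDerivAt_ft {A : ℝ → ℂ} (h0 : Integrable A) (h1 : Integrable fun τ : ℝ => (τ : ℂ) * A τ)
    (t : ℝ) : HasDerivAt (ft A) (Complex.I * ft (fun τ : ℝ => (τ : ℂ) * A τ) t) t := by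
  have := (hasDerivAt_integral_of_dominated_loc_of_deriv_le (μ := volume) (x₀ := t)
    (F := fun (t τ : ℝ) => A τ * Complex.exp (Complex.I * (τ * t)))
    (F' := fun (t τ : ℝ) => Complex.I * ((τ : ℂ) * A τ * Complex.exp (Complex.I * (τ * t))))
    (bound := fun τ : ℝ => ‖(τ : ℂ) * A τ‖) univ_mem
    (Eventually.of_forall fun t => (integrable_mul_exp h0 t).aestronglyMeasurable)
    (integrable_mul_exp h0 t)
    ((integrable_mul_exp h1 t).const_mul _).aestronglyMeasurable
    (ae_of_all _ fun τ x _ => by simp [norm_exp_I_mul]) h1.norm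
    (ae_of_all _ fun τ x _ => ?_)).2
  · rw [integral_const_mul] at this
    exact this
  · have h1 : HasDerivAt (fun t : ℝ => Complex.I * ((τ : ℂ) * t)) (Complex.I * τ) x := by
      simpa using ((Complex.ofRealCLM.hasDerivAt (x := x)).const_mul (τ : ℂ)).const_mul Complex.I
    refine (h1.cexp.const_mul (A τ)).congr_deriv ?_
    ring

/-! ### Mollification in time and localisation to (0,T). -/

/-- The distribution with Fourier transform `H` vanishes on `(0, T)`. -/
def Vanishes (T : ℝ) (H : ℝ → ℂ) : Prop :=
  ∀ ψ, IsTest ψ → tsupport ψ ⊆ Ioo 0 T → ∫ τ, H τ * ft ψ τ = 0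

/-- The radius of the `j`-th mollifier. -/
def mollRadius (j : ℕ) : ℝ := 1 / ((j : ℝ) + 1)

theorem mollRadius_pos (j : ℕ) : 0 < mollRadius j := Nat.one_div_pos_of_nat

theorem tendsto_mollRadius : Tendsto mollRadius atTop (𝓝 0) :=
  tendsto_one_div_add_atTop_nhds_zero_nat

/-- Bump functions shrinking to the origin. -/
def mollBump (j : ℕ) : ContDiffBump (0 : ℝ) :=
  ⟨mollRadius j / 2, mollRadius j, half_pos (mollRadius_pos j), half_lt_self (mollRadius_pos j)⟩

/-- A sequence of even mollifiers on the line. -/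
def moll (j : ℕ) (t : ℝ) : ℂ := ((mollBump j).normed volume t : ℝ)

theorem isTest_moll (j : ℕ) : IsTest (moll j) :=
  ⟨Complex.ofRealCLM.contDiff.comp (mollBump j).contDiff_normed,
    (mollBump j).hasCompactSupport_normed.comp_left (g := fun x : ℝ => (x : ℂ)) (by simp)⟩

theorem moll_eq_zero {j : ℕ} {t : ℝ} (h : mollRadius j ≤ |t|) : moll j t = 0 := by
  have : t ∉ Function.support ((mollBump j).normed volume) := by
    rw [(mollBump j).support_normed_eq]
    simpa [mollBump] using h
  simpa [moll] using this

theorem integral_norm_moll (j : ℕ) : ∫ t, ‖moll j t‖ = 1 := by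
  rw [← (mollBump j).integral_normed (μ := volume)]
  congr 1; ext t
  rw [moll, Complex.norm_real, Real.norm_of_nonneg ((mollBump j).nonneg_normed t)]

theorem integral_moll (j : ℕ) : ∫ t, moll j t = 1 := by
  have : ∫ t, moll j t = ((∫ t, (mollBump j).normed volume t : ℝ) : ℂ) := integral_ofReal
  rw [this, (mollBump j).integral_normed (μ := volume), Complex.ofReal_one]

/-- The Fourier multiplier of the `j`-th mollifier. -/
def mollHat (j : ℕ) : ℝ → ℂ := ft (moll j)

theorem norm_mollHat_le (j : ℕ) (τ : ℝ) : ‖mollHat j τ‖ ≤ 1 :=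
  (norm_ft_le _ _).trans_eq (integral_norm_moll j)

theorem continuous_mollHat (j : ℕ) : Continuous (mollHat j) :=
  continuous_ft (isTest_moll j).integrable

theorem norm_mollHat_sub_one_le (j : ℕ) (τ : ℝ) : ‖mollHat j τ - 1‖ ≤ mollRadius j * |τ| := by
  have hi := (isTest_moll j).integrable
  rw [mollHat, ft, ← integral_moll j, ← integral_sub (integrable_mul_exp hi τ) hi]
  refine (norm_integral_le_of_norm_le (hi.norm.const_mul (mollRadius j * |τ|))
    (ae_of_all _ fun t => ?_)).trans_eq ?_
  · rcases le_or_gt (mollRadius j) |t| with h | h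
    · simp [moll_eq_zero h]
    · rw [← mul_sub_one, norm_mul, mul_comm]
      gcongr
      have := Real.norm_exp_I_mul_ofReal_sub_one_le (x := t * τ)
      push_cast at this
      refine this.trans ?_
      rw [norm_mul]
      exact mul_le_mul_of_nonneg_right h.le (norm_nonneg _)
  · rw [integral_const_mul, integral_norm_moll, mul_one]

theorem tendsto_mollHat (τ : ℝ) : Tendsto (fun j => mollHat j τ) atTop (𝓝 1) := by
  rw [tendsto_iff_norm_sub_tendsto_zero]
  refine squeeze_zero (fun _ => norm_nonneg _) (fun j => norm_mollHat_sub_one_le j τ) ?_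
  simpa using tendsto_mollRadius.mul_const |τ|

theorem ft_moll_sub (j : ℕ) (t τ : ℝ) :
    ft (fun r => moll j (r - t)) τ = Complex.exp (Complex.I * (τ * t)) * mollHat j τ := by
  have := integral_sub_right_eq_self (μ := volume)
    (fun r : ℝ => moll j r * Complex.exp (Complex.I * ((r + t : ℝ) * τ))) t
  simp only [sub_add_cancel] at this
  rw [ft, this, mollHat, ft, ← integral_const_mul]
  congr 1; ext r
  rw [mul_left_comm (Complex.exp _), ← Complex.exp_add]
  congr 2; push_cast; ring

/-- The mollified function at t is the pairing with the mollifier translated to t, which is an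
admissible test function once t is further than its radius from both ends of (0,T). This turns
distributional identities into pointwise ones. -/
theorem Vanishes.ft_mollHat {T : ℝ} {H : ℝ → ℂ} (h : Vanishes T H) (j : ℕ) {t : ℝ}
    (ht : t ∈ Ioo (mollRadius j) (T - mollRadius j)) : ft (fun τ => H τ * mollHat j τ) t = 0 := by
  have hT : IsTest fun r => moll j (r - t) :=
    ⟨(isTest_moll j).1.comp (contDiff_id.sub contDiff_const),
      (isTest_moll j).2.comp_homeomorph (Homeomorph.subRight t)⟩
  have hs : tsupport (fun r => moll j (r - t)) ⊆ Icc (t - mollRadius j) (t + mollRadius j) := by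
    refine closure_minimal (fun r hr => ?_) isClosed_Icc
    by_contra hc
    refine hr (moll_eq_zero ?_)
    by_contra hlt
    have := abs_lt.1 (not_le.1 hlt)
    exact hc ⟨by linarith, by linarith⟩
  rw [← h _ hT (hs.trans fun r hr => ⟨by linarith [hr.1, ht.1], by linarith [hr.2, ht.2]⟩), ft]
  congr 1; ext τ
  rw [ft_moll_sub]; ring

theorem Tempered.integrable_mollHat {H : ℝ → ℂ} (hH : Tempered H) (j : ℕ) :
    Integrable fun τ => H τ * mollHat j τ :=
  hH.integrable_mul_ft (isTest_moll j)

theorem ft_add {A B : ℝ → ℂ} (hA : Integrable A) (hB : Integrable B) (t : ℝ) :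
    ft (fun τ => A τ + B τ) t = ft A t + ft B t := by
  rw [ft, ft, ft, ← integral_add (integrable_mul_exp hA t) (integrable_mul_exp hB t)]
  simp only [add_mul]

theorem ft_sub {A B : ℝ → ℂ} (hA : Integrable A) (hB : Integrable B) (t : ℝ) :
    ft (fun τ => A τ - B τ) t = ft A t - ft B t := by
  rw [ft, ft, ft, ← integral_sub (integrable_mul_exp hA t) (integrable_mul_exp hB t)]
  simp only [sub_mul]

theorem ft_const_mul (c : ℂ) (A : ℝ → ℂ) (t : ℝ) : ft (fun τ => c * A τ) t = c * ft A t := by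
  rw [ft, ft, ← integral_const_mul]
  simp only [mul_assoc]

theorem ft_mollHat_congr {T : ℝ} {A B : ℝ → ℂ} (hA : Tempered A) (hB : Tempered B)
    (h : Vanishes T fun τ => A τ - B τ) (j : ℕ) {t : ℝ}
    (ht : t ∈ Ioo (mollRadius j) (T - mollRadius j)) :
    ft (fun τ => A τ * mollHat j τ) t = ft (fun τ => B τ * mollHat j τ) t := by
  rw [← sub_eq_zero, ← ft_sub (hA.integrable_mollHat j) (hB.integrable_mollHat j),
    ← h.ft_mollHat j ht]
  simp only [sub_mul]

/-- The mollified equation. -/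
theorem hasDerivAt_ft_mollHat {T l : ℝ} {F G : ℝ → ℂ} (hF : Tempered F) (hG : Tempered G)
    (h : Vanishes T fun τ => G τ - ((l : ℂ) - τ) * F τ) (j : ℕ) {t : ℝ}
    (ht : t ∈ Ioo (mollRadius j) (T - mollRadius j)) :
    HasDerivAt (ft fun τ => F τ * mollHat j τ)
      (Complex.I * (l * ft (fun τ => F τ * mollHat j τ) t - ft (fun τ => G τ * mollHat j τ) t))
      t := by
  have i1 := hF.integrable_mollHat j
  have i2 : Integrable fun τ : ℝ => (τ : ℂ) * (F τ * mollHat j τ) :=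
    hF.integrable_mul_mul_ft (isTest_moll j)
  have i3 := hG.integrable_mollHat j
  have i4 : Integrable fun τ => G τ * mollHat j τ - l * (F τ * mollHat j τ) :=
    i3.sub (i1.const_mul _)
  convert hasDerivAt_ft i1 i2 t using 2
  have := h.ft_mollHat j ht
  have e : (fun τ : ℝ => (G τ - ((l : ℂ) - τ) * F τ) * mollHat j τ) = fun τ : ℝ =>
      (G τ * mollHat j τ - l * (F τ * mollHat j τ)) + τ * (F τ * mollHat j τ) := by
    ext τ; ring
  rw [e, ft_add i4 i2, ft_sub i3 (i1.const_mul _), ft_const_mul] at this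
  linear_combination -this

/-! ### The bilinear estimate for products of two modes. -/

/-- The Cauchy-Schwarz inequality. -/
theorem lintegral_enorm_mul_le {α : Type*} [MeasurableSpace α] {μ : Measure α} {f g : α → ℂ}
    (hf : AEStronglyMeasurable f μ) (hg : AEStronglyMeasurable g μ) :
    ∫⁻ x, ‖f x‖ₑ * ‖g x‖ₑ ∂μ ≤ eLpNorm f 2 μ * eLpNorm g 2 μ := by
  have := ENNReal.lintegral_mul_le_Lp_mul_Lq μ (p := 2) (q := 2) Real.HolderConjugate.two_two
    hf.enorm hg.enorm
  rw [eLpNorm_eq_lintegral_rpow_enorm_toReal (by simp) (by simp),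
    eLpNorm_eq_lintegral_rpow_enorm_toReal (by simp) (by simp)]
  simpa using this

theorem enorm_integral_mul_conj_le {α : Type*} [MeasurableSpace α] {μ : Measure α} {f g : α → ℂ}
    (hf : AEStronglyMeasurable f μ) (hg : AEStronglyMeasurable g μ) :
    ‖∫ x, f x * conj (g x) ∂μ‖ₑ ≤ eLpNorm f 2 μ * eLpNorm g 2 μ := by
  refine (enorm_integral_le_lintegral_enorm _).trans ?_
  simpa [enorm_mul] using lintegral_enorm_mul_le hf hg

/-- Young's inequality with an integrable kernel: substitute r = τ - σ, exchange the integrals and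
apply Cauchy–Schwarz for each fixed r. -/
theorem lintegral_lintegral_mul_sub_le {X Y : ℝ → ℂ} (hX : AEStronglyMeasurable X volume)
    (hY : AEStronglyMeasurable Y volume) {K : ℝ → ℝ≥0∞} (hK : Measurable K) :
    ∫⁻ τ, ∫⁻ σ, ‖X τ‖ₑ * ‖Y σ‖ₑ * K (τ - σ) ≤
      (∫⁻ r, K r) * (eLpNorm X 2 volume * eLpNorm Y 2 volume) := by
  have hXe : AEMeasurable (fun τ => ‖X τ‖ₑ) volume := hX.enorm
  have hYe : AEMeasurable (fun τ => ‖Y τ‖ₑ) volume := hY.enorm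
  have h1 : ∀ τ, ∫⁻ σ, ‖X τ‖ₑ * ‖Y σ‖ₑ * K (τ - σ) =
      ∫⁻ r, ‖X τ‖ₑ * ‖Y (τ - r)‖ₑ * K r := fun τ => by
    rw [← lintegral_sub_left_eq_self _ τ]
    simp only [sub_sub_cancel]
  simp only [h1]
  rw [lintegral_lintegral_swap]
  · rw [← lintegral_mul_const _ hK]
    refine lintegral_mono fun r => ?_
    have e : ∀ τ, ‖X τ‖ₑ * ‖Y (τ - r)‖ₑ * K r = K r * (‖X τ‖ₑ * ‖Y (τ - r)‖ₑ) := fun τ =>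
      mul_comm _ _
    simp only [e]
    have hm := measurePreserving_sub_right (volume : Measure ℝ) r
    have hm2 : AEMeasurable (fun τ => ‖X τ‖ₑ * ‖Y (τ - r)‖ₑ) volume :=
      hXe.mul (hYe.comp_quasiMeasurePreserving hm.quasiMeasurePreserving)
    rw [lintegral_const_mul'' _ hm2]
    gcongr
    refine (lintegral_enorm_mul_le hX (hY.comp_measurePreserving hm)).trans_eq ?_
    rw [eLpNorm_comp_measurePreserving hY hm]
  · refine (AEMeasurable.mul (hXe.comp_quasiMeasurePreserving
      Measure.quasiMeasurePreserving_fst) ?_).mul (hK.comp measurable_snd).aemeasurable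
    exact hYe.comp_quasiMeasurePreserving (quasiMeasurePreserving_sub volume volume)

theorem enorm_eq_weighted (s c : ℝ) (A : ℝ → ℂ) (τ : ℝ) :
    ‖A τ‖ₑ = ENNReal.ofReal (bracket (τ - c) ^ s) * ‖weighted (-s) c A τ‖ₑ := by
  rw [enorm_weighted, ← mul_assoc, ← ENNReal.ofReal_mul (Real.rpow_nonneg (bracket_pos _).le _),
    ← Real.rpow_add (bracket_pos _)]
  simp

/-- Products in time become convolutions in frequency. The kernel is the transform of the test
function, whose fast decay absorbs the bracket produced when weights are moved from τ to σ. -/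
theorem ft_mul_conj_ft {ψ B : ℝ → ℂ} (hψ : Integrable ψ) (hB : Integrable B) (τ : ℝ) :
    ft (fun t => ψ t * conj (ft B t)) τ = ∫ σ, conj (B σ) * ft ψ (τ - σ) := by
  have hi : Integrable fun t : ℝ => conj (ψ t * Complex.exp (Complex.I * (t * τ))) :=
    (Complex.conjCLE.toContinuousLinearMap.integrable_comp (integrable_mul_exp hψ τ))
  have := congrArg conj (integral_mul_ft hB hi)
  rw [← integral_conj, ← integral_conj] at this
  rw [ft]
  refine Eq.trans (integral_congr_ae (ae_of_all _ fun t => ?_))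
    (this.trans (integral_congr_ae (ae_of_all _ fun σ => ?_)))
  · simp only [map_mul, Complex.conj_conj]; ring
  · simp only
    rw [map_mul, ft_conj, Complex.conj_conj, ft, ft]
    congr 2; ext t
    rw [mul_assoc, ← Complex.exp_add]
    congr 2; push_cast; ring

/-- The constant of the bilinear estimate. -/
def testConst (ψ : ℝ → ℂ) : ℝ≥0∞ := ∫⁻ r, ENNReal.ofReal (bracket r) * ‖ft ψ r‖ₑ

theorem testConst_lt_top {ψ : ℝ → ℂ} (hψ : IsTest ψ) : testConst ψ < ∞ := by
  obtain ⟨C, hC0, hC⟩ := hψ.ft_decay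
  have hi : Integrable fun r => bracket r * ‖ft ψ r‖ := by
    have hc : Continuous fun r => bracket r * ‖ft ψ r‖ :=
      continuous_bracket.mul (continuous_ft hψ.integrable).norm
    refine (integrable_inv_one_add_sq.const_mul C).mono' hc.aestronglyMeasurable
      (ae_of_all _ fun r => ?_)
    rw [Real.norm_of_nonneg (mul_nonneg (bracket_pos r).le (norm_nonneg _))]
    calc _ ≤ (1 + r ^ 2) * (C * ((1 + r ^ 2) ^ 2)⁻¹) :=
          mul_le_mul (bracket_le_one_add_sq r) (hC r) (norm_nonneg _) (by positivity)
      _ = _ := by field_simp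
  refine lt_of_eq_of_lt (lintegral_congr fun r => ?_) hi.2
  rw [enorm_mul, enorm_norm, ← ofReal_norm (bracket r), Real.norm_of_nonneg (bracket_pos r).le]

/-- The bilinear estimate. -/
theorem enorm_integral_test_mul_le {ψ A B : ℝ → ℂ} (hψ : IsTest ψ) (hA : Integrable A)
    (hB : Integrable B) {s : ℝ} (hs : |s| ≤ 1) (c d : ℝ) :
    ‖∫ t, ψ t * (ft A t * conj (ft B t))‖ₑ ≤
      4 * ENNReal.ofReal (bracket (c - d) ^ |s|) * testConst ψ *
        (modeNorm (-s) c A * modeNorm s d B) := by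
  have hψB : Integrable fun t => ψ t * conj (ft B t) := by
    refine hψ.integrable.mul_bdd (c := ∫ t, ‖B t‖) ?_ (ae_of_all _ fun t => ?_)
    · exact (Complex.continuous_conj.comp (continuous_ft hB)).aestronglyMeasurable
    · rw [RCLike.norm_conj]; exact norm_ft_le _ _
  have e : ∫ t, ψ t * (ft A t * conj (ft B t)) =
      ∫ τ, A τ * ∫ σ, conj (B σ) * ft ψ (τ - σ) := by
    simp only [← ft_mul_conj_ft hψ.integrable hB]
    rw [← integral_mul_ft hA hψB]
    congr 1; ext t; ring
  rw [e]
  set K : ℝ → ℝ≥0∞ := fun r =>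
    4 * ENNReal.ofReal (bracket (c - d) ^ |s|) * (ENNReal.ofReal (bracket r) * ‖ft ψ r‖ₑ) with hK
  have hKm : Measurable K :=
    (((ENNReal.measurable_ofReal.comp continuous_bracket.measurable).mul
      (continuous_ft hψ.integrable).enorm.measurable)).const_mul _
  have hKi : ∫⁻ r, K r = 4 * ENNReal.ofReal (bracket (c - d) ^ |s|) * testConst ψ := by
    rw [hK, lintegral_const_mul' _ _ (by finiteness), testConst]
  rw [← hKi]
  refine le_trans ?_ (lintegral_lintegral_mul_sub_le
    (aestronglyMeasurable_weighted hA.1 (-s) c) (aestronglyMeasurable_weighted hB.1 s d) hKm)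
  refine (enorm_integral_le_lintegral_enorm _).trans (lintegral_mono fun τ => ?_)
  rw [enorm_mul]
  refine (mul_le_mul_right (enorm_integral_le_lintegral_enorm _) _).trans ?_
  rw [← lintegral_const_mul' _ _ enorm_ne_top]
  refine lintegral_mono fun σ => ?_
  simp only [enorm_mul, RCLike.enorm_conj]
  rw [enorm_eq_weighted s c A τ, enorm_weighted s d B σ]
  -- Peetre is applied twice, once to exchange τ - c for σ - d and once to split the difference into
  -- τ - σ and d - c; this is the origin of 4 = 2 · 2. The bracket of τ - σ is kept to the first
  -- power so that it can be put into `testConst`.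
  have hpe : bracket (τ - c) ^ s ≤ 4 * bracket (c - d) ^ |s| * bracket (τ - σ) *
      bracket (σ - d) ^ s := by
    have h1 := bracket_rpow_le hs (τ - c) (σ - d)
    have hx := bracket_pos (τ - σ); have hy := bracket_pos (d - c)
    have h2 : bracket (τ - c - (σ - d)) ^ |s| ≤ 2 * (bracket (τ - σ) * bracket (d - c) ^ |s|) := by
      have h3 := bracket_add_le (τ - σ) (d - c)
      rw [show τ - σ + (d - c) = τ - c - (σ - d) by ring] at h3
      refine (Real.rpow_le_rpow (bracket_pos _).le h3 (abs_nonneg s)).trans ?_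
      rw [Real.mul_rpow (by norm_num) (by positivity), Real.mul_rpow hx.le hy.le]
      gcongr
      · exact (Real.rpow_le_rpow_of_exponent_le (by norm_num) hs).trans_eq (Real.rpow_one 2)
      · exact (Real.rpow_le_rpow_of_exponent_le (one_le_bracket _) hs).trans_eq (Real.rpow_one _)
    rw [← neg_sub c d, bracket_neg] at h2
    have h4 := Real.rpow_pos_of_pos (bracket_pos (σ - d)) s
    calc _ ≤ _ := h1
      _ ≤ 2 * (bracket (σ - d) ^ s * (2 * (bracket (τ - σ) * bracket (c - d) ^ |s|))) := by gcongr
      _ = _ := by ring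
  have hpe' := ENNReal.ofReal_le_ofReal hpe
  have p1 := (bracket_pos (τ - σ)).le
  have p2 := Real.rpow_nonneg (bracket_pos (c - d)).le |s|
  rw [ENNReal.ofReal_mul (by positivity), ENNReal.ofReal_mul (by positivity),
    ENNReal.ofReal_mul (by positivity), ENNReal.ofReal_ofNat] at hpe'
  calc _ ≤ 4 * ENNReal.ofReal (bracket (c - d) ^ |s|) * ENNReal.ofReal (bracket (τ - σ)) *
        ENNReal.ofReal (bracket (σ - d) ^ s) * ‖weighted (-s) c A τ‖ₑ *
        (‖B σ‖ₑ * ‖ft ψ (τ - σ)‖ₑ) := by gcongr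
    _ = _ := by rw [hK]; ring

/-! ### Removing the mollifier. -/

theorem IsL2Transform.sub {F a E e : ℝ → ℂ} (hF : MemLp F 2 volume) (hE : MemLp E 2 volume)
    (ha : IsL2Transform F a) (he : IsL2Transform E e) :
    IsL2Transform (fun τ => F τ - E τ) (fun t => a t - e t) := by
  obtain ⟨b, hb⟩ := exists_isL2Transform (hF.sub hE)
  have hm := ha.memLp.sub he.memLp
  have hp : ∀ ψ, IsTest ψ → ∫ t, (a t - e t) * ψ t = ∫ τ, (F τ - E τ) * ft ψ τ := fun ψ hψ => by
    have m1 : MemLp ψ 2 volume := hψ.1.continuous.memLp_of_hasCompactSupport hψ.2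
    have m2 : MemLp (ft ψ) 2 volume := (isL2Transform_ft hψ.integrable m1).memLp
    simp only [sub_mul]
    have i1 : Integrable fun t => a t * ψ t := ha.memLp.integrable_mul m1
    have i2 : Integrable fun t => e t * ψ t := he.memLp.integrable_mul m1
    have i3 : Integrable fun t => F t * ft ψ t := hF.integrable_mul m2
    have i4 : Integrable fun t => E t * ft ψ t := hE.integrable_mul m2
    rw [integral_sub i1 i2, integral_sub i3 i4, ha.pairing ψ hψ,
      he.pairing ψ hψ]
  have key := IsL2Transform.ae_eq_on hb.memLp hm isOpen_univ fun ψ hψ _ =>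
    (hb.pairing ψ hψ).trans (hp ψ hψ).symm
  refine ⟨hm, hp, ?_⟩
  have h2 := hb.norm_eq
  rw [eLpNorm_congr_ae (key.mono fun t ht => ht (mem_univ t))] at h2
  exact h2

theorem memLp_mul_mollHat {F : ℝ → ℂ} (hF : MemLp F 2 volume) (j : ℕ) :
    MemLp (fun τ => F τ * mollHat j τ) 2 volume := by
  refine hF.mono (hF.1.mul (continuous_mollHat j).aestronglyMeasurable) (ae_of_all _ fun τ => ?_)
  rw [norm_mul]
  exact mul_le_of_le_one_right (norm_nonneg _) (norm_mollHat_le j τ)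

theorem memLp_of_modeNorm {A : ℝ → ℂ} (hA : AEStronglyMeasurable A volume) {s c : ℝ} (hs : 0 ≤ s)
    (h : modeNorm s c A < ∞) : MemLp A 2 volume := by
  refine MemLp.mono (g := weighted s c A) ⟨aestronglyMeasurable_weighted hA _ _, h⟩ hA
    (ae_of_all _ fun τ => ?_)
  rw [weighted, norm_mul, Complex.norm_real, Real.norm_of_nonneg (Real.rpow_nonneg (bracket_pos _).le _)]
  exact le_mul_of_one_le_left (norm_nonneg _) (Real.one_le_rpow (one_le_bracket _) hs)

theorem eLpNorm_le_modeNorm {s : ℝ} (hs : 0 ≤ s) (c : ℝ) (A : ℝ → ℂ) :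
    eLpNorm A 2 volume ≤ modeNorm s c A := by
  refine eLpNorm_mono fun τ => ?_
  rw [weighted, norm_mul, Complex.norm_real, Real.norm_of_nonneg (Real.rpow_nonneg (bracket_pos _).le _)]
  exact le_mul_of_one_le_left (norm_nonneg _) (Real.one_le_rpow (one_le_bracket _) hs)

theorem tempered_of_memLp {F : ℝ → ℂ} (hF : MemLp F 2 volume) : Tempered F :=
  Tempered.of_modeNorm (s := 0) (c := 0) hF.1 (by norm_num) (by rw [modeNorm_zero]; exact hF.2)

theorem tendsto_eLpNorm_mul_mollHat_sub {F : ℝ → ℂ} (hF : MemLp F 2 volume) :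
    Tendsto (fun j => eLpNorm (fun τ => F τ * mollHat j τ - F τ) 2 volume) atTop (𝓝 0) := by
  have h : Tendsto (fun j => ∫⁻ τ, ‖F τ * mollHat j τ - F τ‖ₑ ^ 2) atTop
      (𝓝 (∫⁻ _ : ℝ, 0)) := by
    refine tendsto_lintegral_of_dominated_convergence' (fun τ => 4 * ‖F τ‖ₑ ^ 2) (fun j => ?_)
      (fun j => ae_of_all _ fun τ => ?_) ?_ (ae_of_all _ fun τ => ?_)
    · exact ((memLp_mul_mollHat hF j).sub hF).1.enorm.pow_const 2
    · have h1 : ‖F τ * mollHat j τ - F τ‖ₑ ≤ 2 * ‖F τ‖ₑ := by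
        rw [two_mul]
        refine enorm_sub_le.trans (add_le_add_left ?_ _)
        rw [enorm_mul]
        refine mul_le_of_le_one_right' ?_
        rw [← ofReal_norm]
        exact ENNReal.ofReal_le_one.2 (norm_mollHat_le j τ)
      calc _ ≤ (2 * ‖F τ‖ₑ) ^ 2 := pow_le_pow_left' h1 2
        _ = _ := by rw [mul_pow]; norm_num
    · rw [lintegral_const_mul' _ _ (by simp), ← eLpNorm_two_sq]
      exact ENNReal.mul_ne_top (by simp) (ENNReal.pow_ne_top hF.2.ne)
    · have h1 := ((tendsto_mollHat τ).const_mul (F τ)).sub_const (F τ)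
      simpa using ENNReal.Tendsto.pow (n := 2) h1.enorm
  have h2 := h.ennrpow_const (1 / 2)
  simp only [lintegral_zero] at h2
  rw [ENNReal.zero_rpow_of_pos (by norm_num)] at h2
  refine h2.congr fun j => ?_
  rw [← eLpNorm_two_sq, ← ENNReal.rpow_natCast, ← ENNReal.rpow_mul]
  simp

/-- By Plancherel it suffices that F · `mollHat` tends to F in L², which is dominated convergence.
This lets estimates proved for smooth mollified modes pass to the limit. -/
theorem IsL2Transform.tendsto_mollified {F a : ℝ → ℂ} (hF : MemLp F 2 volume)
    (ha : IsL2Transform F a) :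
    Tendsto (fun j => eLpNorm (fun t => ft (fun τ => F τ * mollHat j τ) t - a t) 2 volume)
      atTop (𝓝 0) := by
  have h := ENNReal.Tendsto.const_mul (a := ENNReal.ofReal (Real.sqrt (2 * Real.pi)))
    (tendsto_eLpNorm_mul_mollHat_sub hF) (Or.inr ENNReal.ofReal_ne_top)
  rw [mul_zero] at h
  refine h.congr fun j => ?_
  exact (IsL2Transform.sub (memLp_mul_mollHat hF j) hF (isL2Transform_ft
    ((tempered_of_memLp hF).integrable_mollHat j) (memLp_mul_mollHat hF j)) ha).norm_eq.symm

theorem tendsto_integral_mul_conj {α : Type*} [MeasurableSpace α] {μ : Measure α}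
    {v w : ℕ → α → ℂ} {a e : α → ℂ} {ψ : α → ℂ} {M : ℝ}
    (hψ : AEStronglyMeasurable ψ μ) (hM : ∀ t, ‖ψ t‖ ≤ M)
    (hv : ∀ j, MemLp (v j) 2 μ) (hw : ∀ j, MemLp (w j) 2 μ) (ha : MemLp a 2 μ) (he : MemLp e 2 μ)
    (hva : Tendsto (fun j => eLpNorm (fun t => v j t - a t) 2 μ) atTop (𝓝 0))
    (hwe : Tendsto (fun j => eLpNorm (fun t => w j t - e t) 2 μ) atTop (𝓝 0)) :
    Tendsto (fun j => ∫ t, ψ t * (v j t * conj (w j t)) ∂μ) atTop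
      (𝓝 (∫ t, ψ t * (a t * conj (e t)) ∂μ)) := by
  have hmul : ∀ {f : α → ℂ}, MemLp f 2 μ → MemLp (fun t => ψ t * f t) 2 μ := fun {f} hf => by
    refine (hf.const_mul (M : ℂ)).mono (hψ.mul hf.1) (ae_of_all _ fun t => ?_)
    rw [norm_mul, norm_mul, Complex.norm_real]
    gcongr
    exact (hM t).trans (Real.le_norm_self M)
  have hle : ∀ {f : α → ℂ}, MemLp f 2 μ →
      eLpNorm (fun t => ψ t * f t) 2 μ ≤ ENNReal.ofReal M * eLpNorm f 2 μ := fun {f} hf =>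
    eLpNorm_le_mul_eLpNorm_of_ae_le_mul (ae_of_all _ fun t => by
      rw [norm_mul]; gcongr; exact hM t) 2
  have hint : ∀ {f g : α → ℂ}, MemLp f 2 μ → MemLp g 2 μ →
      Integrable (fun t => ψ t * (f t * conj (g t))) μ := fun {f g} hf hg => by
    refine ((hmul hf).integrable_mul hg.star).congr (ae_of_all _ fun t => ?_)
    simp [mul_assoc]
  have hb : ∀ {f g : α → ℂ}, MemLp f 2 μ → MemLp g 2 μ →
      ‖∫ t, ψ t * (f t * conj (g t)) ∂μ‖ₑ ≤
        ENNReal.ofReal M * eLpNorm f 2 μ * eLpNorm g 2 μ := fun {f g} hf hg => by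
    refine le_trans ?_ (mul_le_mul_left (hle hf) _)
    simpa only [mul_assoc] using enorm_integral_mul_conj_le (hmul hf).1 hg.1
  rw [tendsto_iff_edist_tendsto_0]
  have h1 : Tendsto (fun j => ENNReal.ofReal M * eLpNorm (fun t => v j t - a t) 2 μ *
      eLpNorm (fun t => w j t - e t) 2 μ + ENNReal.ofReal M *
      eLpNorm (fun t => v j t - a t) 2 μ * eLpNorm e 2 μ +
      ENNReal.ofReal M * eLpNorm a 2 μ * eLpNorm (fun t => w j t - e t) 2 μ) atTop (𝓝 0) := by
    have t1 := ENNReal.Tendsto.const_mul (a := ENNReal.ofReal M) hva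
      (Or.inr ENNReal.ofReal_ne_top)
    rw [mul_zero] at t1
    have t2 := ENNReal.Tendsto.mul t1 (Or.inr ENNReal.zero_ne_top) hwe
      (Or.inr ENNReal.zero_ne_top)
    have t3 := ENNReal.Tendsto.mul_const (b := eLpNorm e 2 μ) t1 (Or.inr he.2.ne)
    have t4 := ENNReal.Tendsto.const_mul (a := ENNReal.ofReal M * eLpNorm a 2 μ) hwe
      (Or.inr (ENNReal.mul_ne_top ENNReal.ofReal_ne_top ha.2.ne))
    simpa using (t2.add t3).add t4
  refine tendsto_of_tendsto_of_tendsto_of_le_of_le tendsto_const_nhds h1 (fun _ => zero_le)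
    fun j => ?_
  have hva' := (hv j).sub ha
  have hwe' := (hw j).sub he
  have e1 : ∫ t, ψ t * (v j t * conj (w j t)) ∂μ - ∫ t, ψ t * (a t * conj (e t)) ∂μ =
      ∫ t, ψ t * ((v j t - a t) * conj (w j t - e t)) ∂μ +
      ∫ t, ψ t * ((v j t - a t) * conj (e t)) ∂μ +
      ∫ t, ψ t * (a t * conj (w j t - e t)) ∂μ := by
    have i1 := hint hva' hwe'
    have i2 := hint hva' he
    have i3 := hint ha hwe'
    simp only [Pi.sub_apply] at i1 i2 i3
    have i4 : Integrable (fun t => ψ t * ((v j t - a t) * conj (w j t - e t)) +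
        ψ t * ((v j t - a t) * conj (e t))) μ := i1.add i2
    rw [← integral_sub (hint (hv j) (hw j)) (hint ha he), ← integral_add i1 i2,
      ← integral_add i4 i3]
    congr 1; ext t
    simp only [map_sub]; ring
  rw [edist_eq_enorm_sub, e1]
  refine (enorm_add_le _ _).trans (add_le_add ((enorm_add_le _ _).trans (add_le_add ?_ ?_)) ?_)
  · exact hb hva' hwe'
  · exact hb hva' he
  · exact hb ha hwe'

/-! ### Products of two modes away from the time endpoints. -/

/-- `F` and `F₁` represent the same distribution `u` on `(0, T)`, which solves `i u' + l u = g` with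
`g` represented by `G`; the norms are those of one Fourier mode of the Bourgain spaces. -/
structure IsModeSolution (T l b c : ℝ) (F F₁ G : ℝ → ℂ) : Prop where
  meas : AEStronglyMeasurable F volume
  meas₁ : AEStronglyMeasurable F₁ volume
  measG : AEStronglyMeasurable G volume
  lt_top : modeNorm b c F < ∞
  lt_top₁ : modeNorm (-b) c F₁ < ∞
  lt_topG : modeNorm (-b) c G < ∞
  same : Vanishes T fun τ => F τ - F₁ τ
  eqn : Vanishes T fun τ => G τ - ((l : ℂ) - τ) * F τ

namespace IsModeSolution

variable {T l b c : ℝ} {F F₁ G : ℝ → ℂ}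

theorem memLp (h : IsModeSolution T l b c F F₁ G) (hb : 0 ≤ b) : MemLp F 2 volume :=
  memLp_of_modeNorm h.meas hb h.lt_top

theorem tempered (h : IsModeSolution T l b c F F₁ G) (hb : 0 ≤ b) : Tempered F :=
  tempered_of_memLp (h.memLp hb)

theorem tempered₁ (h : IsModeSolution T l b c F F₁ G) (hb : b ≤ 1) : Tempered F₁ :=
  .of_modeNorm h.meas₁ (neg_le_neg hb) h.lt_top₁

theorem temperedG (h : IsModeSolution T l b c F F₁ G) (hb : b ≤ 1) : Tempered G :=
  .of_modeNorm h.measG (neg_le_neg hb) h.lt_topG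

end IsModeSolution

/-- The derivative of ψ v conj(w) integrates to zero. Conjugation turns l' into -l', so the two free
oscillations combine into the frequency l - l'. The equations are needed only on the support of ψ;
elsewhere every term is multiplied by zero. -/
theorem integral_identity {l l' : ℝ} {ψ v w v' w' g h : ℝ → ℂ} (hψ : IsTest ψ)
    (hv : ∀ t, HasDerivAt v (v' t) t) (hw : ∀ t, HasDerivAt w (w' t) t)
    (hg : Continuous g) (hh : Continuous h)
    (hv' : ∀ t ∈ tsupport ψ, v' t = Complex.I * (l * v t - g t))
    (hw' : ∀ t ∈ tsupport ψ, w' t = Complex.I * (l' * w t - h t)) :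
    Complex.I * (l - l') * ∫ t, ψ t * (v t * conj (w t)) =
      -(∫ t, deriv ψ t * (v t * conj (w t))) + Complex.I * (∫ t, ψ t * (g t * conj (w t))) -
        Complex.I * (∫ t, ψ t * (v t * conj (h t))) := by
  have hvc : Continuous v := continuous_iff_continuousAt.2 fun t => (hv t).continuousAt
  have hwc : Continuous w := continuous_iff_continuousAt.2 fun t => (hw t).continuousAt
  have hint : ∀ {χ x y : ℝ → ℂ}, IsTest χ → Continuous x → Continuous y →
      Integrable fun t => χ t * (x t * conj (y t)) := fun {χ x y} hχ hx hy => by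
    refine (hχ.1.continuous.mul (hx.mul (Complex.continuous_conj.comp
      hy))).integrable_of_hasCompactSupport hχ.2.mul_right
  have i1 := hint hψ.deriv hvc hwc
  have i2 := hint hψ hvc hwc
  have i3 := hint hψ hg hwc
  have i4 := hint hψ hvc hh
  have i5 : Integrable fun t => Complex.I * (l - l') * (ψ t * (v t * conj (w t))) :=
    i2.const_mul _
  have i6 : Integrable fun t => Complex.I * (ψ t * (g t * conj (w t))) := i3.const_mul _
  have i7 : Integrable fun t => Complex.I * (ψ t * (v t * conj (h t))) := i4.const_mul _
  have i8 : Integrable fun t => deriv ψ t * (v t * conj (w t)) +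
      Complex.I * (l - l') * (ψ t * (v t * conj (w t))) := i1.add i5
  have i9 : Integrable fun t => deriv ψ t * (v t * conj (w t)) +
      Complex.I * (l - l') * (ψ t * (v t * conj (w t))) -
      Complex.I * (ψ t * (g t * conj (w t))) := i8.sub i6
  have hd : ∀ t, HasDerivAt (fun t => ψ t * (v t * conj (w t)))
      (deriv ψ t * (v t * conj (w t)) + Complex.I * (l - l') * (ψ t * (v t * conj (w t))) -
        Complex.I * (ψ t * (g t * conj (w t))) + Complex.I * (ψ t * (v t * conj (h t)))) t :=
    fun t => by
    have hwt : HasDerivAt (fun t => conj (w t)) (conj (w' t)) t := (hw t).star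
    refine ((hψ.hasDerivAt t).fun_mul ((hv t).fun_mul hwt)).congr_deriv ?_
    by_cases ht : t ∈ tsupport ψ
    · rw [hv' t ht, hw' t ht]
      simp only [map_mul, map_sub, Complex.conj_I, Complex.conj_ofReal]
      ring
    · rw [image_eq_zero_of_notMem_tsupport ht]; ring
  have := integral_eq_zero_of_hasDerivAt_of_integrable hd (i9.add i7) i2
  rw [integral_add i9 i7, integral_sub i8 i6, integral_add i1 i5, integral_const_mul,
    integral_const_mul, integral_const_mul] at this
  linear_combination this

theorem enorm_I_mul (z : ℂ) : ‖Complex.I * z‖ₑ = ‖z‖ₑ := by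
  rw [enorm_mul]; simp [← ofReal_norm]

/-- Interior estimates for a product of two modes. -/
theorem interior_estimate {T l l' b c d α β : ℝ} {F F₁ G E E₁ H a e ψ : ℝ → ℂ} (hb0 : 0 ≤ b)
    (hb1 : b ≤ 1) (hF : IsModeSolution T l b c F F₁ G) (hE : IsModeSolution T l' b d E E₁ H)
    (ha : IsL2Transform F a) (he : IsL2Transform E e) (hψ : IsTest ψ) (hα : 0 < α) (hβ : β < T)
    (hs : tsupport ψ ⊆ Icc α β) :
    ‖∫ t, ψ t * (a t * conj (e t))‖ₑ ≤ 4 * ENNReal.ofReal (bracket (c - d) ^ b) * testConst ψ *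
        (modeNorm (-b) c F₁ * modeNorm b d E) ∧
    ENNReal.ofReal |l - l'| * ‖∫ t, ψ t * (a t * conj (e t))‖ₑ ≤
      4 * ENNReal.ofReal (bracket (c - d) ^ b) * testConst (deriv ψ) *
        (modeNorm (-b) c F₁ * modeNorm b d E) +
      4 * ENNReal.ofReal (bracket (c - d) ^ b) * testConst ψ *
        (modeNorm (-b) c G * modeNorm b d E) +
      4 * ENNReal.ofReal (bracket (c - d) ^ b) * testConst ψ *
        (modeNorm b c F * modeNorm (-b) d H) := by
  obtain ⟨M, hM⟩ := hψ.1.continuous.bounded_above_of_compact_support hψ.2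
  have hFt := hF.tempered hb0
  have hEt := hE.tempered hb0
  have hlim : Tendsto (fun j => ∫ t, ψ t * (ft (fun τ => F τ * mollHat j τ) t *
      conj (ft (fun τ => E τ * mollHat j τ) t))) atTop (𝓝 (∫ t, ψ t * (a t * conj (e t)))) :=
    tendsto_integral_mul_conj hψ.1.continuous.aestronglyMeasurable hM
      (fun j => (isL2Transform_ft (hFt.integrable_mollHat j)
        (memLp_mul_mollHat (hF.memLp hb0) j)).memLp)
      (fun j => (isL2Transform_ft (hEt.integrable_mollHat j)
        (memLp_mul_mollHat (hE.memLp hb0) j)).memLp) ha.memLp he.memLp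
      (ha.tendsto_mollified (hF.memLp hb0)) (he.tendsto_mollified (hE.memLp hb0))
  have hr : ∀ᶠ j in atTop, mollRadius j < min α (T - β) :=
    tendsto_mollRadius.eventually_lt_const (lt_min hα (sub_pos.2 hβ))
  have hbil : ∀ (j : ℕ) {χ A B : ℝ → ℂ}, IsTest χ → Tempered A → Tempered B → ∀ s : ℝ, |s| = b →
      ‖∫ t, χ t * (ft (fun τ => A τ * mollHat j τ) t *
        conj (ft (fun τ => B τ * mollHat j τ) t))‖ₑ ≤
      4 * ENNReal.ofReal (bracket (c - d) ^ b) * testConst χ *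
        (modeNorm (-s) c A * modeNorm s d B) := fun j χ A B hχ hA hB s hs => by
    have := enorm_integral_test_mul_le hχ (hA.integrable_mollHat j) (hB.integrable_mollHat j)
      (hs.trans_le hb1) c d
    rw [hs] at this
    refine this.trans ?_
    gcongr
    · exact modeNorm_mul_le (norm_mollHat_le j) _ _
    · exact modeNorm_mul_le (norm_mollHat_le j) _ _
  have hloc : ∀ᶠ j in atTop, ∀ t ∈ Icc α β, t ∈ Ioo (mollRadius j) (T - mollRadius j) := by
    filter_upwards [hr] with j hj t ht
    have := lt_min_iff.1 hj
    exact ⟨by linarith [ht.1], by linarith [ht.2]⟩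
  -- On the support of the cutoff the bounded extension may be replaced by the small one in the
  -- first factor. Both conclusions rely on this exchange.
  have hswap : ∀ᶠ j in atTop, ∀ {χ : ℝ → ℂ}, tsupport χ ⊆ Icc α β →
      ∫ t, χ t * (ft (fun τ => F τ * mollHat j τ) t * conj (ft (fun τ => E τ * mollHat j τ) t)) =
      ∫ t, χ t * (ft (fun τ => F₁ τ * mollHat j τ) t *
        conj (ft (fun τ => E τ * mollHat j τ) t)) := by
    filter_upwards [hloc] with j hj χ hχ
    congr 1; ext t
    by_cases ht : t ∈ tsupport χ
    · rw [ft_mollHat_congr hFt (hF.tempered₁ hb1) hF.same j (hj t (hχ ht))]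
    · rw [image_eq_zero_of_notMem_tsupport ht, zero_mul, zero_mul]
  have hs' : tsupport (deriv ψ) ⊆ Icc α β := (tsupport_deriv_subset (𝕜 := ℝ)).trans hs
  constructor
  · refine le_of_tendsto hlim.enorm ?_
    filter_upwards [hswap] with j hj
    rw [hj hs]
    exact hbil j hψ (hF.tempered₁ hb1) hEt b (abs_of_nonneg hb0)
  · refine le_of_tendsto (ENNReal.Tendsto.const_mul hlim.enorm (Or.inr ENNReal.ofReal_ne_top)) ?_
    filter_upwards [hswap, hloc] with j hj hlj
    have hid := integral_identity (l := l) (l' := l') hψ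
      (fun t => hasDerivAt_ft (hFt.integrable_mollHat j)
        (hFt.integrable_mul_mul_ft (isTest_moll j)) t)
      (fun t => hasDerivAt_ft (hEt.integrable_mollHat j)
        (hEt.integrable_mul_mul_ft (isTest_moll j)) t)
      (continuous_ft ((hF.temperedG hb1).integrable_mollHat j))
      (continuous_ft ((hE.temperedG hb1).integrable_mollHat j))
      (fun t ht => (hasDerivAt_ft (hFt.integrable_mollHat j)
        (hFt.integrable_mul_mul_ft (isTest_moll j)) t).unique
        (hasDerivAt_ft_mollHat hFt (hF.temperedG hb1) hF.eqn j (hlj t (hs ht))))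
      (fun t ht => (hasDerivAt_ft (hEt.integrable_mollHat j)
        (hEt.integrable_mul_mul_ft (isTest_moll j)) t).unique
        (hasDerivAt_ft_mollHat hEt (hE.temperedG hb1) hE.eqn j (hlj t (hs ht))))
    rw [hj hs'] at hid
    have he := congrArg enorm hid
    rw [mul_assoc, enorm_I_mul, enorm_mul, ← Complex.ofReal_sub, ← ofReal_norm (Complex.ofReal _),
      Complex.norm_real, Real.norm_eq_abs] at he
    rw [he]
    refine enorm_sub_le.trans (add_le_add
      ((enorm_add_le (E := ℂ) _ _).trans (add_le_add ?_ ?_)) ?_)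
    · rw [enorm_neg]
      exact hbil j hψ.deriv (hF.tempered₁ hb1) hEt b (abs_of_nonneg hb0)
    · rw [enorm_I_mul]
      exact hbil j hψ (hF.temperedG hb1) hEt b (abs_of_nonneg hb0)
    · rw [enorm_I_mul]
      -- Here the source sits in the second factor, so the weights are distributed the other way: +b
      -- on the first factor and -b on H.
      have := hbil j hψ hFt (hE.temperedG hb1) (-b) (by rw [abs_neg, abs_of_nonneg hb0])
      rwa [neg_neg] at this

/-! ### Equiintegrability in time, for b > 0. -/

/-- Square integrable functions with `⟨τ - c⟩ ^ b` weight, `b > 0`, have uniformly integrable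
Fourier transforms. -/
theorem lintegral_transform_le {b c R : ℝ} (hb : 0 ≤ b) (hR : 0 < R) {F a : ℝ → ℂ}
    (hm : AEStronglyMeasurable F volume) (hF : modeNorm b c F < ∞) (ha : IsL2Transform F a)
    (S : Set ℝ) :
    ∫⁻ t in S, ‖a t‖ₑ ^ 2 ≤ (2 * (ENNReal.ofReal (2 * R) * volume S) +
      2 * ENNReal.ofReal (2 * Real.pi * (R ^ (-b)) ^ 2)) * modeNorm b c F ^ 2 := by
  have hF2 := memLp_of_modeNorm hm hb hF
  -- Frequencies are split at distance R from c. The near part has a transform bounded pointwise, by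
  -- Cauchy–Schwarz over an interval of length 2R, and contributes 2R times the measure of S. On the
  -- far part the weight is at least R^b, and Plancherel gives 2πR^{-2b}.
  set I := Icc (c - R) (c + R) with hI
  have hIm : MeasurableSet I := measurableSet_Icc
  set L := I.indicator F with hL
  set U := Iᶜ.indicator F with hU
  have hLU : ∀ τ, L τ + U τ = F τ := fun τ => congrFun (indicator_self_add_compl I F) τ
  have hL2 : MemLp L 2 volume := hF2.indicator hIm
  have hU2 : MemLp U 2 volume := hF2.indicator hIm.compl
  have hLi : Integrable L := by
    rw [hL, integrable_indicator_iff hIm]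
    exact (hF2.restrict I).integrable (by norm_num)
  obtain ⟨x, hx⟩ := exists_isL2Transform hU2
  have hl := isL2Transform_ft hLi hL2
  have hae : ∀ᵐ t, a t - ft L t = x t := by
    have hs := IsL2Transform.sub hF2 hL2 ha hl
    have := IsL2Transform.ae_eq_on hs.memLp hx.memLp isOpen_univ fun ψ hψ _ => by
      rw [hs.pairing ψ hψ, hx.pairing ψ hψ]
      congr 1; ext τ; rw [← hLU τ]; ring
    exact this.mono fun t ht => ht (mem_univ t)
  have hlow : ∀ t, ‖ft L t‖ₑ ^ 2 ≤ ENNReal.ofReal (2 * R) * modeNorm b c F ^ 2 := fun t => by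
    have h1 : ‖ft L t‖ₑ ≤ eLpNorm F 2 volume * eLpNorm (I.indicator fun _ => (1 : ℂ)) 2 volume := by
      have hm1 : AEStronglyMeasurable (I.indicator fun _ => (1 : ℂ)) volume :=
        (aestronglyMeasurable_const).indicator hIm
      refine le_trans ?_ (lintegral_enorm_mul_le hm hm1)
      refine (enorm_integral_le_lintegral_enorm _).trans (lintegral_mono fun τ => ?_)
      rw [enorm_mul, ← ofReal_norm (Complex.exp _), norm_exp_I_mul, ENNReal.ofReal_one, mul_one]
      by_cases h : τ ∈ I <;> simp [hL, h]
    have h2 : eLpNorm (I.indicator fun _ => (1 : ℂ)) 2 volume ^ 2 = ENNReal.ofReal (2 * R) := by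
      rw [eLpNorm_two_sq]
      have : ∀ τ, ‖I.indicator (fun _ => (1 : ℂ)) τ‖ₑ ^ 2 = I.indicator 1 τ := fun τ => by
        by_cases h : τ ∈ I <;> simp [h]
      simp only [this]
      rw [lintegral_indicator_one hIm, hI, Real.volume_Icc]
      congr 1; ring
    calc _ ≤ (eLpNorm F 2 volume * eLpNorm (I.indicator fun _ => (1 : ℂ)) 2 volume) ^ 2 :=
          pow_le_pow_left' h1 2
      _ = ENNReal.ofReal (2 * R) * eLpNorm F 2 volume ^ 2 := by rw [mul_pow, h2, mul_comm]
      _ ≤ _ := by gcongr; exact eLpNorm_le_modeNorm hb c F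
  have hhigh : ∫⁻ t, ‖x t‖ₑ ^ 2 ≤ ENNReal.ofReal (2 * Real.pi * (R ^ (-b)) ^ 2) *
      modeNorm b c F ^ 2 := by
    have h1 : eLpNorm U 2 volume ≤ ENNReal.ofReal (R ^ (-b)) * modeNorm b c F := by
      refine eLpNorm_le_mul_eLpNorm_of_ae_le_mul (ae_of_all _ fun τ => ?_) 2
      by_cases h : τ ∈ I
      · simp only [hU, mem_compl_iff, h, not_true_eq_false, not_false_eq_true,
          indicator_of_notMem, norm_zero]
        positivity
      · have hRτ : R ≤ bracket (τ - c) := by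
          refine le_trans ?_ (abs_le_bracket _)
          by_contra hc
          have := abs_lt.1 (not_le.1 hc)
          exact h ⟨by linarith, by linarith⟩
        simp only [hU, mem_compl_iff, h, not_false_eq_true, indicator_of_mem, weighted, norm_mul,
          Complex.norm_real]
        rw [Real.norm_of_nonneg (Real.rpow_nonneg (bracket_pos _).le _), ← mul_assoc]
        refine le_mul_of_one_le_left (norm_nonneg _) ?_
        have h2 := Real.rpow_le_rpow hR.le hRτ hb
        have h3 : R ^ (-b) * R ^ b = 1 := by rw [← Real.rpow_add hR]; simp
        rw [← h3]
        gcongr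
    rw [← eLpNorm_two_sq, hx.norm_eq, ENNReal.ofReal_mul (by positivity),
      ENNReal.ofReal_pow (by positivity), mul_pow, ← ENNReal.ofReal_pow (by positivity),
      Real.sq_sqrt (by positivity), mul_assoc, ← mul_pow]
    gcongr
  have hpt : ∀ᵐ t, ‖a t‖ₑ ^ 2 ≤ 2 * (ENNReal.ofReal (2 * R) * modeNorm b c F ^ 2) +
      2 * ‖x t‖ₑ ^ 2 := by
    filter_upwards [hae] with t ht
    have h1 : ‖a t‖ₑ ≤ ‖ft L t‖ₑ + ‖x t‖ₑ := by
      rw [← ht]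
      calc ‖a t‖ₑ = ‖ft L t + (a t - ft L t)‖ₑ := by rw [add_sub_cancel]
        _ ≤ _ := enorm_add_le _ _
    calc _ ≤ (‖ft L t‖ₑ + ‖x t‖ₑ) ^ 2 := pow_le_pow_left' h1 2
      _ ≤ 2 * (‖ft L t‖ₑ ^ 2 + ‖x t‖ₑ ^ 2) := by
        have := ENNReal.rpow_add_le_mul_rpow_add_rpow ‖ft L t‖ₑ ‖x t‖ₑ (p := 2) (by norm_num)
        norm_num at this
        exact this
      _ ≤ _ := by rw [mul_add]; gcongr; exact hlow t
  calc _ ≤ ∫⁻ t in S, (2 * (ENNReal.ofReal (2 * R) * modeNorm b c F ^ 2) + 2 * ‖x t‖ₑ ^ 2) :=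
        lintegral_mono_ae (ae_restrict_of_ae hpt)
    _ = 2 * (ENNReal.ofReal (2 * R) * modeNorm b c F ^ 2) * volume S +
        2 * ∫⁻ t in S, ‖x t‖ₑ ^ 2 := by
      rw [lintegral_add_left measurable_const, setLIntegral_const,
        lintegral_const_mul' 2 _ (by simp)]
    _ ≤ 2 * (ENNReal.ofReal (2 * R) * modeNorm b c F ^ 2) * volume S +
        2 * (ENNReal.ofReal (2 * Real.pi * (R ^ (-b)) ^ 2) * modeNorm b c F ^ 2) := by
      gcongr
      exact (setLIntegral_le_lintegral S _).trans hhigh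
    _ = _ := by ring

/-! ### Estimates up to the time endpoints, for b = 0. -/

/-- The analogue of `integral_identity` with no cutoff: the boundary values of v conj(w) remain and
are controlled by `endpoint_estimate`. -/
theorem interval_identity {l l' α β : ℝ} (hαβ : α ≤ β) {v w g h : ℝ → ℂ}
    (hvc : Continuous v) (hwc : Continuous w) (hg : Continuous g) (hh : Continuous h)
    (hv : ∀ t ∈ Icc α β, HasDerivAt v (Complex.I * (l * v t - g t)) t)
    (hw : ∀ t ∈ Icc α β, HasDerivAt w (Complex.I * (l' * w t - h t)) t) :
    Complex.I * (l - l') * (∫ t in α..β, v t * conj (w t)) =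
      v β * conj (w β) - v α * conj (w α) + Complex.I * (∫ t in α..β, g t * conj (w t)) -
        Complex.I * (∫ t in α..β, v t * conj (h t)) := by
  have hint : ∀ {x y : ℝ → ℂ} (z : ℂ), Continuous x → Continuous y →
      IntervalIntegrable (fun t => z * (x t * conj (y t))) volume α β := fun {x y} z hx hy =>
    (continuous_const.mul (hx.mul (Complex.continuous_conj.comp hy))).intervalIntegrable _ _
  have hd : ∀ t ∈ uIcc α β, HasDerivAt (fun t => v t * conj (w t))
      (Complex.I * (l - l') * (v t * conj (w t)) - Complex.I * (g t * conj (w t)) +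
        Complex.I * (v t * conj (h t))) t := fun t ht => by
    rw [uIcc_of_le hαβ] at ht
    have hwt : HasDerivAt (fun t => conj (w t)) (conj (Complex.I * (l' * w t - h t))) t :=
      (hw t ht).star
    refine ((hv t ht).fun_mul hwt).congr_deriv ?_
    simp only [map_mul, map_sub, Complex.conj_I, Complex.conj_ofReal]
    ring
  have := intervalIntegral.integral_eq_sub_of_hasDerivAt hd
    (((hint _ hvc hwc).sub (hint _ hg hwc)).add (hint _ hvc hh))
  rw [intervalIntegral.integral_add ((hint _ hvc hwc).sub (hint _ hg hwc)) (hint _ hvc hh),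
    intervalIntegral.integral_sub (hint _ hvc hwc) (hint _ hg hwc),
    intervalIntegral.integral_const_mul, intervalIntegral.integral_const_mul,
    intervalIntegral.integral_const_mul] at this
  linear_combination this

/-- The term i l v is orthogonal to v for the real inner product, so the derivative of ‖v‖² sees
only g and the bound does not depend on l. That uniformity is essential, since l grows like k⁴. -/
theorem endpoint_estimate {l α β : ℝ} (hαβ : α < β) {v g : ℝ → ℂ}
    (hvc : Continuous v) (hg : Continuous g)
    (hv : ∀ t ∈ Icc α β, HasDerivAt v (Complex.I * (l * v t - g t)) t) :
    ‖v α‖ ^ 2 + ‖v β‖ ^ 2 ≤ 2 / (β - α) * (∫ t in α..β, ‖v t‖ * ‖v t‖) +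
      2 * ∫ t in α..β, ‖v t‖ * ‖g t‖ := by
  have hpos : 0 < β - α := sub_pos.2 hαβ
  -- The affine multiplier equal to 1 at α and -1 at β, so that both endpoint values enter with the
  -- same sign.
  set s : ℝ → ℝ := fun t => 1 - 2 / (β - α) * (t - α) with hs
  have hsd : ∀ t, HasDerivAt s (-(2 / (β - α))) t := fun t => by
    simpa using (((hasDerivAt_id t).sub_const α).const_mul (2 / (β - α))).const_sub 1
  have hs1 : ∀ t ∈ Icc α β, |s t| ≤ 1 := fun t ht => by
    have h1 : 2 / (β - α) * (t - α) ≤ 2 := by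
      rw [div_mul_eq_mul_div, div_le_iff₀ hpos]; linarith [ht.2]
    have h2 : 0 ≤ 2 / (β - α) * (t - α) := mul_nonneg (by positivity) (by linarith [ht.1])
    rw [abs_le]; constructor <;> simp only [hs] <;> linarith
  have hsα : s α = 1 := by simp [hs]
  have hsβ : s β = -1 := by simp only [hs]; field_simp; ring
  set r : ℝ → ℝ := fun t => inner ℝ (v t) (Complex.I * (l * v t - g t)) with hr
  have hrle : ∀ t, |r t| ≤ ‖v t‖ * ‖g t‖ := fun t => by
    have : r t = inner ℝ (v t) (-(Complex.I * g t)) := by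
      simp only [hr, mul_sub]
      rw [sub_eq_add_neg, inner_add_right]
      have : inner ℝ (v t) (Complex.I * (l * v t)) = (0 : ℝ) := by
        simp only [Complex.inner, Complex.mul_re, Complex.mul_im, Complex.conj_re,
          Complex.conj_im, Complex.I_re, Complex.I_im, Complex.ofReal_re, Complex.ofReal_im]
        ring
      rw [this, zero_add]
    rw [this]
    refine (abs_real_inner_le_norm _ _).trans_eq ?_
    rw [norm_neg, norm_mul, Complex.norm_I, one_mul]
  have hd : ∀ t ∈ uIcc α β, HasDerivAt (fun t => s t * ‖v t‖ ^ 2)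
      (-(2 / (β - α)) * ‖v t‖ ^ 2 + s t * (2 * r t)) t := fun t ht => by
    rw [uIcc_of_le hαβ.le] at ht
    exact (hsd t).mul (hv t ht).norm_sq
  have hsc : Continuous s := continuous_iff_continuousAt.2 fun t => (hsd t).continuousAt
  have hrc : Continuous r := by
    refine hvc.inner (continuous_const.mul ((continuous_const.mul hvc).sub hg))
  have i1 : IntervalIntegrable (fun t => -(2 / (β - α)) * ‖v t‖ ^ 2) volume α β :=
    (continuous_const.mul (hvc.norm.pow 2)).intervalIntegrable _ _
  have i2 : IntervalIntegrable (fun t => s t * (2 * r t)) volume α β :=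
    (hsc.mul (continuous_const.mul hrc)).intervalIntegrable _ _
  have i3 : IntervalIntegrable (fun t => 2 * (‖v t‖ * ‖g t‖)) volume α β :=
    (continuous_const.mul (hvc.norm.mul hg.norm)).intervalIntegrable _ _
  have key := intervalIntegral.integral_eq_sub_of_hasDerivAt hd (i1.add i2)
  rw [intervalIntegral.integral_add i1 i2, intervalIntegral.integral_const_mul, hsα, hsβ] at key
  have hle : |∫ t in α..β, s t * (2 * r t)| ≤ ∫ t in α..β, 2 * (‖v t‖ * ‖g t‖) := by
    rw [← Real.norm_eq_abs]
    refine intervalIntegral.norm_integral_le_of_norm_le hαβ.le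
      (ae_of_all _ fun t ht => ?_) i3
    rw [Real.norm_eq_abs, abs_mul, abs_mul, abs_two]
    have h1 := hs1 t ⟨ht.1.le, ht.2⟩
    have h2 := hrle t
    calc _ ≤ 1 * (2 * (‖v t‖ * ‖g t‖)) := by gcongr
      _ = _ := one_mul _
  rw [intervalIntegral.integral_const_mul] at hle
  have := (abs_le.1 hle).1
  simp only [← sq]
  linarith

theorem lintegral_enorm_ft_mul_le {A B : ℝ → ℂ} (hA : MemLp A 2 volume) (hB : MemLp B 2 volume)
    (j : ℕ) : ∫⁻ t, ‖ft (fun τ => A τ * mollHat j τ) t‖ₑ * ‖ft (fun τ => B τ * mollHat j τ) t‖ₑ ≤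
      ENNReal.ofReal (2 * Real.pi) * (eLpNorm A 2 volume * eLpNorm B 2 volume) := by
  have h : ∀ {C : ℝ → ℂ}, MemLp C 2 volume →
      IsL2Transform (fun τ => C τ * mollHat j τ) (ft fun τ => C τ * mollHat j τ) := fun hC =>
    isL2Transform_ft ((tempered_of_memLp hC).integrable_mollHat j) (memLp_mul_mollHat hC j)
  have hn : ∀ C : ℝ → ℂ, eLpNorm (fun τ => C τ * mollHat j τ) 2 volume ≤ eLpNorm C 2 volume :=
    fun C => by simpa only [modeNorm_zero] using modeNorm_mul_le (norm_mollHat_le j) 0 0 (A := C)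
  refine (lintegral_enorm_mul_le (h hA).memLp.1 (h hB).memLp.1).trans ?_
  rw [(h hA).norm_eq, (h hB).norm_eq]
  have e : ENNReal.ofReal (2 * Real.pi) = ENNReal.ofReal (Real.sqrt (2 * Real.pi)) *
      ENNReal.ofReal (Real.sqrt (2 * Real.pi)) := by
    rw [← ENNReal.ofReal_mul (Real.sqrt_nonneg _), Real.mul_self_sqrt (by positivity)]
  calc _ ≤ ENNReal.ofReal (Real.sqrt (2 * Real.pi)) * eLpNorm A 2 volume *
        (ENNReal.ofReal (Real.sqrt (2 * Real.pi)) * eLpNorm B 2 volume) := by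
        gcongr
        · exact hn A
        · exact hn B
    _ = _ := by rw [e]; ring

theorem ofReal_intervalIntegral_le {α β : ℝ} (h : α ≤ β) (x y : ℝ → ℂ) :
    ENNReal.ofReal (∫ t in α..β, ‖x t‖ * ‖y t‖) ≤ ∫⁻ t in Ioc α β, ‖x t‖ₑ * ‖y t‖ₑ := by
  rw [intervalIntegral.integral_of_le h]
  refine (Real.ofReal_le_enorm _).trans ((enorm_integral_le_lintegral_enorm _).trans_eq ?_)
  simp [enorm_mul]

/-- The estimate up to the boundary, without loss in time regularity. -/
theorem boundary_estimate_Ioc {T l l' c d α β : ℝ} {F F₁ G E E₁ H a e : ℝ → ℂ}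
    (hF : IsModeSolution T l 0 c F F₁ G) (hE : IsModeSolution T l' 0 d E E₁ H)
    (ha : IsL2Transform F a) (he : IsL2Transform E e) (hα : 0 < α) (hβ : β < T) (hT : 0 < T)
    (hαβ : T / 2 ≤ β - α) :
    ‖∫ t in Ioc α β, a t * conj (e t)‖ₑ ≤
      ENNReal.ofReal (2 * Real.pi) * (modeNorm 0 c F₁ * modeNorm 0 d E) ∧
    ENNReal.ofReal |l - l'| * ‖∫ t in Ioc α β, a t * conj (e t)‖ₑ ≤
      ENNReal.ofReal (2 * Real.pi) * (ENNReal.ofReal (2 / T) *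
        (modeNorm 0 c F₁ * modeNorm 0 c F + modeNorm 0 d E₁ * modeNorm 0 d E) +
        (modeNorm 0 c G * modeNorm 0 c F + modeNorm 0 d H * modeNorm 0 d E) +
        (modeNorm 0 c G * modeNorm 0 d E + modeNorm 0 d H * modeNorm 0 c F)) := by
  simp only [modeNorm_zero]
  have hlt : α < β := by linarith
  have mF := hF.memLp le_rfl
  have mE := hE.memLp le_rfl
  have mF₁ : MemLp F₁ 2 volume := ⟨hF.meas₁, by simpa [modeNorm_zero] using hF.lt_top₁⟩
  have mE₁ : MemLp E₁ 2 volume := ⟨hE.meas₁, by simpa [modeNorm_zero] using hE.lt_top₁⟩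
  have mG : MemLp G 2 volume := ⟨hF.measG, by simpa [modeNorm_zero] using hF.lt_topG⟩
  have mH : MemLp H 2 volume := ⟨hE.measG, by simpa [modeNorm_zero] using hE.lt_topG⟩
  have hlim : Tendsto (fun j => ∫ t in Ioc α β, (ft (fun τ => F τ * mollHat j τ) t *
      conj (ft (fun τ => E τ * mollHat j τ) t))) atTop
      (𝓝 (∫ t in Ioc α β, a t * conj (e t))) := by
    have := tendsto_integral_mul_conj (μ := volume)
      (ψ := (Ioc α β).indicator fun _ => (1 : ℂ)) (M := 1)
      ((aestronglyMeasurable_const).indicator measurableSet_Ioc)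
      (fun t => by by_cases h : t ∈ Ioc α β <;> simp [h])
      (fun j => (isL2Transform_ft ((tempered_of_memLp mF).integrable_mollHat j)
        (memLp_mul_mollHat mF j)).memLp)
      (fun j => (isL2Transform_ft ((tempered_of_memLp mE).integrable_mollHat j)
        (memLp_mul_mollHat mE j)).memLp) ha.memLp he.memLp
      (ha.tendsto_mollified mF) (he.tendsto_mollified mE)
    have e : ∀ f : ℝ → ℂ, ∫ t, (Ioc α β).indicator (fun _ => (1 : ℂ)) t * f t =
        ∫ t in Ioc α β, f t := fun f => by
      rw [← integral_indicator measurableSet_Ioc]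
      congr 1; ext t
      by_cases h : t ∈ Ioc α β <;> simp [h]
    simpa only [e] using this
  have hloc : ∀ᶠ j in atTop, ∀ t ∈ Icc α β, t ∈ Ioo (mollRadius j) (T - mollRadius j) := by
    filter_upwards [tendsto_mollRadius.eventually_lt_const (lt_min hα (sub_pos.2 hβ))] with j hj t ht
    have := lt_min_iff.1 hj
    exact ⟨by linarith [ht.1], by linarith [ht.2]⟩
  have hcont : ∀ {A : ℝ → ℂ} (j : ℕ), MemLp A 2 volume →
      Continuous (ft fun τ => A τ * mollHat j τ) := fun j hA =>
    continuous_ft ((tempered_of_memLp hA).integrable_mollHat j)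
  have hbil : ∀ {A B : ℝ → ℂ} (j : ℕ), MemLp A 2 volume → MemLp B 2 volume →
      ENNReal.ofReal (∫ t in α..β, ‖ft (fun τ => A τ * mollHat j τ) t‖ *
        ‖ft (fun τ => B τ * mollHat j τ) t‖) ≤
      ENNReal.ofReal (2 * Real.pi) * (eLpNorm A 2 volume * eLpNorm B 2 volume) :=
    fun j hA hB => (ofReal_intervalIntegral_le hlt.le _ _).trans
      ((setLIntegral_le_lintegral _ _).trans (lintegral_enorm_ft_mul_le hA hB j))
  have hsame : ∀ {l c : ℝ} {A A₁ B : ℝ → ℂ}, IsModeSolution T l 0 c A A₁ B →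
      MemLp A 2 volume → MemLp A₁ 2 volume → ∀ᶠ j in atTop, ∀ t ∈ Icc α β,
      ft (fun τ => A τ * mollHat j τ) t = ft (fun τ => A₁ τ * mollHat j τ) t :=
    fun hA m m₁ => by
      filter_upwards [hloc] with j hj t ht
      exact ft_mollHat_congr (tempered_of_memLp m) (tempered_of_memLp m₁) hA.same j (hj t ht)
  -- One of the two copies of A is exchanged for A₁, so the quadratic terms coming from the
  -- endpoints also carry a small norm.
  have hsq : ∀ {l c : ℝ} {A A₁ B : ℝ → ℂ}, IsModeSolution T l 0 c A A₁ B →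
      MemLp A 2 volume → MemLp A₁ 2 volume → ∀ᶠ j in atTop,
      ENNReal.ofReal (∫ t in α..β, ‖ft (fun τ => A τ * mollHat j τ) t‖ *
        ‖ft (fun τ => A τ * mollHat j τ) t‖) ≤
      ENNReal.ofReal (2 * Real.pi) * (eLpNorm A₁ 2 volume * eLpNorm A 2 volume) :=
    fun hA m m₁ => by
      filter_upwards [hsame hA m m₁] with j hj
      refine le_trans (le_of_eq ?_) (hbil j m₁ m)
      congr 1
      refine intervalIntegral.integral_congr fun t ht => ?_
      rw [uIcc_of_le hlt.le] at ht
      simp only [hj t ht]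
  constructor
  · refine le_of_tendsto hlim.enorm ?_
    filter_upwards [hsame hF mF mF₁] with j hj
    refine (enorm_integral_le_lintegral_enorm _).trans ?_
    refine le_trans ?_ (lintegral_enorm_ft_mul_le mF₁ mE j)
    refine le_trans (setLIntegral_mono_ae' measurableSet_Ioc (ae_of_all _ fun t ht => ?_))
      (setLIntegral_le_lintegral (Ioc α β) _)
    rw [enorm_mul, RCLike.enorm_conj, hj t ⟨ht.1.le, ht.2⟩]
  · refine le_of_tendsto (ENNReal.Tendsto.const_mul hlim.enorm (Or.inr ENNReal.ofReal_ne_top)) ?_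
    filter_upwards [hloc, hsq hF mF mF₁, hsq hE mE mE₁] with j hj h1 h2
    set v := ft fun τ => F τ * mollHat j τ with hv
    set w := ft fun τ => E τ * mollHat j τ with hw
    set g := ft fun τ => G τ * mollHat j τ with hg
    set h := ft fun τ => H τ * mollHat j τ with hh
    have cv : Continuous v := hcont j mF
    have cw : Continuous w := hcont j mE
    have cg : Continuous g := hcont j mG
    have ch : Continuous h := hcont j mH
    have dv : ∀ t ∈ Icc α β, HasDerivAt v (Complex.I * (l * v t - g t)) t := fun t ht =>
      hasDerivAt_ft_mollHat (tempered_of_memLp mF) (tempered_of_memLp mG) hF.eqn j (hj t ht)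
    have dw : ∀ t ∈ Icc α β, HasDerivAt w (Complex.I * (l' * w t - h t)) t := fun t ht =>
      hasDerivAt_ft_mollHat (tempered_of_memLp mE) (tempered_of_memLp mH) hE.eqn j (hj t ht)
    have id := interval_identity hlt.le cv cw cg ch dv dw
    have ev := endpoint_estimate hlt cv cg dv
    have ew := endpoint_estimate hlt cw ch dw
    -- As β - α ≥ T/2, the endpoint constant is at most 4/T; the factor 1/2 of the
    -- arithmetic-geometric inequality then leaves 2/T.
    have hT2 : 2 / (β - α) ≤ 2 * (2 / T) := by
      rw [← mul_div_assoc, div_le_div_iff₀ (by linarith) hT]; linarith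
    have n0 : ∀ x y : ℝ → ℂ, 0 ≤ ∫ t in α..β, ‖x t‖ * ‖y t‖ := fun x y =>
      intervalIntegral.integral_nonneg hlt.le fun t _ => by positivity
    have nle : ∀ x y : ℝ → ℂ, ‖∫ t in α..β, x t * conj (y t)‖ ≤ ∫ t in α..β, ‖x t‖ * ‖y t‖ :=
      fun x y => (intervalIntegral.norm_integral_le_integral_norm hlt.le).trans_eq (by
        simp only [norm_mul, RCLike.norm_conj])
    have real : |l - l'| * ‖∫ t in Ioc α β, v t * conj (w t)‖ ≤
        2 / T * ((∫ t in α..β, ‖v t‖ * ‖v t‖) + ∫ t in α..β, ‖w t‖ * ‖w t‖) +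
        ((∫ t in α..β, ‖g t‖ * ‖v t‖) + ∫ t in α..β, ‖h t‖ * ‖w t‖) +
        ((∫ t in α..β, ‖g t‖ * ‖w t‖) + ∫ t in α..β, ‖h t‖ * ‖v t‖) := by
      have e1 : |l - l'| * ‖∫ t in Ioc α β, v t * conj (w t)‖ =
          ‖Complex.I * (l - l') * (∫ t in α..β, v t * conj (w t))‖ := by
        rw [norm_mul, norm_mul, Complex.norm_I, one_mul, ← Complex.ofReal_sub, Complex.norm_real,
          Real.norm_eq_abs, intervalIntegral.integral_of_le hlt.le]
      have e2 : ‖v β * conj (w β) - v α * conj (w α) + Complex.I * (∫ t in α..β, g t * conj (w t)) -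
          Complex.I * (∫ t in α..β, v t * conj (h t))‖ ≤ ‖v β‖ * ‖w β‖ + ‖v α‖ * ‖w α‖ +
          (∫ t in α..β, ‖g t‖ * ‖w t‖) + ∫ t in α..β, ‖v t‖ * ‖h t‖ := by
        refine (norm_sub_le _ _).trans (add_le_add ((norm_add_le _ _).trans
          (add_le_add ((norm_sub_le _ _).trans_eq ?_) ?_)) ?_)
        · simp only [norm_mul, RCLike.norm_conj]
        · rw [norm_mul, Complex.norm_I, one_mul]; exact nle g w
        · rw [norm_mul, Complex.norm_I, one_mul]; exact nle v h
      have c1 : ∀ x y : ℝ → ℂ, ∫ t in α..β, ‖x t‖ * ‖y t‖ = ∫ t in α..β, ‖y t‖ * ‖x t‖ :=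
        fun x y => by simp only [mul_comm]
      rw [e1, id]
      refine e2.trans ?_
      rw [c1 v g] at ev
      rw [c1 w h] at ew
      rw [c1 v h]
      have t1 := mul_le_mul_of_nonneg_right hT2 (n0 v v)
      have t2 := mul_le_mul_of_nonneg_right hT2 (n0 w w)
      -- The boundary products are bounded by half sums of squares, to which the two endpoint
      -- estimates apply.
      nlinarith [sq_nonneg (‖v β‖ - ‖w β‖), sq_nonneg (‖v α‖ - ‖w α‖)]
    have hE0 := ENNReal.ofReal_le_ofReal real
    have p0 : 0 ≤ 2 / T := by positivity
    rw [ENNReal.ofReal_mul (abs_nonneg _), ofReal_norm, ENNReal.ofReal_add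
      (add_nonneg (mul_nonneg p0 (add_nonneg (n0 _ _) (n0 _ _))) (add_nonneg (n0 _ _) (n0 _ _)))
      (add_nonneg (n0 _ _) (n0 _ _)), ENNReal.ofReal_add (mul_nonneg p0
      (add_nonneg (n0 _ _) (n0 _ _))) (add_nonneg (n0 _ _) (n0 _ _)), ENNReal.ofReal_mul p0,
      ENNReal.ofReal_add (n0 _ _) (n0 _ _), ENNReal.ofReal_add (n0 _ _) (n0 _ _),
      ENNReal.ofReal_add (n0 _ _) (n0 _ _)] at hE0
    refine hE0.trans ((add_le_add (add_le_add (mul_le_mul_right (add_le_add h1 h2) _)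
      (add_le_add (hbil j mG mF) (hbil j mH mE)))
      (add_le_add (hbil j mG mE) (hbil j mH mF))).trans_eq ?_)
    ring

/-- The estimate on the whole time interval, without loss in time regularity. -/
theorem boundary_estimate {T l l' c d : ℝ} {F F₁ G E E₁ H a e : ℝ → ℂ} (hT : 0 < T)
    (hF : IsModeSolution T l 0 c F F₁ G) (hE : IsModeSolution T l' 0 d E E₁ H)
    (ha : IsL2Transform F a) (he : IsL2Transform E e) :
    ‖∫ t in Ioo 0 T, a t * conj (e t)‖ₑ ≤
      ENNReal.ofReal (2 * Real.pi) * (modeNorm 0 c F₁ * modeNorm 0 d E) ∧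
    ENNReal.ofReal |l - l'| * ‖∫ t in Ioo 0 T, a t * conj (e t)‖ₑ ≤
      ENNReal.ofReal (2 * Real.pi) * (ENNReal.ofReal (2 / T) *
        (modeNorm 0 c F₁ * modeNorm 0 c F + modeNorm 0 d E₁ * modeNorm 0 d E) +
        (modeNorm 0 c G * modeNorm 0 c F + modeNorm 0 d H * modeNorm 0 d E) +
        (modeNorm 0 c G * modeNorm 0 d E + modeNorm 0 d H * modeNorm 0 c F)) := by
  have hr := tendsto_mollRadius
  have hcov : AECover (volume.restrict (Ioo 0 T)) atTop
      fun j => Ioc (0 + mollRadius j) (T - mollRadius j) :=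
    aecover_Ioo_of_Ioc (by simpa using hr.const_add 0) (by simpa using hr.const_sub T)
  have hi : Integrable (fun t => a t * conj (e t)) (volume.restrict (Ioo 0 T)) :=
    (ha.memLp.integrable_mul he.memLp.star).restrict
  have hsub : ∀ j, Ioc (0 + mollRadius j) (T - mollRadius j) ∩ Ioo 0 T =
      Ioc (0 + mollRadius j) (T - mollRadius j) := fun j =>
    inter_eq_left.2 fun t ht => by
      have := mollRadius_pos j
      exact ⟨by linarith [ht.1], by linarith [ht.2]⟩
  have hlim := hcov.integral_tendsto_of_countably_generated hi
  simp only [Measure.restrict_restrict measurableSet_Ioc, hsub] at hlim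
  -- Removing less than T/4 at each end keeps the length at least T/2, so the constants do not
  -- change along the exhaustion of (0,T).
  have hev : ∀ᶠ j in atTop, mollRadius j < T / 4 := hr.eventually_lt_const (by positivity)
  constructor
  · refine le_of_tendsto hlim.enorm ?_
    filter_upwards [hev] with j hj
    have := mollRadius_pos j
    exact (boundary_estimate_Ioc hF hE ha he (by linarith) (by linarith) hT (by linarith)).1
  · refine le_of_tendsto (ENNReal.Tendsto.const_mul hlim.enorm (Or.inr ENNReal.ofReal_ne_top)) ?_
    filter_upwards [hev] with j hj
    have := mollRadius_pos j
    exact (boundary_estimate_Ioc hF hE ha he (by linarith) (by linarith) hT (by linarith)).2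

/-! ### The resonance function and the frequency weights. -/

/-- The symbol of the equation. -/
def symbolPhase (k : ℤ) : ℝ := -((k : ℝ) ^ 4 + (k : ℝ) ^ 2)

/-- The difference factors as m(2k+m)((k+m)²+k²+1). If 2k+m ≠ 0 then |2k+m| is at least 1, dominates
⟨k⟩ up to a factor depending on m, and the last factor is at least ⟨k⟩². If 2k+m = 0 then k is
determined by m and the added 1 is enough. -/
theorem bracket_cube_le_aux {k m : ℤ} (hm : m ≠ 0) : bracket (k : ℝ) ^ 3 ≤
    (2 + |(m : ℝ)|) ^ 3 * (1 + |symbolPhase k - symbolPhase (k + m)|) := by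
  set x : ℝ := (k : ℝ)
  set y : ℝ := (m : ℝ)
  have hD : symbolPhase k - symbolPhase (k + m) =
      y * (2 * x + y) * ((x + y) ^ 2 + x ^ 2 + 1) := by
    simp only [symbolPhase]; push_cast; ring
  have hy : 1 ≤ |y| := by
    have : (1 : ℤ) ≤ |m| := Int.one_le_abs hm
    simp only [y]; exact_mod_cast this
  have hb0 := bracket_pos x
  rcases eq_or_ne (2 * k + m) 0 with h | h
  · have hx : x = -y / 2 := by
      have : 2 * x + y = 0 := by simp only [x, y]; exact_mod_cast h
      linarith
    have hb : bracket x ≤ 2 + |y| := by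
      refine (bracket_le_one_add_abs x).trans ?_
      rw [hx, abs_div, abs_neg, abs_two]
      linarith
    calc _ ≤ (2 + |y|) ^ 3 := by gcongr
      _ ≤ _ := le_mul_of_one_le_right (by positivity) (le_add_of_nonneg_right (abs_nonneg _))
  · have hz : 1 ≤ |2 * x + y| := by
      have : (1 : ℤ) ≤ |2 * k + m| := Int.one_le_abs h
      simp only [x, y]; exact_mod_cast this
    have hx : |x| ≤ |2 * x + y| * (1 + |y|) := by
      have h1 : 2 * |x| ≤ |2 * x + y| + |y| := by
        have := abs_sub (2 * x + y) y
        rw [add_sub_cancel_right, abs_mul, abs_two] at this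
        exact this
      nlinarith [abs_nonneg y, abs_nonneg x]
    have hb : bracket x ≤ (2 + |y|) * |2 * x + y| := by
      refine (bracket_le_one_add_abs x).trans ?_
      nlinarith
    have hDa : |2 * x + y| * bracket x ^ 2 ≤ |symbolPhase k - symbolPhase (k + m)| := by
      rw [hD, abs_mul, abs_mul, bracket_sq]
      have h1 : 1 + x ^ 2 ≤ |(x + y) ^ 2 + x ^ 2 + 1| := by
        rw [abs_of_nonneg (by positivity)]; nlinarith [sq_nonneg (x + y)]
      have h2 : |2 * x + y| ≤ |y| * |2 * x + y| := le_mul_of_one_le_left (abs_nonneg _) hy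
      gcongr
    have hp : 2 + |y| ≤ (2 + |y|) ^ 3 := le_self_pow₀ (by linarith [abs_nonneg y]) (by norm_num)
    calc bracket x ^ 3 = bracket x * bracket x ^ 2 := by ring
      _ ≤ (2 + |y|) * |2 * x + y| * bracket x ^ 2 := by gcongr
      _ = (2 + |y|) * (|2 * x + y| * bracket x ^ 2) := by ring
      _ ≤ (2 + |y|) ^ 3 * (1 + |symbolPhase k - symbolPhase (k + m)|) := by
          refine mul_le_mul hp ?_ (by positivity) (by positivity)
          linarith

/-- Both phases have differences m(2k+m)((k+m)²+k²±1) up to sign, hence cubic in k. Only this upper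
bound on p is used; the lower bound concerns the symbol of the equation, which need not equal p. -/
theorem bracket_phase_sub_le {p : ℤ → ℝ}
    (hp : (∀ k : ℤ, p k = -((k : ℝ) ^ 4 + (k : ℝ) ^ 2)) ∨
      (∀ k : ℤ, p k = (k : ℝ) ^ 4 - (k : ℝ) ^ 2)) (k m : ℤ) :
    bracket (p k - p (k + m)) ≤ 9 * (2 + |(m : ℝ)|) ^ 4 * bracket (k : ℝ) ^ 3 := by
  set x : ℝ := (k : ℝ)
  set y : ℝ := (m : ℝ)
  set B := bracket x
  have hB1 : 1 ≤ B := one_le_bracket x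
  have hx : |x| ≤ B := abs_le_bracket x
  have hz : |2 * x + y| ≤ (2 + |y|) * B := by
    refine (abs_add_le _ _).trans ?_
    rw [abs_mul, abs_two]
    nlinarith [abs_nonneg y]
  have hq : ∀ σ : ℝ, |σ| ≤ 1 → |(x + y) ^ 2 + x ^ 2 + σ| ≤ 3 * (2 + |y|) ^ 2 * B ^ 2 := by
    intro σ hσ
    have h1 : |x + y| ≤ (2 + |y|) * B := (abs_add_le _ _).trans (by nlinarith [abs_nonneg y])
    have h2 : |x + y| ^ 2 ≤ ((2 + |y|) * B) ^ 2 := by gcongr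
    have h3 : |x| ^ 2 ≤ ((2 + |y|) * B) ^ 2 := by
      gcongr; nlinarith [abs_nonneg y]
    have h4 : |σ| ≤ ((2 + |y|) * B) ^ 2 := hσ.trans (one_le_pow₀ (by nlinarith [abs_nonneg y]))
    calc _ ≤ |(x + y) ^ 2| + |x ^ 2| + |σ| := abs_add_three _ _ _
      _ ≤ _ := by rw [abs_pow, abs_pow]; linarith [mul_pow (2 + |y|) B 2]
  have hab : |p k - p (k + m)| ≤ 3 * (2 + |y|) ^ 4 * B ^ 3 := by
    obtain ⟨σ, hσ, h⟩ : ∃ σ : ℝ, |σ| ≤ 1 ∧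
        |p k - p (k + m)| = |y| * |2 * x + y| * |(x + y) ^ 2 + x ^ 2 + σ| := by
      rcases hp with hp | hp
      · refine ⟨1, by simp, ?_⟩
        rw [← abs_mul, ← abs_mul, hp, hp]
        congr 1; push_cast; ring
      · refine ⟨-1, by simp, ?_⟩
        rw [← abs_mul, ← abs_mul, hp, hp, ← abs_neg]
        congr 1; push_cast; ring
    rw [h]
    calc _ ≤ (2 + |y|) * ((2 + |y|) * B) * (3 * (2 + |y|) ^ 2 * B ^ 2) := by
          gcongr
          · linarith
          · exact hq σ hσ
      _ = _ := by ring
  refine (bracket_le_one_add_abs _).trans ?_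
  have h1 : (1 : ℝ) ≤ (2 + |y|) ^ 4 * B ^ 3 :=
    one_le_mul_of_one_le_of_one_le (one_le_pow₀ (by linarith [abs_nonneg y])) (one_le_pow₀ hB1)
  linarith

/-- The weights `⟨k⟩ ^ r` as extended nonnegative reals. -/
def intWeight (r : ℝ) (k : ℤ) : ℝ≥0∞ := ENNReal.ofReal (bracket (k : ℝ) ^ r)

/-- Peetre's inequality for the weight ⟨k⟩^r with r ≤ 0, written for the reciprocal; r ≥ -3 lets the
cube serve for all exponents at once. -/
theorem intWeight_le_shift {r : ℝ} (h0 : -3 ≤ r) (h1 : r ≤ 0) (m k : ℤ) :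
    intWeight r k ≤ ENNReal.ofReal ((2 * bracket (m : ℝ)) ^ 3) * intWeight r (k + m) := by
  rw [intWeight, intWeight, ← ENNReal.ofReal_mul (by have := bracket_pos (m : ℝ); positivity)]
  refine ENNReal.ofReal_le_ofReal ?_
  have hm := bracket_pos (m : ℝ)
  have hk := bracket_pos (k : ℝ)
  have hl := bracket_pos ((k + m : ℤ) : ℝ)
  have h := bracket_add_le (k : ℝ) (m : ℝ)
  have h2 : bracket ((k + m : ℤ) : ℝ) ^ (-r) ≤ (2 * bracket (m : ℝ)) ^ 3 * bracket (k : ℝ) ^ (-r) := by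
    push_cast
    refine (Real.rpow_le_rpow (bracket_pos _).le h (by linarith)).trans ?_
    rw [show 2 * (bracket (k : ℝ) * bracket (m : ℝ)) = 2 * bracket (m : ℝ) * bracket (k : ℝ) by ring,
      Real.mul_rpow (by positivity) hk.le]
    gcongr
    rw [← Real.rpow_natCast]
    exact Real.rpow_le_rpow_of_exponent_le (by linarith [one_le_bracket (m : ℝ)])
      (by push_cast; linarith)
  have e1 : bracket (k : ℝ) ^ r * bracket (k : ℝ) ^ (-r) = 1 := by
    rw [← Real.rpow_add hk]; simp
  have e2 : bracket ((k + m : ℤ) : ℝ) ^ r * bracket ((k + m : ℤ) : ℝ) ^ (-r) = 1 := by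
    rw [← Real.rpow_add hl]; simp
  have p1 := Real.rpow_pos_of_pos hk r
  have p2 := Real.rpow_pos_of_pos hl r
  calc bracket (k : ℝ) ^ r = bracket (k : ℝ) ^ r * bracket ((k + m : ℤ) : ℝ) ^ r *
        bracket ((k + m : ℤ) : ℝ) ^ (-r) := by rw [mul_assoc, e2, mul_one]
    _ ≤ bracket (k : ℝ) ^ r * bracket ((k + m : ℤ) : ℝ) ^ r *
        ((2 * bracket (m : ℝ)) ^ 3 * bracket (k : ℝ) ^ (-r)) := by gcongr
    _ = (bracket (k : ℝ) ^ r * bracket (k : ℝ) ^ (-r)) *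
        ((2 * bracket (m : ℝ)) ^ 3 * bracket ((k + m : ℤ) : ℝ) ^ r) := by ring
    _ = _ := by rw [e1, one_mul]

/-- Division by the resonance function. -/
theorem resonance_bound {p : ℤ → ℝ}
    (hp : (∀ k : ℤ, p k = -((k : ℝ) ^ 4 + (k : ℝ) ^ 2)) ∨
      (∀ k : ℤ, p k = (k : ℝ) ^ 4 - (k : ℝ) ^ 2)) {b : ℝ} (hb0 : 0 ≤ b) (hb1 : b ≤ 1)
    {m : ℤ} (hm : m ≠ 0) : ∃ C : ℝ≥0∞, C ≠ ∞ ∧ ∀ (k : ℤ) (X Y : ℝ≥0∞),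
      X ≤ ENNReal.ofReal (bracket (p k - p (k + m)) ^ b) * Y →
      ENNReal.ofReal |symbolPhase k - symbolPhase (k + m)| * X ≤
        ENNReal.ofReal (bracket (p k - p (k + m)) ^ b) * Y →
      X ≤ C * (intWeight (-3 + 3 * b) k * Y) := by
  set A : ℝ := (2 + |(m : ℝ)|) ^ 3 with hA
  set B : ℝ := 9 * (2 + |(m : ℝ)|) ^ 4 with hB
  have hA0 : 0 < A := by positivity
  have hB1 : 1 ≤ B := by
    have : (1 : ℝ) ≤ (2 + |(m : ℝ)|) ^ 4 := one_le_pow₀ (by linarith [abs_nonneg (m : ℝ)])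
    linarith
  refine ⟨ENNReal.ofReal (A * (B * 2)), ENNReal.ofReal_ne_top, fun k X Y h1 h2 => ?_⟩
  set D := |symbolPhase k - symbolPhase (k + m)| with hD
  set x := bracket (k : ℝ) with hx
  have hx0 : 0 < x := bracket_pos _
  -- Adding the two hypotheses gives a bound with 1 + |l - l'| on the left, so resonant and
  -- nonresonant frequencies need no separate treatment.
  have h3 : ENNReal.ofReal (1 + D) * X ≤
      ENNReal.ofReal 2 * (ENNReal.ofReal (bracket (p k - p (k + m)) ^ b) * Y) := by
    rw [ENNReal.ofReal_add zero_le_one (abs_nonneg _), ENNReal.ofReal_one, add_mul, one_mul,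
      ENNReal.ofReal_ofNat, two_mul]
    exact add_le_add h1 h2
  have h4 : bracket (p k - p (k + m)) ^ b ≤ B * x ^ (3 * b) := by
    refine (Real.rpow_le_rpow (bracket_pos _).le (bracket_phase_sub_le hp k m) hb0).trans ?_
    have e : (x ^ 3) ^ b = x ^ (3 * b) := by
      rw [← Real.rpow_natCast, ← Real.rpow_mul hx0.le]; norm_num
    rw [Real.mul_rpow (by positivity) (by positivity), e]
    gcongr
    exact (Real.rpow_le_rpow_of_exponent_le hB1 hb1).trans_eq (Real.rpow_one _)
  have h5 : 1 ≤ x ^ (-3 : ℝ) * (A * (1 + D)) := by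
    have := bracket_cube_le_aux (k := k) hm
    rw [Real.rpow_neg hx0.le, ← div_eq_inv_mul, le_div_iff₀ (by positivity), one_mul]
    calc x ^ (3 : ℝ) = x ^ (3 : ℕ) := by rw [← Real.rpow_natCast]; norm_num
      _ ≤ _ := this
  calc X ≤ ENNReal.ofReal (x ^ (-3 : ℝ) * (A * (1 + D))) * X :=
        le_mul_of_one_le_left' (by simpa using ENNReal.ofReal_le_ofReal h5)
    _ = ENNReal.ofReal (x ^ (-3 : ℝ)) * ENNReal.ofReal A * (ENNReal.ofReal (1 + D) * X) := by
        rw [ENNReal.ofReal_mul (by positivity), ENNReal.ofReal_mul hA0.le]; ring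
    _ ≤ ENNReal.ofReal (x ^ (-3 : ℝ)) * ENNReal.ofReal A *
        (ENNReal.ofReal 2 * (ENNReal.ofReal (B * x ^ (3 * b)) * Y)) := by
        refine mul_le_mul_right (h3.trans ?_) _
        gcongr
    _ = ENNReal.ofReal (A * (B * 2)) * (intWeight (-3 + 3 * b) k * Y) := by
        rw [intWeight, Real.rpow_add hx0, ENNReal.ofReal_mul (q := x ^ (3 * b)) (zero_le_one.trans hB1),
          ENNReal.ofReal_mul (q := B * 2) hA0.le, ENNReal.ofReal_mul (q := 2) (zero_le_one.trans hB1),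
          ENNReal.ofReal_mul (q := x ^ (3 * b)) (by positivity)]
        ring

/-! ### Summation over the spatial frequencies. -/

theorem tsum_mul_le (x y : ℤ → ℝ≥0∞) :
    ∑' k, x k * y k ≤ (∑' k, x k ^ 2) ^ (1 / 2 : ℝ) * (∑' k, y k ^ 2) ^ (1 / 2 : ℝ) := by
  have := ENNReal.lintegral_mul_le_Lp_mul_Lq (Measure.count : Measure ℤ) (p := 2) (q := 2)
    Real.HolderConjugate.two_two (measurable_from_top (f := x)).aemeasurable
    (measurable_from_top (f := y)).aemeasurable
  simpa only [lintegral_count, Pi.mul_apply, ENNReal.rpow_ofNat] using this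

/-- Translating the weight costs only a constant depending on i, after which Cauchy–Schwarz and
translation invariance of the sums remove both shifts. -/
theorem tsum_weighted_mul_le {r : ℝ} (h0 : -3 ≤ r) (h1 : r ≤ 0) (i j : ℤ) (x y : ℤ → ℝ≥0∞) :
    ∑' k, intWeight r k * (x (k + i) * y (k + j)) ≤
      ENNReal.ofReal ((2 * bracket (i : ℝ)) ^ 3) *
        ((∑' k, (intWeight r k * x k) ^ 2) ^ (1 / 2 : ℝ) * (∑' k, y k ^ 2) ^ (1 / 2 : ℝ)) := by
  calc _ ≤ ∑' k, ENNReal.ofReal ((2 * bracket (i : ℝ)) ^ 3) *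
        ((intWeight r (k + i) * x (k + i)) * y (k + j)) := by
        refine ENNReal.tsum_le_tsum fun k => ?_
        calc _ ≤ ENNReal.ofReal ((2 * bracket (i : ℝ)) ^ 3) * intWeight r (k + i) *
              (x (k + i) * y (k + j)) := mul_le_mul_left (intWeight_le_shift h0 h1 i k) _
          _ = _ := by ring
    _ ≤ _ := by
        rw [ENNReal.tsum_mul_left]
        gcongr
        refine (tsum_mul_le (fun k => intWeight r (k + i) * x (k + i)) fun k => y (k + j)).trans_eq ?_
        have e1 := (Equiv.addRight i).tsum_eq (fun k => (intWeight r k * x k) ^ 2)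
        have e2 := (Equiv.addRight j).tsum_eq (fun k => y k ^ 2)
        simp only [Equiv.coe_addRight] at e1 e2
        rw [e1, e2]

theorem bourgainNorm_eq (p : ℤ → ℝ) (b s : ℝ) (F : ℤ → ℝ → ℂ) : bourgainNorm p b s F =
    (∑' k, (intWeight s k * modeNorm b (p k) (F k)) ^ 2) ^ (1 / 2 : ℝ) := by
  rw [bourgainNorm]
  congr 2; ext k
  have hk := bracket_pos (k : ℝ)
  rw [mul_pow, modeNorm_sq, intWeight, ← ENNReal.ofReal_pow (by positivity), ← Real.rpow_natCast,
    ← Real.rpow_mul hk.le, ← lintegral_const_mul' _ _ ENNReal.ofReal_ne_top]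
  refine lintegral_congr fun τ => ?_
  rw [ENNReal.ofReal_mul (by positivity), mul_assoc, mul_comm (2 : ℝ) s]
  norm_num

theorem bourgainNorm_zero_eq (p : ℤ → ℝ) (b : ℝ) (F : ℤ → ℝ → ℂ) : bourgainNorm p b 0 F =
    (∑' k, modeNorm b (p k) (F k) ^ 2) ^ (1 / 2 : ℝ) := by
  rw [bourgainNorm_eq]
  simp [intWeight]

theorem modeNorm_lt_top_of_bourgainNorm {p : ℤ → ℝ} {b s : ℝ} {F : ℤ → ℝ → ℂ}
    (h : bourgainNorm p b s F < ∞) (k : ℤ) : modeNorm b (p k) (F k) < ∞ := by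
  rw [bourgainNorm_eq, ENNReal.rpow_lt_top_iff_of_pos (by norm_num)] at h
  have h1 := (ENNReal.le_tsum k).trans_lt h
  rw [ENNReal.pow_lt_top_iff] at h1
  have h2 : intWeight s k ≠ 0 := by
    simpa [intWeight] using Real.rpow_pos_of_pos (bracket_pos (k : ℝ)) s
  rcases h1 with h1 | h1
  · by_contra hc
    rw [not_lt, top_le_iff] at hc
    rw [hc, ENNReal.mul_top h2] at h1
    exact lt_irrefl _ h1
  · simp at h1

/-- Families of modes of solutions in the Bourgain spaces. -/
structure IsSolutionFamily (p : ℤ → ℝ) (T b : ℝ) (F F₁ G : ℤ → ℝ → ℂ) (a : ℤ → ℝ → ℂ) : Prop where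
  mode : ∀ k, IsModeSolution T (symbolPhase k) b (p k) (F k) (F₁ k) (G k)
  transform : ∀ k, IsL2Transform (F k) (a k)

/-- The resonance gains ⟨k⟩^{-3} and the mismatch of the modulation weights loses ⟨k⟩^{3b};
Cauchy–Schwarz in k then produces precisely the norms of X_{-b,-3+3b} and X_{b,0}. The constant
depends on ψ and m but not on the solution. -/
theorem sum_interior_le {p : ℤ → ℝ}
    (hp : (∀ k : ℤ, p k = -((k : ℝ) ^ 4 + (k : ℝ) ^ 2)) ∨
      (∀ k : ℤ, p k = (k : ℝ) ^ 4 - (k : ℝ) ^ 2)) {T b α β : ℝ} (hb0 : 0 ≤ b) (hb1 : b ≤ 1)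
    {m : ℤ} (hm : m ≠ 0) {ψ : ℝ → ℂ} (hψ : IsTest ψ) (hα : 0 < α) (hβ : β < T)
    (hs : tsupport ψ ⊆ Icc α β) : ∃ C : ℝ≥0∞, C ≠ ∞ ∧ ∀ F F₁ G a : ℤ → ℝ → ℂ,
      IsSolutionFamily p T b F F₁ G a →
      ∑' k, ‖∫ t, ψ t * (a k t * conj (a (k + m) t))‖ₑ ≤
        C * ((bourgainNorm p (-b) (-3 + 3 * b) F₁ + bourgainNorm p (-b) (-3 + 3 * b) G) *
          bourgainNorm p b 0 F) := by
  obtain ⟨C, hC, hres⟩ := resonance_bound hp hb0 hb1 hm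
  set K := testConst ψ + testConst (deriv ψ) with hK
  have hKt : K ≠ ∞ := (ENNReal.add_lt_top.2 ⟨testConst_lt_top hψ, testConst_lt_top hψ.deriv⟩).ne
  set c0 := ENNReal.ofReal ((2 * bracket ((0 : ℤ) : ℝ)) ^ 3) with hc0
  set cm := ENNReal.ofReal ((2 * bracket (m : ℝ)) ^ 3) with hcm
  refine ⟨C * (4 * K) * (c0 + cm), by finiteness, fun F F₁ G a h => ?_⟩
  set N1 := fun k => modeNorm (-b) (p k) (F₁ k)
  set NG := fun k => modeNorm (-b) (p k) (G k)
  set N := fun k => modeNorm b (p k) (F k)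
  have key : ∀ k, ‖∫ t, ψ t * (a k t * conj (a (k + m) t))‖ₑ ≤
      C * (4 * K) * (intWeight (-3 + 3 * b) k * (N1 (k + 0) * N (k + m)) +
        (intWeight (-3 + 3 * b) k * (NG (k + 0) * N (k + m)) +
        intWeight (-3 + 3 * b) k * (NG (k + m) * N (k + 0)))) := fun k => by
    obtain ⟨e1, e2⟩ := interior_estimate hb0 hb1 (h.mode k) (h.mode (k + m)) (h.transform k)
      (h.transform (k + m)) hψ hα hβ hs
    have := hres k ‖∫ t, ψ t * (a k t * conj (a (k + m) t))‖ₑ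
      (4 * K * (N1 k * N (k + m) + (NG k * N (k + m) + NG (k + m) * N k))) ?_ ?_
    · simp only [add_zero]
      refine this.trans_eq ?_
      ring
    · refine e1.trans ?_
      calc _ = ENNReal.ofReal (bracket (p k - p (k + m)) ^ b) *
            (4 * testConst ψ * (N1 k * N (k + m))) := by ring
        _ ≤ _ := by
            gcongr
            · exact le_self_add
            · exact le_self_add
    · refine e2.trans ?_
      calc _ = ENNReal.ofReal (bracket (p k - p (k + m)) ^ b) *
            (4 * testConst (deriv ψ) * (N1 k * N (k + m)) +
            (4 * testConst ψ * (NG k * N (k + m)) + 4 * testConst ψ * (NG (k + m) * N k))) := by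
            ring
        _ ≤ ENNReal.ofReal (bracket (p k - p (k + m)) ^ b) *
            (4 * K * (N1 k * N (k + m)) +
            (4 * K * (NG k * N (k + m)) + 4 * K * (NG (k + m) * N k))) := by
            gcongr
            · exact le_add_self
            · exact le_self_add
            · exact le_self_add
        _ = _ := by ring
  have hr0 : -3 ≤ -3 + 3 * b := by linarith
  have hr1 : -3 + 3 * b ≤ 0 := by linarith
  refine (ENNReal.tsum_le_tsum key).trans ?_
  rw [ENNReal.tsum_mul_left, ENNReal.tsum_add, ENNReal.tsum_add]
  have s1 := tsum_weighted_mul_le hr0 hr1 0 m N1 N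
  have s2 := tsum_weighted_mul_le hr0 hr1 0 m NG N
  have s3 := tsum_weighted_mul_le hr0 hr1 m 0 NG N
  rw [← bourgainNorm_eq, ← bourgainNorm_zero_eq] at s1 s2 s3
  calc _ ≤ C * (4 * K) * (c0 * (bourgainNorm p (-b) (-3 + 3 * b) F₁ * bourgainNorm p b 0 F) +
        (c0 * (bourgainNorm p (-b) (-3 + 3 * b) G * bourgainNorm p b 0 F) +
        cm * (bourgainNorm p (-b) (-3 + 3 * b) G * bourgainNorm p b 0 F))) := by gcongr
    -- A deliberate enlargement, giving both norms the common factor c0 + cm.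
    _ ≤ C * (4 * K) * ((c0 + cm) * (bourgainNorm p (-b) (-3 + 3 * b) F₁ * bourgainNorm p b 0 F) +
        (c0 * (bourgainNorm p (-b) (-3 + 3 * b) G * bourgainNorm p b 0 F) +
        cm * (bourgainNorm p (-b) (-3 + 3 * b) G * bourgainNorm p b 0 F))) := by
        gcongr
        exact le_self_add
    _ = _ := by ring

theorem sum_boundary_le {p : ℤ → ℝ}
    (hp : (∀ k : ℤ, p k = -((k : ℝ) ^ 4 + (k : ℝ) ^ 2)) ∨
      (∀ k : ℤ, p k = (k : ℝ) ^ 4 - (k : ℝ) ^ 2)) {T : ℝ} (hT : 0 < T)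
    {m : ℤ} (hm : m ≠ 0) : ∃ C : ℝ≥0∞, C ≠ ∞ ∧ ∀ F F₁ G a : ℤ → ℝ → ℂ,
      IsSolutionFamily p T 0 F F₁ G a →
      ∑' k, ‖∫ t in Ioo 0 T, a k t * conj (a (k + m) t)‖ₑ ≤
        C * ((bourgainNorm p 0 (-3) F₁ + bourgainNorm p 0 (-3) G) * bourgainNorm p 0 0 F) := by
  obtain ⟨C, hC, hres⟩ := resonance_bound hp le_rfl zero_le_one hm
  set Q := ENNReal.ofReal (2 * Real.pi) with hQ
  set R := ENNReal.ofReal (2 / T) + 1 with hR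
  set c0 := ENNReal.ofReal ((2 * bracket ((0 : ℤ) : ℝ)) ^ 3) with hc0
  set cm := ENNReal.ofReal ((2 * bracket (m : ℝ)) ^ 3) with hcm
  refine ⟨C * (Q * R) * (3 * (c0 + cm)), by finiteness, fun F F₁ G a h => ?_⟩
  set N1 := fun k => modeNorm 0 (p k) (F₁ k)
  set NG := fun k => modeNorm 0 (p k) (G k)
  set N := fun k => modeNorm 0 (p k) (F k)
  set W := intWeight (-3 : ℝ)
  have key : ∀ k, ‖∫ t in Ioo 0 T, a k t * conj (a (k + m) t)‖ₑ ≤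
      C * (Q * R) * (W k * (N1 (k + 0) * N (k + m)) + (W k * (N1 (k + 0) * N (k + 0)) +
        (W k * (N1 (k + m) * N (k + m)) + (W k * (NG (k + 0) * N (k + 0)) +
        (W k * (NG (k + m) * N (k + m)) + (W k * (NG (k + 0) * N (k + m)) +
        W k * (NG (k + m) * N (k + 0)))))))) := fun k => by
    obtain ⟨e1, e2⟩ := boundary_estimate hT (h.mode k) (h.mode (k + m)) (h.transform k)
      (h.transform (k + m))
    have := hres k ‖∫ t in Ioo 0 T, a k t * conj (a (k + m) t)‖ₑ
      (Q * (R * (N1 k * N (k + m) + (N1 k * N k + (N1 (k + m) * N (k + m) + (NG k * N k +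
        (NG (k + m) * N (k + m) + (NG k * N (k + m) + NG (k + m) * N k)))))))) ?_ ?_
    · simp only [add_zero]
      rw [mul_zero, add_zero] at this
      refine this.trans_eq ?_
      ring
    · rw [Real.rpow_zero, ENNReal.ofReal_one, one_mul]
      refine e1.trans (mul_le_mul_right ?_ _)
      exact le_trans le_self_add (le_mul_of_one_le_left' le_add_self)
    · rw [Real.rpow_zero, ENNReal.ofReal_one, one_mul]
      refine e2.trans ?_
      gcongr
      have r1 : ENNReal.ofReal (2 / T) ≤ R := le_self_add
      have r2 : 1 ≤ R := le_add_self
      calc _ ≤ R * (N1 k * N k + N1 (k + m) * N (k + m)) +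
            R * (NG k * N k + NG (k + m) * N (k + m)) +
            R * (NG k * N (k + m) + NG (k + m) * N k) :=
            add_le_add (add_le_add (mul_le_mul_left r1 _) (le_mul_of_one_le_left' r2))
              (le_mul_of_one_le_left' r2)
        _ = R * (N1 k * N k + (N1 (k + m) * N (k + m) + (NG k * N k +
            (NG (k + m) * N (k + m) + (NG k * N (k + m) + NG (k + m) * N k))))) := by ring
        _ ≤ _ := mul_le_mul_right le_add_self _
  refine (ENNReal.tsum_le_tsum key).trans ?_
  rw [ENNReal.tsum_mul_left, ENNReal.tsum_add, ENNReal.tsum_add, ENNReal.tsum_add,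
    ENNReal.tsum_add, ENNReal.tsum_add, ENNReal.tsum_add]
  have s := fun (i j : ℤ) (x : ℤ → ℝ≥0∞) => tsum_weighted_mul_le (r := -3) le_rfl (by norm_num) i j x N
  set B1 := bourgainNorm p 0 (-3) F₁ * bourgainNorm p 0 0 F with hB1
  set BG := bourgainNorm p 0 (-3) G * bourgainNorm p 0 0 F with hBG
  have s1 : ∀ i j : ℤ, ∑' k, W k * (N1 (k + i) * N (k + j)) ≤
      ENNReal.ofReal ((2 * bracket (i : ℝ)) ^ 3) * B1 := fun i j => by
    have := s i j N1
    rwa [← bourgainNorm_eq, ← bourgainNorm_zero_eq] at this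
  have s2 : ∀ i j : ℤ, ∑' k, W k * (NG (k + i) * N (k + j)) ≤
      ENNReal.ofReal ((2 * bracket (i : ℝ)) ^ 3) * BG := fun i j => by
    have := s i j NG
    rwa [← bourgainNorm_eq, ← bourgainNorm_zero_eq] at this
  calc _ ≤ C * (Q * R) * (c0 * B1 + (c0 * B1 + (cm * B1 + (c0 * BG + (cm * BG +
        (c0 * BG + cm * BG)))))) := by
        gcongr
        exacts [s1 0 m, s1 0 0, s1 m m, s2 0 0, s2 m m, s2 0 m, s2 m 0]
    -- The added terms bring every coefficient up to 3, so the sum factors as 3(c0 + cm) times B1 +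
    -- BG.
    _ ≤ C * (Q * R) * (c0 * B1 + (c0 * B1 + (cm * B1 + (c0 * BG + (cm * BG +
        (c0 * BG + cm * BG))))) + (c0 * B1 + 2 * (cm * B1) + (c0 * BG + cm * BG))) :=
        mul_le_mul_right le_self_add _
    _ = _ := by rw [hB1, hBG]; ring

/-! ### Smallness of the off-diagonal correlations. -/

/-- The order of choice matters: R is taken large first, making R^{-b} small (hence b > 0), and only
then is δ taken small against that R. -/
theorem exists_small_tail {b T : ℝ} (hb : 0 < b) (hT : 0 < T) {κ : ℝ≥0∞} (hκ : κ ≠ 0) :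
    ∃ R δ : ℝ, 0 < R ∧ 0 < δ ∧ δ < T / 2 ∧
      2 * (ENNReal.ofReal (2 * R) * ENNReal.ofReal (2 * δ)) +
        2 * ENNReal.ofReal (2 * Real.pi * (R ^ (-b)) ^ 2) ≤ κ := by
  have hκ2 : 0 < κ / 2 := ENNReal.half_pos hκ
  have h1 : Tendsto (fun R : ℝ => 2 * ENNReal.ofReal (2 * Real.pi * (R ^ (-b)) ^ 2)) atTop
      (𝓝 (2 * ENNReal.ofReal (2 * Real.pi * 0 ^ 2))) :=
    ENNReal.Tendsto.const_mul (ENNReal.tendsto_ofReal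
      (((tendsto_rpow_neg_atTop hb).pow 2).const_mul _)) (Or.inr (by simp))
  simp only [ne_eq, OfNat.ofNat_ne_zero, not_false_eq_true, zero_pow, mul_zero,
    ENNReal.ofReal_zero] at h1
  obtain ⟨R, hR, hR0⟩ := ((h1.eventually_le_const hκ2).and (eventually_gt_atTop 0)).exists
  have h2 : Tendsto (fun δ : ℝ => 2 * (ENNReal.ofReal (2 * R) * ENNReal.ofReal (2 * δ))) (𝓝[>] 0)
      (𝓝 (2 * (ENNReal.ofReal (2 * R) * ENNReal.ofReal (2 * 0)))) := by
    refine Tendsto.mono_left ?_ nhdsWithin_le_nhds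
    exact ENNReal.Tendsto.const_mul (ENNReal.Tendsto.const_mul (ENNReal.tendsto_ofReal
      (tendsto_id.const_mul 2)) (Or.inr ENNReal.ofReal_ne_top)) (Or.inr (by simp))
  simp only [mul_zero, ENNReal.ofReal_zero] at h2
  obtain ⟨δ, hδ, hδ0, hδT⟩ := ((h2.eventually_le_const hκ2).and
    (Ioo_mem_nhdsGT (half_pos hT))).exists
  exact ⟨R, δ, hR0, hδ0, hδT, (add_le_add hδ hR).trans_eq (ENNReal.add_halves κ)⟩

theorem exists_cutoff {T δ : ℝ} (hδ : 0 < δ) (hδT : δ < T / 2) : ∃ ψ : ℝ → ℂ, IsTest ψ ∧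
    tsupport ψ ⊆ Icc (δ / 2) (T - δ / 2) ∧ (∀ t, ‖1 - ψ t‖ ≤ 1) ∧
    ∀ t ∈ Icc δ (T - δ), ψ t = 1 := by
  let f : ContDiffBump (T / 2 : ℝ) := ⟨T / 2 - δ, T / 2 - δ / 2, by linarith, by linarith⟩
  have hT : IsTest fun t => (f t : ℂ) :=
    ⟨Complex.ofRealCLM.contDiff.comp f.contDiff,
      f.hasCompactSupport.comp_left (g := fun x : ℝ => (x : ℂ)) (by simp)⟩
  refine ⟨fun t => (f t : ℂ), hT, ?_, fun t => ?_, fun t ht => ?_⟩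
  · have hsub : tsupport (fun t => (f t : ℂ)) ⊆ tsupport f :=
      closure_mono fun t ht => by simpa using ht
    refine hsub.trans ?_
    rw [f.tsupport_eq, Real.closedBall_eq_Icc]
    refine Icc_subset_Icc ?_ ?_ <;> simp only [f] <;> linarith
  · rw [← Complex.ofReal_one, ← Complex.ofReal_sub, Complex.norm_real, Real.norm_eq_abs, abs_le]
    constructor <;> linarith [f.nonneg (x := t), f.le_one (x := t)]
  · have : f t = 1 := f.one_of_mem_closedBall (by
      rw [Real.closedBall_eq_Icc]
      exact ⟨by simp only [f]; linarith [ht.1], by simp only [f]; linarith [ht.2]⟩)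
    simp [this]

theorem exists_mul_le {K κ : ℝ≥0∞} (hK : K ≠ ∞) (hκ : κ ≠ 0) : ∃ η : ℝ≥0∞, η ≠ 0 ∧ K * η ≤ κ :=
  ⟨κ / (K + 1), ENNReal.div_ne_zero.2 ⟨hκ, by finiteness⟩,
    (mul_le_mul_left le_self_add _).trans ENNReal.mul_div_le⟩

/-- Only a set of measure at most 2δ near the endpoints contributes. Equiintegrability bounds each
mode there with a factor independent of k, and Cauchy–Schwarz in k sums the bounds. -/
theorem sum_tail_le {p : ℤ → ℝ} {T b R δ : ℝ} (hb : 0 ≤ b) (hR : 0 < R) (hδ : 0 < δ)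
    {F F₁ G a : ℤ → ℝ → ℂ} (h : IsSolutionFamily p T b F F₁ G a) {χ : ℝ → ℂ}
    (hχ : ∀ t, ‖χ t‖ ≤ 1) (hχ0 : ∀ t ∈ Icc δ (T - δ), χ t = 0) (m : ℤ) :
    ∑' k, ‖∫ t in Ioo 0 T, χ t * (a k t * conj (a (k + m) t))‖ₑ ≤
      (2 * (ENNReal.ofReal (2 * R) * ENNReal.ofReal (2 * δ)) +
        2 * ENNReal.ofReal (2 * Real.pi * (R ^ (-b)) ^ 2)) * bourgainNorm p b 0 F ^ 2 := by
  set Q := 2 * (ENNReal.ofReal (2 * R) * ENNReal.ofReal (2 * δ)) +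
        2 * ENNReal.ofReal (2 * Real.pi * (R ^ (-b)) ^ 2) with hQ
  set S : Set ℝ := Ioo 0 δ ∪ Ioo (T - δ) T with hS
  have hSm : MeasurableSet S := measurableSet_Ioo.union measurableSet_Ioo
  have hvol : volume S ≤ ENNReal.ofReal (2 * δ) := by
    refine (measure_union_le _ _).trans_eq ?_
    rw [Real.volume_Ioo, Real.volume_Ioo, sub_zero, sub_sub_cancel, ← ENNReal.ofReal_add hδ.le hδ.le,
      two_mul]
  have hsq : ∀ k, eLpNorm (a k) 2 (volume.restrict S) ^ 2 ≤ Q * modeNorm b (p k) (F k) ^ 2 :=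
    fun k => by
      rw [eLpNorm_two_sq]
      refine (lintegral_transform_le hb hR (h.mode k).meas (h.mode k).lt_top (h.transform k)
        S).trans (mul_le_mul_left (add_le_add_left (mul_le_mul_right (mul_le_mul_right hvol _) _) _) _)
  have hk : ∀ k, ‖∫ t in Ioo 0 T, χ t * (a k t * conj (a (k + m) t))‖ₑ ≤
      eLpNorm (a k) 2 (volume.restrict S) * eLpNorm (a (k + m)) 2 (volume.restrict S) := fun k => by
    refine le_trans ?_ (lintegral_enorm_mul_le (h.transform k).memLp.1.restrict
      (h.transform (k + m)).memLp.1.restrict)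
    refine (enorm_integral_le_lintegral_enorm _).trans ?_
    rw [← lintegral_indicator measurableSet_Ioo, ← lintegral_indicator hSm]
    refine lintegral_mono fun t => ?_
    by_cases ht : t ∈ Ioo 0 T
    · rw [indicator_of_mem ht]
      by_cases hts : t ∈ S
      · rw [indicator_of_mem hts, enorm_mul, enorm_mul, RCLike.enorm_conj]
        refine mul_le_of_le_one_left' ?_
        rw [← ofReal_norm]
        exact ENNReal.ofReal_le_one.2 (hχ t)
      · have : t ∈ Icc δ (T - δ) := by
          simp only [hS, mem_union, not_or, mem_Ioo, not_and, not_lt] at hts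
          refine ⟨hts.1 ht.1, ?_⟩
          by_contra hc
          exact absurd ht.2 (not_lt.2 (hts.2 (not_le.1 hc)))
        rw [hχ0 t this, zero_mul, enorm_zero]
        exact zero_le
    · rw [indicator_of_notMem ht]; exact zero_le
  refine (ENNReal.tsum_le_tsum hk).trans ((tsum_mul_le (fun k => eLpNorm (a k) 2 (volume.restrict S))
    fun k => eLpNorm (a (k + m)) 2 (volume.restrict S)).trans ?_)
  have e := (Equiv.addRight m).tsum_eq (fun k => eLpNorm (a k) 2 (volume.restrict S) ^ 2)
  simp only [Equiv.coe_addRight] at e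
  rw [e, ← ENNReal.rpow_add_of_nonneg _ _ (by norm_num) (by norm_num)]
  norm_num only
  rw [ENNReal.rpow_one]
  refine (ENNReal.tsum_le_tsum hsq).trans_eq ?_
  rw [ENNReal.tsum_mul_left, bourgainNorm_zero_eq, ← ENNReal.rpow_natCast, ← ENNReal.rpow_mul]
  norm_num

/-- Off-diagonal correlations of the modes are small. -/
theorem exists_correlation_le {p : ℤ → ℝ}
    (hp : (∀ k : ℤ, p k = -((k : ℝ) ^ 4 + (k : ℝ) ^ 2)) ∨
      (∀ k : ℤ, p k = (k : ℝ) ^ 4 - (k : ℝ) ^ 2)) {T b : ℝ} (hT : 0 < T) (hb0 : 0 ≤ b) (hb1 : b ≤ 1)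
    {m : ℤ} (hm : m ≠ 0) {C κ : ℝ≥0∞} (hC : C ≠ ∞) (hκ : κ ≠ 0) :
    ∃ η : ℝ≥0∞, η ≠ 0 ∧ ∀ F F₁ G a : ℤ → ℝ → ℂ, IsSolutionFamily p T b F F₁ G a →
      bourgainNorm p b 0 F ≤ C → bourgainNorm p (-b) (-3 + 3 * b) F₁ ≤ η →
      bourgainNorm p (-b) (-3 + 3 * b) G ≤ η →
      ∑' k, ‖∫ t in Ioo 0 T, a k t * conj (a (k + m) t)‖ₑ ≤ κ := by
  -- At b = 0 there is no equiintegrability, so the estimate without a time cutoff is used there;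
  -- for b > 0 a cutoff and a small tail.
  rcases hb0.eq_or_lt with rfl | hb
  · obtain ⟨K, hK, h⟩ := sum_boundary_le hp hT hm
    obtain ⟨η, hη, hle⟩ := exists_mul_le (K := K * 2 * C) (by finiteness) hκ
    refine ⟨η, hη, fun F F₁ G a hs hF hF₁ hG => (h F F₁ G a hs).trans (le_trans ?_ hle)⟩
    simp only [neg_zero, mul_zero, add_zero] at hF₁ hG
    calc _ ≤ K * ((η + η) * C) := by gcongr
      _ = _ := by ring
  · have hκ2 : κ / 2 ≠ 0 := (ENNReal.half_pos hκ).ne'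
    -- The tail tolerance q fixes δ and hence ψ; the constant K depends on ψ, so η has to be chosen
    -- last.
    obtain ⟨q, hq, hqle⟩ := exists_mul_le (K := C ^ 2) (by finiteness) hκ2
    obtain ⟨R, δ, hR, hδ, hδT, hRδ⟩ := exists_small_tail hb hT hq
    obtain ⟨ψ, hψ, hψs, hψ1, hψe⟩ := exists_cutoff hδ hδT
    obtain ⟨K, hK, h⟩ := sum_interior_le hp hb0 hb1 hm hψ (half_pos hδ)
      (show T - δ / 2 < T by linarith) hψs
    obtain ⟨η, hη, hle⟩ := exists_mul_le (K := K * 2 * C) (by finiteness) hκ2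
    refine ⟨η, hη, fun F F₁ G a hs hF hF₁ hG => ?_⟩
    have t1 : ∑' k, ‖∫ t, ψ t * (a k t * conj (a (k + m) t))‖ₑ ≤ κ / 2 := by
      refine (h F F₁ G a hs).trans (le_trans ?_ hle)
      calc _ ≤ K * ((η + η) * C) := by gcongr
        _ = _ := by ring
    have t2 : ∑' k, ‖∫ t in Ioo 0 T, (1 - ψ t) * (a k t * conj (a (k + m) t))‖ₑ ≤ κ / 2 := by
      refine (sum_tail_le hb0 hR hδ hs hψ1
        (fun t ht => by simp [hψe t ht]) m).trans (le_trans ?_ hqle)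
      rw [mul_comm]
      gcongr
    have hk : ∀ k, ‖∫ t in Ioo 0 T, a k t * conj (a (k + m) t)‖ₑ ≤
        ‖∫ t, ψ t * (a k t * conj (a (k + m) t))‖ₑ +
        ‖∫ t in Ioo 0 T, (1 - ψ t) * (a k t * conj (a (k + m) t))‖ₑ := fun k => by
      have hi : Integrable fun t => a k t * conj (a (k + m) t) :=
        (hs.transform k).memLp.integrable_mul (hs.transform (k + m)).memLp.star
      obtain ⟨M, hM⟩ := hψ.1.continuous.bounded_above_of_compact_support hψ.2
      have i1 : Integrable fun t => ψ t * (a k t * conj (a (k + m) t)) :=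
        hi.bdd_mul hψ.1.continuous.aestronglyMeasurable (ae_of_all _ hM)
      have i2 : Integrable fun t => (1 - ψ t) * (a k t * conj (a (k + m) t)) :=
        hi.bdd_mul (continuous_const.sub hψ.1.continuous).aestronglyMeasurable (ae_of_all _ hψ1)
      have e1 : ∫ t, ψ t * (a k t * conj (a (k + m) t)) =
          ∫ t in Ioo 0 T, ψ t * (a k t * conj (a (k + m) t)) := by
        refine (setIntegral_eq_integral_of_forall_compl_eq_zero fun t ht => ?_).symm
        rw [image_eq_zero_of_notMem_tsupport (f := ψ), zero_mul]
        exact fun hc => ht ⟨by linarith [(hψs hc).1], by linarith [(hψs hc).2]⟩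
      refine le_trans (le_of_eq ?_) (enorm_add_le _ _)
      rw [e1, ← integral_add i1.integrableOn i2.integrableOn]
      congr 2; ext t; ring
    calc _ ≤ ∑' k, (‖∫ t, ψ t * (a k t * conj (a (k + m) t))‖ₑ +
          ‖∫ t in Ioo 0 T, (1 - ψ t) * (a k t * conj (a (k + m) t))‖ₑ) :=
          ENNReal.tsum_le_tsum hk
      _ ≤ κ / 2 + κ / 2 := by rw [ENNReal.tsum_add]; exact add_le_add t1 t2
      _ = κ := ENNReal.add_halves κ

/-! ### Fourier series in space and the density |g|². -/

/-- The Fourier coefficients over a period, `∫ f(x) exp(-ikx) dx`. -/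
def coeff (f : ℝ → ℂ) (k : ℤ) : ℂ :=
  ∫ x in Ioc 0 (2 * Real.pi), f x * Complex.exp (-(Complex.I * (k * x)))

theorem norm_exp_neg_I_mul (k : ℤ) (x : ℝ) : ‖Complex.exp (-(Complex.I * (k * x)))‖ = 1 := by
  have : -(Complex.I * ((k : ℂ) * x)) = Complex.I * ((-(k * x) : ℝ) : ℂ) := by push_cast; ring
  rw [this, Complex.norm_exp_I_mul_ofReal]

theorem continuous_exp_neg_I_mul (k : ℤ) :
    Continuous fun x : ℝ => Complex.exp (-(Complex.I * (k * x))) := by fun_prop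

theorem integrable_mul_exp_neg {μ : Measure ℝ} {f : ℝ → ℂ} (hf : Integrable f μ) (k : ℤ) :
    Integrable (fun x : ℝ => f x * Complex.exp (-(Complex.I * (k * x)))) μ :=
  hf.mul_bdd (c := 1) (continuous_exp_neg_I_mul k).aestronglyMeasurable
    (ae_of_all _ fun x => (norm_exp_neg_I_mul k x).le)

theorem coeff_add {f g : ℝ → ℂ} (hf : Integrable f (volume.restrict (Ioc 0 (2 * Real.pi))))
    (hg : Integrable g (volume.restrict (Ioc 0 (2 * Real.pi)))) (k : ℤ) :
    coeff (fun x => f x + g x) k = coeff f k + coeff g k := by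
  rw [coeff, coeff, coeff, ← integral_add (integrable_mul_exp_neg hf k)
    (integrable_mul_exp_neg hg k)]
  simp only [add_mul]

theorem coeff_const_mul (c : ℂ) (f : ℝ → ℂ) (k : ℤ) :
    coeff (fun x => c * f x) k = c * coeff f k := by
  rw [coeff, coeff, ← integral_const_mul]
  simp only [mul_assoc]

theorem hasSum_norm_coeff_sq {f : ℝ → ℂ} (hf : MemLp f 2 (volume.restrict (Ioc 0 (2 * Real.pi)))) :
    HasSum (fun k => ‖coeff f k‖ ^ 2) (2 * Real.pi * ∫ x in Ioc 0 (2 * Real.pi), ‖f x‖ ^ 2) := by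
  have hpi : (0 : ℝ) < 2 * Real.pi := by positivity
  have h := (hasSum_sq_fourierCoeffOn hpi hf).mul_left ((2 * Real.pi) ^ 2)
  have e : ∀ k, (2 * Real.pi) ^ 2 * ‖fourierCoeffOn hpi f k‖ ^ 2 = ‖coeff f k‖ ^ 2 := fun k => by
    rw [← mul_pow, fourierCoeffOn_eq_integral, norm_smul, intervalIntegral.integral_of_le hpi.le,
      Real.norm_of_nonneg (by positivity), coeff, ← mul_assoc, sub_zero, mul_one_div_cancel hpi.ne',
      one_mul]
    congr 2
    refine integral_congr_ae (ae_of_all _ fun x => ?_)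
    simp only [fourier_coe_apply, smul_eq_mul]
    rw [mul_comm]
    congr 2
    have : (Real.pi : ℂ) ≠ 0 := by exact_mod_cast Real.pi_ne_zero
    push_cast; field_simp
  simp only [e] at h
  have e2 : (2 * Real.pi) ^ 2 * ((2 * Real.pi - 0)⁻¹ • ∫ x in (0 : ℝ)..2 * Real.pi, ‖f x‖ ^ 2) =
      2 * Real.pi * ∫ x in Ioc 0 (2 * Real.pi), ‖f x‖ ^ 2 := by
    rw [intervalIntegral.integral_of_le hpi.le, smul_eq_mul, sub_zero]
    field_simp
  rwa [e2] at h

/-- Polarisation, with the signs arranged so that each term has the form ‖z + c w‖² for c = 1, -1,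
i, -i. This reduces the sesquilinear Parseval identity to the quadratic one. -/
theorem four_mul_conj (z w : ℂ) : z * conj w = (1 / 4 : ℂ) * ((‖z + w‖ ^ 2 : ℝ) +
    -(‖z + (-1) * w‖ ^ 2 : ℝ) + Complex.I * (‖z + Complex.I * w‖ ^ 2 : ℝ) +
    -(Complex.I * (‖z + (-Complex.I) * w‖ ^ 2 : ℝ))) := by
  simp only [← Complex.normSq_eq_norm_sq]
  apply Complex.ext <;>
  · simp [Complex.normSq_apply]
    ring

theorem hasSum_coeff_mul_conj {f g : ℝ → ℂ}
    (hf : MemLp f 2 (volume.restrict (Ioc 0 (2 * Real.pi))))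
    (hg : MemLp g 2 (volume.restrict (Ioc 0 (2 * Real.pi)))) :
    HasSum (fun k => coeff f k * conj (coeff g k))
      (2 * Real.pi * ∫ x in Ioc 0 (2 * Real.pi), f x * conj (g x)) := by
  have hfi := hf.integrable (by norm_num)
  have hm : ∀ c : ℂ, MemLp (fun x => f x + c * g x) 2 (volume.restrict (Ioc 0 (2 * Real.pi))) :=
    fun c => hf.add (hg.const_mul c)
  have hs : ∀ c : ℂ, HasSum (fun k => ((‖coeff f k + c * coeff g k‖ ^ 2 : ℝ) : ℂ))
      ((2 * Real.pi * ∫ x in Ioc 0 (2 * Real.pi), ‖f x + c * g x‖ ^ 2 : ℝ) : ℂ) := fun c => by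
    have := hasSum_norm_coeff_sq (hm c)
    rw [← Complex.hasSum_ofReal] at this
    refine this.congr_fun fun k => ?_
    rw [coeff_add hfi ((hg.const_mul c).integrable (by norm_num)), coeff_const_mul]
  have hi : ∀ c : ℂ, Integrable (fun x => ((‖f x + c * g x‖ ^ 2 : ℝ) : ℂ))
      (volume.restrict (Ioc 0 (2 * Real.pi))) := fun c => (hm c).norm.integrable_sq.ofReal
  have h := ((((hs 1).add (hs (-1)).neg).add ((hs Complex.I).mul_left Complex.I)).add
    ((hs (-Complex.I)).mul_left Complex.I).neg).mul_left (1 / 4 : ℂ)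
  have e : ∀ x, f x * conj (g x) = (1 / 4 : ℂ) * (((‖f x + 1 * g x‖ ^ 2 : ℝ) +
      -(‖f x + (-1) * g x‖ ^ 2 : ℝ) + Complex.I * (‖f x + Complex.I * g x‖ ^ 2 : ℝ)) +
      -(Complex.I * (‖f x + (-Complex.I) * g x‖ ^ 2 : ℝ))) := fun x => by
    rw [one_mul]; exact four_mul_conj _ _
  have i4 : Integrable (fun x => -((‖f x + (-1) * g x‖ ^ 2 : ℝ) : ℂ))
      (volume.restrict (Ioc 0 (2 * Real.pi))) := (hi (-1)).neg
  have j0 : Integrable (fun x => ((‖f x + 1 * g x‖ ^ 2 : ℝ) : ℂ) + -(‖f x + (-1) * g x‖ ^ 2 : ℝ))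
      (volume.restrict (Ioc 0 (2 * Real.pi))) := (hi 1).add (hi (-1)).neg
  have j2 : Integrable (fun x => Complex.I * ((‖f x + Complex.I * g x‖ ^ 2 : ℝ) : ℂ))
      (volume.restrict (Ioc 0 (2 * Real.pi))) := (hi Complex.I).const_mul Complex.I
  have j1 : Integrable (fun x => ((‖f x + 1 * g x‖ ^ 2 : ℝ) : ℂ) + -(‖f x + (-1) * g x‖ ^ 2 : ℝ) +
      Complex.I * ((‖f x + Complex.I * g x‖ ^ 2 : ℝ) : ℂ))
      (volume.restrict (Ioc 0 (2 * Real.pi))) := j0.add j2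
  have j3 : Integrable (fun x => -(Complex.I * ((‖f x + (-Complex.I) * g x‖ ^ 2 : ℝ) : ℂ)))
      (volume.restrict (Ioc 0 (2 * Real.pi))) := ((hi (-Complex.I)).const_mul Complex.I).neg
  have hv : (2 * Real.pi : ℂ) * ∫ x in Ioc 0 (2 * Real.pi), f x * conj (g x) = (1 / 4 : ℂ) *
      (((2 * Real.pi * ∫ x in Ioc 0 (2 * Real.pi), ‖f x + 1 * g x‖ ^ 2 : ℝ) : ℂ) +
      -((2 * Real.pi * ∫ x in Ioc 0 (2 * Real.pi), ‖f x + (-1) * g x‖ ^ 2 : ℝ) : ℂ) +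
      Complex.I * ((2 * Real.pi * ∫ x in Ioc 0 (2 * Real.pi),
        ‖f x + Complex.I * g x‖ ^ 2 : ℝ) : ℂ) +
      -(Complex.I * ((2 * Real.pi * ∫ x in Ioc 0 (2 * Real.pi),
        ‖f x + (-Complex.I) * g x‖ ^ 2 : ℝ) : ℂ))) := by
    simp only [e]
    rw [integral_const_mul, integral_add j1 j3, integral_add j0 j2,
      integral_add (hi 1) i4]
    simp only [integral_neg, integral_const_mul, integral_complex_ofReal]
    push_cast
    ring
  rw [hv]
  refine h.congr_fun fun k => ?_
  rw [four_mul_conj]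
  simp only [one_mul]

theorem coeff_exp_mul (f : ℝ → ℂ) (m k : ℤ) :
    coeff (fun x => f x * Complex.exp (Complex.I * (m * x))) (k + m) = coeff f k := by
  rw [coeff, coeff]
  congr 1; ext x
  rw [mul_assoc, ← Complex.exp_add]
  congr 2; push_cast; ring

/-- Multiplication by exp(imx) shifts coefficients by m, so the correlation at lag m is Parseval's
identity for f exp(imx) against f. -/
theorem hasSum_coeff_mul_conj_shift {f : ℝ → ℂ}
    (hf : MemLp f 2 (volume.restrict (Ioc 0 (2 * Real.pi)))) (m : ℤ) :
    HasSum (fun k => coeff f k * conj (coeff f (k + m))) (2 * Real.pi *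
      ∫ x in Ioc 0 (2 * Real.pi), f x * conj (f x) * Complex.exp (Complex.I * (m * x))) := by
  have hm : MemLp (fun x : ℝ => f x * Complex.exp (Complex.I * (m * x))) 2
      (volume.restrict (Ioc 0 (2 * Real.pi))) := by
    refine hf.mono (hf.1.mul (by fun_prop : Continuous fun x : ℝ =>
      Complex.exp (Complex.I * (m * x))).aestronglyMeasurable) (ae_of_all _ fun x => ?_)
    have := norm_exp_I_mul m x
    push_cast at this
    rw [norm_mul, this, mul_one]
  have h := (hasSum_coeff_mul_conj hm hf)
  rw [← (Equiv.addRight m).hasSum_iff] at h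
  simp only [Function.comp_def, Equiv.coe_addRight, coeff_exp_mul] at h
  have e : ∀ x : ℝ, f x * conj (f x) * Complex.exp (Complex.I * (m * x)) =
      f x * Complex.exp (Complex.I * (m * x)) * conj (f x) := fun x => by ring
  simp only [e]
  exact h

theorem cylinderMeasure_univ (T : ℝ) : cylinderMeasure T univ =
    (volume.restrict (Ioo 0 T)).prod (volume.restrict (Ioc 0 (2 * Real.pi))) := by
  rw [Measure.prod_restrict, cylinderMeasure]
  simp [Measure.volume_eq_prod]
  rfl

instance (T : ℝ) : IsFiniteMeasure (cylinderMeasure T univ) := by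
  rw [cylinderMeasure_univ]; infer_instance

/-- Square integrability of almost every time slice. -/
theorem memLp_slice {T : ℝ} {g : ℝ × ℝ → ℂ} (hg : MemLp g 2 (cylinderMeasure T univ)) :
    ∀ᵐ t ∂(volume.restrict (Ioo 0 T)),
      MemLp (fun x => g (t, x)) 2 (volume.restrict (Ioc 0 (2 * Real.pi))) := by
  rw [cylinderMeasure_univ] at hg
  have h1 := hg.1.prodMk_left
  have h2 : ∫⁻ t in Ioo 0 T, ∫⁻ x in Ioc 0 (2 * Real.pi), ‖g (t, x)‖ₑ ^ 2 < ∞ := by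
    rw [← lintegral_prod _ (hg.1.enorm.pow_const 2), ← eLpNorm_two_sq]
    exact ENNReal.pow_lt_top hg.2
  have h3 := ae_lt_top' (hg.1.enorm.pow_const 2).lintegral_prod_right' h2.ne
  filter_upwards [h1, h3] with t ht1 ht3
  refine ⟨ht1, ?_⟩
  rw [← eLpNorm_two_sq] at ht3
  simpa using ht3

theorem aestronglyMeasurable_coeff {T : ℝ} {g : ℝ × ℝ → ℂ}
    (hg : MemLp g 2 (cylinderMeasure T univ)) (k : ℤ) :
    AEStronglyMeasurable (fun t => coeff (fun x => g (t, x)) k) (volume.restrict (Ioo 0 T)) := by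
  rw [cylinderMeasure_univ] at hg
  have : AEStronglyMeasurable (fun z : ℝ × ℝ => g z * Complex.exp (-(Complex.I * (k * z.2))))
      ((volume.restrict (Ioo 0 T)).prod (volume.restrict (Ioc 0 (2 * Real.pi)))) :=
    hg.1.mul (by fun_prop : Continuous fun z : ℝ × ℝ =>
      Complex.exp (-(Complex.I * (k * z.2)))).aestronglyMeasurable
  exact this.integral_prod_right'

theorem tsum_enorm_coeff_sq {f : ℝ → ℂ} (hf : MemLp f 2 (volume.restrict (Ioc 0 (2 * Real.pi)))) :
    ∑' k, ‖coeff f k‖ₑ ^ 2 =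
      ENNReal.ofReal (2 * Real.pi) * ∫⁻ x in Ioc 0 (2 * Real.pi), ‖f x‖ₑ ^ 2 := by
  have h := hasSum_norm_coeff_sq hf
  have e : ∀ z : ℂ, ‖z‖ₑ ^ 2 = ENNReal.ofReal (‖z‖ ^ 2) := fun z => by
    rw [ENNReal.ofReal_pow (norm_nonneg _), ofReal_norm]
  simp only [e]
  rw [← ENNReal.ofReal_tsum_of_nonneg (fun k => by positivity) h.summable, h.tsum_eq,
    ENNReal.ofReal_mul (by positivity), ofReal_integral_eq_lintegral_ofReal hf.norm.integrable_sq
    (ae_of_all _ fun x => by positivity)]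

theorem tsum_lintegral_coeff_sq {T : ℝ} {g : ℝ × ℝ → ℂ}
    (hg : MemLp g 2 (cylinderMeasure T univ)) :
    ∑' k, ∫⁻ t in Ioo 0 T, ‖coeff (fun x => g (t, x)) k‖ₑ ^ 2 =
      ENNReal.ofReal (2 * Real.pi) * eLpNorm g 2 (cylinderMeasure T univ) ^ 2 := by
  rw [← lintegral_tsum fun k => (aestronglyMeasurable_coeff hg k).enorm.pow_const 2]
  have h1 : ∫⁻ t in Ioo 0 T, ∑' k, ‖coeff (fun x => g (t, x)) k‖ₑ ^ 2 = ∫⁻ t in Ioo 0 T,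
      ENNReal.ofReal (2 * Real.pi) * ∫⁻ x in Ioc 0 (2 * Real.pi), ‖g (t, x)‖ₑ ^ 2 := by
    refine lintegral_congr_ae ?_
    filter_upwards [memLp_slice hg] with t ht using tsum_enorm_coeff_sq ht
  rw [h1, lintegral_const_mul' _ _ ENNReal.ofReal_ne_top, eLpNorm_two_sq]
  rw [cylinderMeasure_univ] at hg ⊢
  rw [lintegral_prod _ (hg.1.enorm.pow_const 2)]

theorem memLp_coeff {T : ℝ} {g : ℝ × ℝ → ℂ} (hg : MemLp g 2 (cylinderMeasure T univ)) (k : ℤ) :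
    MemLp (fun t => coeff (fun x => g (t, x)) k) 2 (volume.restrict (Ioo 0 T)) := by
  refine ⟨aestronglyMeasurable_coeff hg k, ?_⟩
  have h := (ENNReal.le_tsum k).trans_eq (tsum_lintegral_coeff_sq hg)
  rw [← eLpNorm_two_sq] at h
  have := h.trans_lt (ENNReal.mul_lt_top ENNReal.ofReal_lt_top (ENNReal.pow_lt_top hg.2))
  simpa using this

/-- The Fourier coefficients in space of `|g|²`, integrated in time. -/
theorem enorm_integral_density_mul_exp_le {T : ℝ} {g : ℝ × ℝ → ℂ}
    (hg : MemLp g 2 (cylinderMeasure T univ)) (m : ℤ) :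
    ‖∫ z, g z * conj (g z) * Complex.exp (Complex.I * (m * z.2)) ∂(cylinderMeasure T univ)‖ₑ ≤
      ∑' k, ‖∫ t in Ioo 0 T, coeff (fun x => g (t, x)) k *
        conj (coeff (fun x => g (t, x)) (k + m))‖ₑ := by
  have hi : Integrable (fun z : ℝ × ℝ => g z * conj (g z) * Complex.exp (Complex.I * (m * z.2)))
      (cylinderMeasure T univ) := by
    refine (hg.integrable_mul hg.star).mul_bdd (c := 1) (by fun_prop : Continuous fun z : ℝ × ℝ =>
      Complex.exp (Complex.I * (m * z.2))).aestronglyMeasurable (ae_of_all _ fun z => ?_)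
    have := norm_exp_I_mul m z.2
    push_cast at this
    exact this.le
  have e1 : (2 * Real.pi : ℂ) * ∫ z, g z * conj (g z) * Complex.exp (Complex.I * (m * z.2))
      ∂(cylinderMeasure T univ) = ∫ t in Ioo 0 T, ∑' k, coeff (fun x => g (t, x)) k *
        conj (coeff (fun x => g (t, x)) (k + m)) := by
    have h2 : ∫ t in Ioo 0 T, ∑' k, coeff (fun x => g (t, x)) k *
        conj (coeff (fun x => g (t, x)) (k + m)) = ∫ t in Ioo 0 T, (2 * Real.pi : ℂ) *
        ∫ x in Ioc 0 (2 * Real.pi), g (t, x) * conj (g (t, x)) *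
          Complex.exp (Complex.I * (m * x)) := by
      refine integral_congr_ae ?_
      filter_upwards [memLp_slice hg] with t ht using (hasSum_coeff_mul_conj_shift ht m).tsum_eq
    rw [h2, integral_const_mul]
    rw [cylinderMeasure_univ] at hi ⊢
    rw [integral_prod _ hi]
  -- Absolute summability, by Cauchy–Schwarz in t and then in k; it justifies exchanging the
  -- frequency sum with the time integral.
  have hfin : ∑' k, ∫⁻ t in Ioo 0 T, ‖coeff (fun x => g (t, x)) k *
      conj (coeff (fun x => g (t, x)) (k + m))‖ₑ ≠ ∞ := by
    set N : ℤ → ℝ≥0∞ := fun k =>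
      eLpNorm (fun t => coeff (fun x => g (t, x)) k) 2 (volume.restrict (Ioo 0 T))
    have h1 : ∀ k, ∫⁻ t in Ioo 0 T, ‖coeff (fun x => g (t, x)) k *
        conj (coeff (fun x => g (t, x)) (k + m))‖ₑ ≤ N k * N (k + m) := fun k => by
      simp only [enorm_mul, RCLike.enorm_conj]
      exact lintegral_enorm_mul_le (memLp_coeff hg k).1 (memLp_coeff hg (k + m)).1
    have h2 : ∑' k, N k ^ 2 < ∞ := by
      have := tsum_lintegral_coeff_sq hg
      simp only [← eLpNorm_two_sq] at this
      rw [this]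
      exact ENNReal.mul_lt_top ENNReal.ofReal_lt_top (ENNReal.pow_lt_top hg.2)
    refine ((ENNReal.tsum_le_tsum h1).trans_lt ((tsum_mul_le _ _).trans_lt ?_)).ne
    have e := (Equiv.addRight m).tsum_eq (fun k => N k ^ 2)
    simp only [Equiv.coe_addRight] at e
    rw [e]
    exact ENNReal.mul_lt_top (ENNReal.rpow_lt_top_of_nonneg (by norm_num) h2.ne)
      (ENNReal.rpow_lt_top_of_nonneg (by norm_num) h2.ne)
  have hms : ∀ k, AEStronglyMeasurable (fun t => coeff (fun x => g (t, x)) k *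
      conj (coeff (fun x => g (t, x)) (k + m))) (volume.restrict (Ioo 0 T)) := fun k =>
    (aestronglyMeasurable_coeff hg k).mul
      (Complex.continuous_conj.comp_aestronglyMeasurable (aestronglyMeasurable_coeff hg (k + m)))
  rw [integral_tsum hms hfin] at e1
  have e2 := congrArg enorm e1
  rw [enorm_mul] at e2
  refine le_trans ?_ (e2.trans_le enorm_tsum_le_tsum_enorm)
  -- The Parseval factor 2π is at least 1 and is simply dropped.
  refine le_mul_of_one_le_left' ?_
  rw [← ofReal_norm, show (1 : ℝ≥0∞) = ENNReal.ofReal 1 by simp]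
  refine ENNReal.ofReal_le_ofReal ?_
  have : ‖(2 * Real.pi : ℂ)‖ = 2 * Real.pi := by
    rw [norm_mul, Complex.norm_real, Real.norm_of_nonneg Real.pi_pos.le]; simp
  rw [this]
  linarith [Real.pi_gt_three]

/-! ### Single-frequency test functions and reduction to modes. -/

/-- The function `ψ(t) exp(-ikx)`. -/
def modeFun (k : ℤ) (ψ : ℝ → ℂ) (z : ℝ × ℝ) : ℂ :=
  ψ z.1 * Complex.exp (-(Complex.I * (k * z.2)))

theorem modeFun_mem {T : ℝ} {ψ : ℝ → ℂ} (hψ : IsTest ψ) (hs : tsupport ψ ⊆ Ioo 0 T) (k : ℤ) :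
    modeFun k ψ ∈ testSpace T := by
  refine ⟨?_, fun t x => ?_, ?_⟩
  · have h2 : ContDiff ℝ (⊤ : ℕ∞) fun z : ℝ × ℝ => -(Complex.I * ((k : ℂ) * (z.2 : ℂ))) :=
      (contDiff_const.mul (contDiff_const.mul
        (Complex.ofRealCLM.contDiff.comp contDiff_snd))).neg
    exact (hψ.1.comp contDiff_fst).mul h2.cexp
  · simp only [modeFun]
    congr 1
    rw [Complex.exp_eq_exp_iff_exists_int]
    exact ⟨-k, by push_cast; ring⟩
  · rcases (tsupport ψ).eq_empty_or_nonempty with h | h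
    · rw [tsupport_eq_empty_iff] at h
      -- For ψ = 0 any admissible pair of bounds will do.
      exact ⟨1, T - 1, one_pos, sub_one_lt T, fun t x _ => by simp [modeFun, h]⟩
    · have hc : IsCompact (tsupport ψ) := hψ.2
      refine ⟨sInf (tsupport ψ), sSup (tsupport ψ), (hs (hc.sInf_mem h)).1, (hs (hc.sSup_mem h)).2,
        fun t x ht => ?_⟩
      have : ψ t = 0 := image_eq_zero_of_notMem_tsupport fun h' =>
        ht ⟨csInf_le hc.bddBelow h', le_csSup hc.bddAbove h'⟩
      simp [modeFun, this]

/-- The test function `ψ(t) exp(-ikx)`. -/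
def modeTest {T : ℝ} {ψ : ℝ → ℂ} (hψ : IsTest ψ) (hs : tsupport ψ ⊆ Ioo 0 T) (k : ℤ) :
    testSpace T := ⟨modeFun k ψ, modeFun_mem hψ hs k⟩

theorem hasFDerivAt_modeFun {ψ : ℝ → ℂ} (hψ : IsTest ψ) (k : ℤ) (z : ℝ × ℝ) :
    HasFDerivAt (modeFun k ψ) (ψ z.1 • (Complex.exp (-(Complex.I * (k * z.2))) •
      (-(Complex.I * k)) • (Complex.ofRealCLM.comp (ContinuousLinearMap.snd ℝ ℝ ℝ))) +
      Complex.exp (-(Complex.I * (k * z.2))) •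
        ((ContinuousLinearMap.toSpanSingleton ℝ (deriv ψ z.1)).comp
          (ContinuousLinearMap.fst ℝ ℝ ℝ))) z := by
  have h1 : HasFDerivAt (fun z : ℝ × ℝ => ψ z.1)
      ((ContinuousLinearMap.toSpanSingleton ℝ (deriv ψ z.1)).comp
        (ContinuousLinearMap.fst ℝ ℝ ℝ)) z :=
    HasFDerivAt.comp z (hψ.hasDerivAt z.1).hasFDerivAt hasFDerivAt_fst
  have h2 : HasFDerivAt (fun z : ℝ × ℝ => -(Complex.I * ((k : ℂ) * (z.2 : ℂ))))
      ((-(Complex.I * k)) • (Complex.ofRealCLM.comp (ContinuousLinearMap.snd ℝ ℝ ℝ))) z := by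
    have h := (HasFDerivAt.comp z (Complex.ofRealCLM.hasFDerivAt (x := z.2))
      (hasFDerivAt_snd (𝕜 := ℝ) (p := z))).const_mul (-(Complex.I * k))
    refine h.congr_of_eventuallyEq (Eventually.of_forall fun w => ?_)
    simp only [Function.comp_apply, Complex.ofRealCLM_apply]
    ring
  exact h1.mul h2.cexp

theorem tsupport_deriv_subset_of {T : ℝ} {ψ : ℝ → ℂ} (hs : tsupport ψ ⊆ Ioo 0 T) :
    tsupport (deriv ψ) ⊆ Ioo 0 T :=
  (closure_minimal (support_deriv_subset (f := ψ)) isClosed_closure).trans hs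

theorem testDeriv_time_modeTest {T : ℝ} {ψ : ℝ → ℂ} (hψ : IsTest ψ) (hs : tsupport ψ ⊆ Ioo 0 T)
    (k : ℤ) : testDeriv T (1, 0) (modeTest hψ hs k) =
      modeTest hψ.deriv (tsupport_deriv_subset_of hs) k := by
  ext z
  change fderiv ℝ (modeFun k ψ) z (1, 0) = modeFun k (deriv ψ) z
  rw [(hasFDerivAt_modeFun hψ k z).fderiv]
  simp [modeFun, mul_comm]

theorem testDeriv_space_modeTest {T : ℝ} {ψ : ℝ → ℂ} (hψ : IsTest ψ) (hs : tsupport ψ ⊆ Ioo 0 T)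
    (k : ℤ) : testDeriv T (0, 1) (modeTest hψ hs k) = (-(Complex.I * k)) • modeTest hψ hs k := by
  ext z
  change fderiv ℝ (modeFun k ψ) z (0, 1) = (-(Complex.I * k)) * modeFun k ψ z
  rw [(hasFDerivAt_modeFun hψ k z).fderiv]
  simp [modeFun]
  ring

/-- Mode test functions are eigenfunctions of ∂ₓ, so the operator acts on frequency k as i d/dt +
l_k with l_k = -(k⁴+k²). -/
theorem schrodinger4_modeTest {T : ℝ} (u : GenFun T) {ψ : ℝ → ℂ} (hψ : IsTest ψ)
    (hs : tsupport ψ ⊆ Ioo 0 T) (k : ℤ) : schrodinger4 u (modeTest hψ hs k) =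
      -(Complex.I * u (modeTest hψ.deriv (tsupport_deriv_subset_of hs) k)) +
        symbolPhase k * u (modeTest hψ hs k) := by
  simp only [schrodinger4, GenFun.dt, GenFun.dx, LinearMap.sub_apply, LinearMap.add_apply,
    LinearMap.smul_apply, LinearMap.neg_apply, LinearMap.comp_apply, testDeriv_time_modeTest,
    testDeriv_space_modeTest, map_smul, smul_eq_mul, symbolPhase]
  push_cast
  linear_combination ((k : ℂ) ^ 2 * u (modeTest hψ hs k) -
    (k : ℂ) ^ 4 * (Complex.I ^ 2 - 1) * u (modeTest hψ hs k)) * Complex.I_sq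

theorem integral_exp_int (n : ℤ) : ∫ x in Ioc 0 (2 * Real.pi), Complex.exp (-(Complex.I * (n * x))) =
    if n = 0 then (2 * Real.pi : ℂ) else 0 := by
  split_ifs with h
  · have hpi : (0 : ℝ) ≤ 2 * Real.pi := by positivity
    simp [h, hpi]
  · have hc : -(Complex.I * n) ≠ 0 := by simp [h]
    have := integral_exp_mul_complex (a := 0) (b := 2 * Real.pi) hc
    rw [intervalIntegral.integral_of_le (by positivity)] at this
    have e : ∀ x : ℝ, -(Complex.I * n) * (x : ℂ) = -(Complex.I * (n * x)) := fun x => by ring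
    simp only [e] at this
    rw [this]
    have e2 : -(Complex.I * (n * ((2 * Real.pi : ℝ) : ℂ))) = ((-n : ℤ) : ℂ) *
        (2 * Real.pi * Complex.I) := by push_cast; ring
    rw [e2, Complex.exp_int_mul_two_pi_mul_I]
    simp

section TestFunctions

variable {T : ℝ} (φ : testSpace T)

theorem testSpace_continuous : Continuous (φ : ℝ × ℝ → ℂ) := φ.2.1.continuous

theorem testSpace_eq_zero {t : ℝ} (ht : t ∉ Ioo 0 T) (x : ℝ) : (φ : ℝ × ℝ → ℂ) (t, x) = 0 := by
  obtain ⟨-, -, a, c, ha, hc, h⟩ := φ.2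
  exact h t x fun h' => ht ⟨ha.trans_le h'.1, h'.2.trans_lt hc⟩

theorem integrableOn_testSpace :
    IntegrableOn (φ : ℝ × ℝ → ℂ) ((univ : Set ℝ) ×ˢ Ioc 0 (2 * Real.pi)) := by
  have h : IntegrableOn (φ : ℝ × ℝ → ℂ) (Icc 0 T ×ˢ Icc 0 (2 * Real.pi)) :=
    (testSpace_continuous φ).continuousOn.integrableOn_compact (isCompact_Icc.prod isCompact_Icc)
  refine h.of_forall_sdiff_eq_zero (MeasurableSet.univ.prod measurableSet_Ioc) ?_
  rintro ⟨t, x⟩ ⟨⟨-, hx⟩, hn⟩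
  refine testSpace_eq_zero φ (fun ht => hn ⟨Ioo_subset_Icc_self ht, Ioc_subset_Icc_self hx⟩) x

theorem memLp_testSpace : MemLp (φ : ℝ × ℝ → ℂ) 2 (cylinderMeasure T univ) := by
  obtain ⟨M, hM⟩ := ((isCompact_Icc (a := (0 : ℝ)) (b := T)).prod
    (isCompact_Icc (a := (0 : ℝ)) (b := 2 * Real.pi))).exists_bound_of_continuousOn
    (testSpace_continuous φ).continuousOn
  refine MemLp.of_bound (testSpace_continuous φ).aestronglyMeasurable M ?_
  have : MeasurableSet (Ioo 0 T ×ˢ {x : ℝ | x ∈ Ioc 0 (2 * Real.pi) ∧ (x : Torus) ∈ univ}) := by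
    refine measurableSet_Ioo.prod ?_
    simp only [mem_univ, and_true]
    exact measurableSet_Ioc
  filter_upwards [ae_restrict_mem this] with z hz
  exact hM z ⟨Ioo_subset_Icc_self hz.1, Ioc_subset_Icc_self hz.2.1⟩

theorem coeff_testSpace_indicator (k : ℤ) :
    (Ioo 0 T).indicator (fun t => coeff (fun x => (φ : ℝ × ℝ → ℂ) (t, x)) k) =
      fun t => coeff (fun x => (φ : ℝ × ℝ → ℂ) (t, x)) k := by
  ext t
  by_cases ht : t ∈ Ioo 0 T
  · rw [indicator_of_mem ht]
  · rw [indicator_of_notMem ht]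
    simp [coeff, testSpace_eq_zero φ ht]

theorem memLp_coeff_testSpace (k : ℤ) :
    MemLp (fun t => coeff (fun x => (φ : ℝ × ℝ → ℂ) (t, x)) k) 2 volume := by
  rw [← coeff_testSpace_indicator, memLp_indicator_iff_restrict measurableSet_Ioo]
  exact memLp_coeff (memLp_testSpace φ) k

theorem integrable_coeff_testSpace (k : ℤ) :
    Integrable (fun t => coeff (fun x => (φ : ℝ × ℝ → ℂ) (t, x)) k) volume := by
  rw [← coeff_testSpace_indicator, integrable_indicator_iff measurableSet_Ioo]
  exact (memLp_coeff (memLp_testSpace φ) k).integrable (by norm_num)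

theorem fourier_testSpace (k : ℤ) (τ : ℝ) : fourier (φ : ℝ × ℝ → ℂ) (-k) (-τ) =
    (2 * Real.pi : ℂ)⁻¹ * ft (fun t => coeff (fun x => (φ : ℝ × ℝ → ℂ) (t, x)) (-k)) τ := by
  have hφ := integrableOn_testSpace φ
  rw [IntegrableOn, Measure.volume_eq_prod, ← Measure.prod_restrict, Measure.restrict_univ] at hφ
  rw [fourier, Measure.volume_eq_prod, ← Measure.prod_restrict, Measure.restrict_univ,
    integral_prod]
  · congr 1
    refine integral_congr_ae (ae_of_all _ fun t => ?_)
    simp only [coeff]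
    rw [← integral_mul_const]
    refine integral_congr_ae (ae_of_all _ fun x => ?_)
    simp only
    rw [mul_assoc, ← Complex.exp_add]
    congr 2
    push_cast
    ring
  · refine hφ.mul_bdd (c := 1) (by fun_prop : Continuous fun z : ℝ × ℝ => Complex.exp (-Complex.I *
      (((-k : ℤ) : ℂ) * (z.2 : ℂ) + (z.1 : ℂ) * ((-τ : ℝ) : ℂ)))).aestronglyMeasurable
      (ae_of_all _ fun z => ?_)
    have : -Complex.I * (((-k : ℤ) : ℂ) * (z.2 : ℂ) + (z.1 : ℂ) * ((-τ : ℝ) : ℂ)) =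
        Complex.I * ((k * z.2 + z.1 * τ : ℝ) : ℂ) := by push_cast; ring
    rw [this, Complex.norm_exp_I_mul_ofReal]

/-- Plancherel in time combined with Parseval in space; the unitary normalisation makes all factors
2π cancel. -/
theorem tsum_eLpNorm_fourier_sq :
    ∑' k : ℤ, eLpNorm (fun τ => fourier (φ : ℝ × ℝ → ℂ) (-k) (-τ)) 2 volume ^ 2 =
      eLpNorm (φ : ℝ × ℝ → ℂ) 2 (cylinderMeasure T univ) ^ 2 := by
  have h1 : ∀ k : ℤ, eLpNorm (fun τ => fourier (φ : ℝ × ℝ → ℂ) (-k) (-τ)) 2 volume ^ 2 =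
      ENNReal.ofReal (2 * Real.pi)⁻¹ *
        ∫⁻ t in Ioo 0 T, ‖coeff (fun x => (φ : ℝ × ℝ → ℂ) (t, x)) (-k)‖ₑ ^ 2 := fun k => by
    have hpi : (0 : ℝ) < 2 * Real.pi := by positivity
    have e1 : (fun τ => fourier (φ : ℝ × ℝ → ℂ) (-k) (-τ)) = (2 * Real.pi : ℂ)⁻¹ •
        ft (fun t => coeff (fun x => (φ : ℝ × ℝ → ℂ) (t, x)) (-k)) := by
      ext τ; exact fourier_testSpace φ k τ
    have e2 : ‖(2 * Real.pi : ℂ)⁻¹‖ₑ = ENNReal.ofReal (2 * Real.pi)⁻¹ := by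
      rw [← ofReal_norm, norm_inv, norm_mul, Complex.norm_real, Real.norm_of_nonneg Real.pi_pos.le]
      simp
    rw [e1, eLpNorm_const_smul, (isL2Transform_ft (integrable_coeff_testSpace φ (-k))
      (memLp_coeff_testSpace φ (-k))).norm_eq, e2, ← coeff_testSpace_indicator,
      eLpNorm_indicator_eq_eLpNorm_restrict measurableSet_Ioo, mul_pow, mul_pow, eLpNorm_two_sq,
      ← mul_assoc, ← ENNReal.ofReal_pow (by positivity), ← ENNReal.ofReal_pow (by positivity),
      ← ENNReal.ofReal_mul (by positivity), Real.sq_sqrt hpi.le]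
    congr 2
    field_simp
  simp only [h1]
  have h2 := (Equiv.neg ℤ).tsum_eq fun k => ∫⁻ t in Ioo 0 T,
    ‖coeff (fun x => (φ : ℝ × ℝ → ℂ) (t, x)) k‖ₑ ^ 2
  simp only [Equiv.neg_apply] at h2
  rw [ENNReal.tsum_mul_left, h2, tsum_lintegral_coeff_sq (memLp_testSpace φ),
    ← mul_assoc, ← ENNReal.ofReal_mul (by positivity), inv_mul_cancel₀ (by positivity)]
  simp

end TestFunctions

theorem fourier_modeTest {T : ℝ} {ψ : ℝ → ℂ} (hψ : IsTest ψ) (hs : tsupport ψ ⊆ Ioo 0 T) (k j : ℤ)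
    (τ : ℝ) : fourier (modeTest hψ hs k : ℝ × ℝ → ℂ) (-j) (-τ) = if j = k then ft ψ τ else 0 := by
  have hpi : (Real.pi : ℂ) ≠ 0 := by exact_mod_cast Real.pi_ne_zero
  rw [fourier_testSpace]
  have h : (fun t => coeff (fun x => (modeTest hψ hs k : ℝ × ℝ → ℂ) (t, x)) (-j)) =
      fun t => ψ t * if k - j = 0 then (2 * Real.pi : ℂ) else 0 := by
    ext t
    rw [← integral_exp_int, ← integral_const_mul]
    refine integral_congr_ae (ae_of_all _ fun x => ?_)
    simp only [modeTest, modeFun]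
    rw [mul_assoc, ← Complex.exp_add]
    congr 2
    push_cast
    ring
  rw [h]
  rcases eq_or_ne j k with rfl | hjk
  · simp only [sub_self, if_true, ft]
    rw [← integral_const_mul]
    refine integral_congr_ae (ae_of_all _ fun t => ?_)
    field_simp
  · rw [if_neg hjk, if_neg (sub_ne_zero.2 hjk.symm)]
    simp [ft]

theorem Extends.apply_modeTest {T : ℝ} {F : ℤ → ℝ → ℂ} {u : GenFun T} (h : Extends F u)
    {ψ : ℝ → ℂ} (hψ : IsTest ψ) (hs : tsupport ψ ⊆ Ioo 0 T) (k : ℤ) :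
    u (modeTest hψ hs k) = ∫ τ, F k τ * ft ψ τ := by
  rw [h, tsum_eq_single k]
  · simp [fourier_modeTest]
  · intro j hj
    simp [fourier_modeTest, hj]

/-- Testing against ψ(t) exp(-ikx) selects one frequency from each extension. Agreement of F with F₁
and the equation thus become statements about single modes on (0,T); the time derivative appears as
the factor τ. -/
theorem isModeSolution_of_extends {p : ℤ → ℝ} {T b : ℝ} (hb0 : 0 ≤ b) (hb1 : b ≤ 1)
    {F F₁ G : ℤ → ℝ → ℂ} {u f : GenFun T} (hL : schrodinger4 u = f) (hF : Extends F u)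
    (hF₁ : Extends F₁ u) (hG : Extends G f) (mF : ∀ k, AEStronglyMeasurable (F k) volume)
    (mF₁ : ∀ k, AEStronglyMeasurable (F₁ k) volume) (mG : ∀ k, AEStronglyMeasurable (G k) volume)
    {s s' : ℝ} (nF : bourgainNorm p b 0 F < ∞) (nF₁ : bourgainNorm p (-b) s F₁ < ∞)
    (nG : bourgainNorm p (-b) s' G < ∞) (k : ℤ) :
    IsModeSolution T (symbolPhase k) b (p k) (F k) (F₁ k) (G k) := by
  have lF := modeNorm_lt_top_of_bourgainNorm nF k
  have lF₁ := modeNorm_lt_top_of_bourgainNorm nF₁ k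
  have lG := modeNorm_lt_top_of_bourgainNorm nG k
  have tF : Tempered (F k) := .of_modeNorm (mF k) (by linarith) lF
  have tF₁ : Tempered (F₁ k) := .of_modeNorm (mF₁ k) (by linarith) lF₁
  have tG : Tempered (G k) := .of_modeNorm (mG k) (by linarith) lG
  refine ⟨mF k, mF₁ k, mG k, lF, lF₁, lG, fun ψ hψ hs => ?_, fun ψ hψ hs => ?_⟩
  · simp only [sub_mul]
    rw [integral_sub (tF.integrable_mul_ft hψ) (tF₁.integrable_mul_ft hψ),
      ← hF.apply_modeTest hψ hs, ← hF₁.apply_modeTest hψ hs, sub_self]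
  · have h := schrodinger4_modeTest u hψ hs k
    rw [hL, hG.apply_modeTest, hF.apply_modeTest, hF.apply_modeTest] at h
    have e : ∀ τ : ℝ, F k τ * ft (deriv ψ) τ = -Complex.I * (τ * (F k τ * ft ψ τ)) := fun τ => by
      rw [ft_deriv hψ]; ring
    simp only [e] at h
    rw [integral_const_mul] at h
    have e' : ∀ τ : ℝ, (G k τ - ((symbolPhase k : ℂ) - τ) * F k τ) * ft ψ τ =
        G k τ * ft ψ τ - (symbolPhase k * (F k τ * ft ψ τ) - τ * (F k τ * ft ψ τ)) := fun τ => by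
      ring
    have i2 : Integrable fun τ : ℝ => (symbolPhase k : ℂ) * (F k τ * ft ψ τ) :=
      (tF.integrable_mul_ft hψ).const_mul _
    have i3 : Integrable fun τ : ℝ => (symbolPhase k : ℂ) * (F k τ * ft ψ τ) -
        τ * (F k τ * ft ψ τ) := i2.sub (tF.integrable_mul_mul_ft hψ)
    simp only [e']
    rw [integral_sub (tG.integrable_mul_ft hψ) i3, integral_sub i2 (tF.integrable_mul_mul_ft hψ), h,
      integral_const_mul]
    linear_combination (∫ τ : ℝ, (τ : ℂ) * (F k τ * ft ψ τ)) * Complex.I_sq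

/-! ### The L² density of a generalized function. -/

/-- The representing functional is bounded in the `L²` norm on the cylinder. -/
theorem Extends.enorm_apply_le {T : ℝ} {F : ℤ → ℝ → ℂ} {u : GenFun T} (h : Extends F u)
    (mF : ∀ k, AEStronglyMeasurable (F k) volume) {p : ℤ → ℝ} {b : ℝ} (hb : 0 ≤ b)
    (φ : testSpace T) :
    ‖u φ‖ₑ ≤ bourgainNorm p b 0 F * eLpNorm (φ : ℝ × ℝ → ℂ) 2 (cylinderMeasure T univ) := by
  have hm : ∀ k : ℤ, AEStronglyMeasurable (fun τ => fourier (φ : ℝ × ℝ → ℂ) (-k) (-τ)) volume :=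
    fun k => by
      simp only [fourier_testSpace]
      exact ((continuous_ft (integrable_coeff_testSpace φ (-k))).const_mul _).aestronglyMeasurable
  rw [h φ]
  calc _ ≤ ∑' k : ℤ, ‖∫ τ : ℝ, F k τ * fourier (φ : ℝ × ℝ → ℂ) (-k) (-τ)‖ₑ :=
        enorm_tsum_le_tsum_enorm
    _ ≤ ∑' k : ℤ, modeNorm b (p k) (F k) *
          eLpNorm (fun τ => fourier (φ : ℝ × ℝ → ℂ) (-k) (-τ)) 2 volume := by
        refine ENNReal.tsum_le_tsum fun k => (enorm_integral_le_lintegral_enorm _).trans ?_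
        simp only [enorm_mul]
        exact (lintegral_enorm_mul_le (mF k) (hm k)).trans
          (mul_le_mul_left (eLpNorm_le_modeNorm hb _ _) _)
    _ ≤ _ := by
        refine (tsum_mul_le _ _).trans_eq ?_
        rw [bourgainNorm_zero_eq, tsum_eLpNorm_fourier_sq, ← ENNReal.rpow_natCast,
          ← ENNReal.rpow_mul]
        norm_num

/-- Riesz representation of a functional that is bounded through a linear map. -/
theorem exists_inner_eq_of_norm_le {V H : Type*} [AddCommGroup V] [Module ℂ V]
    [NormedAddCommGroup H] [InnerProductSpace ℂ H] [CompleteSpace H] (j : V →ₗ[ℂ] H)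
    (u : V →ₗ[ℂ] ℂ) {C : ℝ} (hC : 0 ≤ C) (h : ∀ v, ‖u v‖ ≤ C * ‖j v‖) :
    ∃ w : H, ‖w‖ ≤ C ∧ ∀ v, u v = inner ℂ w (j v) := by
  -- The bound makes u factor through the range of j. A linear section r of j defines the factored
  -- functional, which Hahn–Banach extends to all of H.
  obtain ⟨r, hr⟩ := j.rangeRestrict.exists_rightInverse_of_surjective j.range_rangeRestrict
  have hr' : ∀ y, j (r y) = y := fun y => congrArg Subtype.val (LinearMap.congr_fun hr y)
  set f : LinearMap.range j →L[ℂ] ℂ := (u ∘ₗ r).mkContinuous C fun y => by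
    refine (h (r y)).trans_eq ?_
    rw [hr']; rfl
  have hf : ‖f‖ ≤ C := LinearMap.mkContinuous_norm_le _ hC _
  obtain ⟨g, hg, hgn⟩ := exists_extension_norm_eq _ f
  refine ⟨(InnerProductSpace.toDual ℂ H).symm g, ?_, fun v => ?_⟩
  · rw [LinearIsometryEquiv.norm_map, hgn]; exact hf
  · rw [InnerProductSpace.toDual_symm_apply]
    have h1 : g (j v) = u (r (j.rangeRestrict v)) := hg (j.rangeRestrict v)
    -- The difference lies in the kernel of j, so the bound forces u to vanish on it; hence the
    -- choice of section does not matter.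
    have h2 := h (v - r (j.rangeRestrict v))
    rw [map_sub, map_sub, hr'] at h2
    have h3 : ((j.rangeRestrict v : LinearMap.range j) : H) = j v := rfl
    rw [h3, sub_self, norm_zero, mul_zero] at h2
    rw [h1]
    exact sub_eq_zero.1 (norm_le_zero_iff.1 h2)

/-- The density of a functional of finite Bourgain norm. -/
theorem Extends.exists_density {T : ℝ} {F : ℤ → ℝ → ℂ} {u : GenFun T} (h : Extends F u)
    (mF : ∀ k, AEStronglyMeasurable (F k) volume) {p : ℤ → ℝ} {b : ℝ} (hb : 0 ≤ b)
    (hF : bourgainNorm p b 0 F < ∞) :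
    ∃ g : ℝ × ℝ → ℂ, MemLp g 2 (cylinderMeasure T univ) ∧
      eLpNorm g 2 (cylinderMeasure T univ) ≤ bourgainNorm p b 0 F ∧
      ∀ φ : testSpace T, u φ = ∫ z, g z * (φ : ℝ × ℝ → ℂ) z ∂(cylinderMeasure T univ) := by
  set μ := cylinderMeasure T univ
  let j : testSpace T →ₗ[ℂ] Lp ℂ 2 μ :=
    { toFun := fun φ => (memLp_testSpace φ).toLp _
      map_add' := fun φ ψ => MemLp.toLp_add (memLp_testSpace φ) (memLp_testSpace ψ)
      map_smul' := fun c φ => MemLp.toLp_const_smul c (memLp_testSpace φ) }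
  obtain ⟨w, hw, hu⟩ := exists_inner_eq_of_norm_le j u (C := (bourgainNorm p b 0 F).toReal)
    ENNReal.toReal_nonneg fun φ => by
      have h1 := h.enorm_apply_le mF hb φ (p := p)
      change _ ≤ _ * ‖(memLp_testSpace φ).toLp _‖
      rw [Lp.norm_toLp, ← ENNReal.toReal_mul, ← toReal_enorm]
      exact ENNReal.toReal_mono (ENNReal.mul_lt_top hF (memLp_testSpace φ).2).ne h1
  -- The inner product is conjugate-linear in its first argument, while the pairing with test
  -- functions is bilinear.
  refine ⟨fun z => conj (w z), (Lp.memLp w).star, ?_, fun φ => ?_⟩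
  · have : eLpNorm (fun z => conj (w z)) 2 μ = eLpNorm w 2 μ :=
      eLpNorm_congr_norm_ae (ae_of_all _ fun z => by simp)
    rw [this, ← ENNReal.ofReal_toReal (Lp.memLp w).2.ne, ← Lp.norm_def,
      ← ENNReal.ofReal_toReal hF.ne]
    exact ENNReal.ofReal_le_ofReal hw
  · rw [hu, L2.inner_def]
    refine integral_congr_ae ?_
    filter_upwards [(memLp_testSpace φ).coeFn_toLp] with z hz
    change inner ℂ (w z) ((memLp_testSpace φ).toLp _ z) = _
    rw [hz, RCLike.inner_apply, mul_comm]

/-- Both sides have the same pairing with every ψ supported in (0,T): by Fubini on the left and by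
`Extends.apply_modeTest` on the right. The transform a depends on the extension outside (0,T), so
equality is claimed only inside. -/
theorem coeff_density_ae_eq {T : ℝ} {F : ℤ → ℝ → ℂ} {u : GenFun T} (h : Extends F u)
    {g : ℝ × ℝ → ℂ} (hg : MemLp g 2 (cylinderMeasure T univ))
    (hu : ∀ φ : testSpace T, u φ = ∫ z, g z * (φ : ℝ × ℝ → ℂ) z ∂(cylinderMeasure T univ))
    {k : ℤ} {a : ℝ → ℂ} (ha : IsL2Transform (F k) a) :
    ∀ᵐ t ∂(volume.restrict (Ioo 0 T)), coeff (fun x => g (t, x)) k = a t := by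
  have hc := memLp_coeff hg k
  rw [← memLp_indicator_iff_restrict measurableSet_Ioo] at hc
  have := IsL2Transform.ae_eq_on hc ha.memLp isOpen_Ioo fun ψ hψ hs => by
    rw [ha.pairing ψ hψ, ← h.apply_modeTest hψ hs, hu]
    have e1 : ∀ t, (Ioo 0 T).indicator (fun t => coeff (fun x => g (t, x)) k) t * ψ t =
        (Ioo 0 T).indicator (fun t => coeff (fun x => g (t, x)) k * ψ t) t := fun t => by
      by_cases ht : t ∈ Ioo 0 T <;> simp [ht]
    simp only [e1]
    rw [integral_indicator measurableSet_Ioo]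
    have hi : Integrable (fun z => g z * (modeTest hψ hs k : ℝ × ℝ → ℂ) z)
        (cylinderMeasure T univ) := hg.integrable_mul (memLp_testSpace _)
    rw [cylinderMeasure_univ] at hi ⊢
    rw [integral_prod _ hi]
    refine integral_congr_ae (ae_of_all _ fun t => ?_)
    simp only [coeff]
    rw [← integral_mul_const]
    refine integral_congr_ae (ae_of_all _ fun x => ?_)
    simp only [modeTest, modeFun]
    ring
  filter_upwards [ae_restrict_of_ae this, ae_restrict_mem measurableSet_Ioo] with t ht hT
  rw [← ht hT, indicator_of_mem hT]

theorem IsSolutionFamily.enorm_integral_density_le {p : ℤ → ℝ} {T b : ℝ}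
    {F F₁ G a : ℤ → ℝ → ℂ} (hS : IsSolutionFamily p T b F F₁ G a) {u : GenFun T}
    (h : Extends F u) {g : ℝ × ℝ → ℂ} (hg : MemLp g 2 (cylinderMeasure T univ))
    (hu : ∀ φ : testSpace T, u φ = ∫ z, g z * (φ : ℝ × ℝ → ℂ) z ∂(cylinderMeasure T univ)) (m : ℤ) :
    ‖∫ z, g z * conj (g z) * Complex.exp (Complex.I * (m * z.2)) ∂(cylinderMeasure T univ)‖ₑ ≤
      ∑' k, ‖∫ t in Ioo 0 T, a k t * conj (a (k + m) t)‖ₑ := by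
  refine (enorm_integral_density_mul_exp_le hg m).trans_eq (tsum_congr fun k => ?_)
  congr 1
  refine integral_congr_ae ?_
  filter_upwards [coeff_density_ae_eq h hg hu (hS.transform k),
    coeff_density_ae_eq h hg hu (hS.transform (k + m))] with t h1 h2
  rw [h1, h2]

/-! ### Localisation to ω. -/

instance fact_two_pi_pos : Fact (0 < 2 * Real.pi) := ⟨by positivity⟩

theorem continuous_periodic_lift {β : Type*} [TopologicalSpace β] {f : ℝ → β}
    (h : Function.Periodic f (2 * Real.pi)) (hf : Continuous f) :
    Continuous (h.lift : Torus → β) := hf.quotient_liftOn' _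

/-- The superlevel sets of `cos (x - x₀)` shrink to `x₀`. -/
theorem exists_cos_level_subset {ω : Set Torus} (hω : IsOpen ω) {x₀ : ℝ} (hx : (x₀ : Torus) ∈ ω) :
    ∃ c < 1, ∃ K : Set Torus, IsCompact K ∧ K ⊆ ω ∧
      ∀ x : ℝ, c ≤ Real.cos (x - x₀) → (x : Torus) ∈ K := by
  have hper : Function.Periodic (fun x => Real.cos (x - x₀)) (2 * Real.pi) := fun x => by
    simp only [show x + 2 * Real.pi - x₀ = x - x₀ + 2 * Real.pi by ring, Real.cos_add_two_pi]
  set D : Torus → ℝ := hper.lift with hD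
  have hDc : Continuous D := continuous_periodic_lift hper (by fun_prop)
  have hD1 : ∀ y, y ∉ ω → D y < 1 := fun y hy => by
    obtain ⟨x, rfl⟩ := QuotientAddGroup.mk_surjective y
    change Real.cos (x - x₀) < 1
    refine lt_of_le_of_ne (Real.cos_le_one _) fun h => hy ?_
    obtain ⟨n, hn⟩ := (Real.cos_eq_one_iff _).1 h
    have : ((x : ℝ) : Torus) = (x₀ : Torus) := by
      rw [← sub_eq_zero, ← AddCircle.coe_sub, AddCircle.coe_eq_zero_iff]
      exact ⟨n, by rw [← hn, zsmul_eq_mul]⟩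
    rwa [this]
  have hcomp : IsCompact ωᶜ := hω.isClosed_compl.isCompact
  -- Compactness of the complement of ω upgrades the pointwise bound D < 1 to a uniform gap; if the
  -- complement is empty any c < 1 works.
  obtain ⟨c, hc1, hc⟩ : ∃ c < 1, ∀ y, y ∉ ω → D y < c := by
    rcases (ωᶜ).eq_empty_or_nonempty with h | h
    · refine ⟨0, one_pos, fun y hy => ?_⟩
      have : y ∈ ωᶜ := hy
      rw [h] at this
      exact this.elim
    · obtain ⟨y, hy, hmax⟩ := hcomp.exists_isMaxOn h hDc.continuousOn
      have h1 := hD1 y hy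
      refine ⟨(1 + D y) / 2, by linarith, fun z hz => ?_⟩
      have : D z ≤ D y := hmax hz
      linarith
  refine ⟨c, hc1, {y | c ≤ D y}, (isClosed_le continuous_const hDc).isCompact, fun y hy => ?_,
    fun x hx => hx⟩
  by_contra h
  exact (hc y h).not_ge hy

/-- Composing a smooth step with cos(x - x₀) - c gives periodicity for free, with support controlled
by the superlevel set of the cosine. -/
theorem exists_periodic_cutoff {ω : Set Torus} (hω : IsOpen ω) (hne : ω.Nonempty) :
    ∃ θ : ℝ → ℝ, ContDiff ℝ (⊤ : ℕ∞) θ ∧ Function.Periodic θ (2 * Real.pi) ∧ (∀ x, |θ x| ≤ 1) ∧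
      0 < ∫ x in Ioc 0 (2 * Real.pi), θ x ^ 2 ∧
      ∃ K : Set Torus, IsCompact K ∧ K ⊆ ω ∧ ∀ x : ℝ, θ x ≠ 0 → (x : Torus) ∈ K := by
  obtain ⟨y, hy⟩ := hne
  obtain ⟨x₀, hx₀, rfl⟩ : y ∈ QuotientAddGroup.mk '' Ico (0 : ℝ) (0 + 2 * Real.pi) := by
    rw [AddCircle.coe_image_Ico_eq]; trivial
  obtain ⟨c, hc, K, hK, hKω, hcK⟩ := exists_cos_level_subset hω hy
  have hs : ContDiff ℝ (⊤ : ℕ∞) fun x => Real.smoothTransition (Real.cos (x - x₀) - c) :=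
    Real.smoothTransition.contDiff.comp
      ((Real.contDiff_cos.comp (contDiff_id.sub contDiff_const)).sub contDiff_const)
  refine ⟨fun x => Real.smoothTransition (Real.cos (x - x₀) - c), hs, fun x => ?_, fun x => ?_, ?_,
    K, hK, hKω, fun x hx => hcK x ?_⟩
  · simp only [show x + 2 * Real.pi - x₀ = x - x₀ + 2 * Real.pi by ring, Real.cos_add_two_pi]
  · rw [abs_of_nonneg (Real.smoothTransition.nonneg _)]
    exact Real.smoothTransition.le_one _
  · rw [← intervalIntegral.integral_of_le Real.two_pi_pos.le]
    refine intervalIntegral.integral_pos Real.two_pi_pos (hs.continuous.pow 2).continuousOn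
      (fun x _ => sq_nonneg _) ⟨x₀, ⟨hx₀.1, by simpa using hx₀.2.le⟩, ?_⟩
    simp only [sub_self, Real.cos_zero]
    exact pow_pos (Real.smoothTransition.pos_of_pos (sub_pos.2 hc)) 2
  · by_contra h
    exact hx (Real.smoothTransition.zero_of_nonpos (by linarith))

theorem cylinderMeasure_eq_restrict (T : ℝ) {ω : Set Torus} (hω : IsOpen ω) :
    cylinderMeasure T ω = (cylinderMeasure T univ).restrict {z : ℝ × ℝ | (z.2 : Torus) ∈ ω} := by
  have hm : MeasurableSet {z : ℝ × ℝ | (z.2 : Torus) ∈ ω} :=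
    (hω.preimage ((AddCircle.continuous_mk' _).comp continuous_snd)).measurableSet
  rw [cylinderMeasure, cylinderMeasure, Measure.restrict_restrict hm]
  congr 1
  ext z
  simp only [mem_prod, mem_ofPred_eq, mem_inter_iff, mem_univ, and_true]
  tauto

/-- The function d is a density of the zero functional, so almost every time slice has vanishing
Fourier coefficients and Parseval finishes. -/
theorem ae_eq_zero_of_forall_integral_eq_zero {T : ℝ} {d : ℝ × ℝ → ℂ}
    (hd : MemLp d 2 (cylinderMeasure T univ))
    (h : ∀ φ : testSpace T, ∫ z, d z * (φ : ℝ × ℝ → ℂ) z ∂(cylinderMeasure T univ) = 0) :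
    d =ᵐ[cylinderMeasure T univ] 0 := by
  have h0 : Extends (T := T) (fun _ _ => 0) (0 : GenFun T) := fun φ => by simp
  have ht : IsL2Transform (fun _ => 0) (fun _ => 0) := ⟨MemLp.zero', by simp, by simp⟩
  have hs := tsum_lintegral_coeff_sq hd
  have hz : ∀ k, ∫⁻ t in Ioo 0 T, ‖coeff (fun x => d (t, x)) k‖ₑ ^ 2 = 0 := fun k => by
    rw [← lintegral_zero (μ := volume.restrict (Ioo 0 T))]
    refine lintegral_congr_ae ?_
    filter_upwards [coeff_density_ae_eq h0 hd (fun φ => (h φ).symm) (k := k) ht] with t h1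
    rw [h1]; simp
  simp only [hz, tsum_zero] at hs
  have h2 := (mul_eq_zero.1 hs.symm).resolve_left (by simp [Real.pi_pos])
  exact (eLpNorm_eq_zero_iff hd.1 (by norm_num)).1 (pow_eq_zero_iff (by norm_num) |>.1 h2)

/-- The global density g and any local representative g' need not be compared on all of ω:
multiplying by θ suffices, as θφ is an admissible local test function for every φ. The bound holds
for each g', hence for the infimum. -/
theorem eLpNorm_cutoff_mul_le {T : ℝ} {ω : Set Torus} (hω : IsOpen ω) {θ : ℝ → ℝ}
    (hθ : ContDiff ℝ (⊤ : ℕ∞) θ) (hper : Function.Periodic θ (2 * Real.pi)) (h1 : ∀ x, |θ x| ≤ 1)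
    {K : Set Torus} (hK : IsCompact K) (hKω : K ⊆ ω) (hθK : ∀ x : ℝ, θ x ≠ 0 → (x : Torus) ∈ K)
    {u : GenFun T} {g : ℝ × ℝ → ℂ} (hg : MemLp g 2 (cylinderMeasure T univ))
    (hu : ∀ φ : testSpace T, u φ = ∫ z, g z * (φ : ℝ × ℝ → ℂ) z ∂(cylinderMeasure T univ)) :
    eLpNorm (fun z => (θ z.2 : ℂ) * g z) 2 (cylinderMeasure T univ) ≤ l2Norm ω u := by
  refine le_iInf fun g' => le_iInf fun hg' => le_iInf fun hrep => ?_
  set μ := cylinderMeasure T univ with hμ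
  set S : Set (ℝ × ℝ) := {z : ℝ × ℝ | (z.2 : Torus) ∈ ω} with hS
  have hm : MeasurableSet S :=
    (hω.preimage ((AddCircle.continuous_mk' _).comp continuous_snd)).measurableSet
  have hμω : cylinderMeasure T ω = μ.restrict S := cylinderMeasure_eq_restrict T hω
  have hG : MemLp (S.indicator g') 2 μ := by
    rw [memLp_indicator_iff_restrict hm, ← hμω]; exact hg'
  have hθc : AEStronglyMeasurable (fun z : ℝ × ℝ => (θ z.2 : ℂ)) μ :=
    (Complex.continuous_ofReal.comp (hθ.continuous.comp continuous_snd)).aestronglyMeasurable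
  have hθn : ∀ x, ‖(θ x : ℂ)‖ ≤ 1 := fun x => by rw [Complex.norm_real]; exact h1 x
  have hcut : ∀ {f : ℝ × ℝ → ℂ}, MemLp f 2 μ → MemLp (fun z => (θ z.2 : ℂ) * f z) 2 μ :=
    fun {f} hf => hf.mono (hθc.mul hf.1) (ae_of_all _ fun z => by
      rw [norm_mul]; exact mul_le_of_le_one_left (norm_nonneg _) (hθn _))
  have hae := ae_eq_zero_of_forall_integral_eq_zero ((hcut hg).sub (hcut hG)) fun φ => by
    have hθφ : (fun z : ℝ × ℝ => (θ z.2 : ℂ) * (φ : ℝ × ℝ → ℂ) z) ∈ testSpace T := by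
      obtain ⟨a1, a2, a, c, ha, hc, a3⟩ := φ.2
      refine ⟨(Complex.ofRealCLM.contDiff.comp (hθ.comp contDiff_snd)).mul a1, fun t x => ?_,
        a, c, ha, hc, fun t x ht => ?_⟩
      · simp only [a2, hper x]
      · simp only [a3 t x ht, mul_zero]
    have e1 := hu ⟨_, hθφ⟩
    have e2 := hrep ⟨_, hθφ⟩ ⟨K, hK, hKω, fun _ x hz => hθK x fun h => hz (by simp [h])⟩
    rw [hμω, ← integral_indicator hm] at e2
    have e3 : ∀ z, S.indicator (fun z => g' z * ((θ z.2 : ℂ) * (φ : ℝ × ℝ → ℂ) z)) z =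
        (θ z.2 : ℂ) * S.indicator g' z * (φ : ℝ × ℝ → ℂ) z := fun z => by
      by_cases hz : z ∈ S
      · simp only [indicator_of_mem hz]; ring
      · simp [hz]
    have e4 : ∀ z, g z * ((θ z.2 : ℂ) * (φ : ℝ × ℝ → ℂ) z) =
        (θ z.2 : ℂ) * g z * (φ : ℝ × ℝ → ℂ) z := fun z => by ring
    simp only [e3] at e2
    simp only [e4] at e1
    have i1 : Integrable (fun z => (θ z.2 : ℂ) * g z * (φ : ℝ × ℝ → ℂ) z) μ :=
      (hcut hg).integrable_mul (memLp_testSpace φ)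
    have i2 : Integrable (fun z => (θ z.2 : ℂ) * S.indicator g' z * (φ : ℝ × ℝ → ℂ) z) μ :=
      (hcut hG).integrable_mul (memLp_testSpace φ)
    simp only [Pi.sub_apply, sub_mul]
    rw [integral_sub i1 i2, ← e1, ← e2, sub_self]
  calc eLpNorm (fun z => (θ z.2 : ℂ) * g z) 2 μ
      = eLpNorm (fun z => (θ z.2 : ℂ) * S.indicator g' z) 2 μ := by
        refine eLpNorm_congr_ae ?_
        filter_upwards [hae] with z hz using sub_eq_zero.1 hz
    _ ≤ eLpNorm (S.indicator g') 2 μ := eLpNorm_mono fun z => by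
        rw [norm_mul]; exact mul_le_of_le_one_left (norm_nonneg _) (hθn _)
    _ = eLpNorm g' 2 (cylinderMeasure T ω) := by
        rw [eLpNorm_indicator_eq_eLpNorm_restrict hm, hμω]

/-! ### Equidistribution in space. -/

/-- The mean value over the torus. -/
def torusMean (f : C(Torus, ℂ)) : ℂ := (2 * Real.pi : ℂ)⁻¹ * ∫ x in Ioc 0 (2 * Real.pi), f (x : ℝ)

/-- The deviation of the density `w` from equidistribution in space, tested against `f`. -/
def deviation (μ : Measure (ℝ × ℝ)) (w : ℝ × ℝ → ℂ) (f : C(Torus, ℂ)) : ℂ :=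
  (∫ z, w z * f (z.2 : ℝ) ∂μ) - (∫ z, w z ∂μ) * torusMean f

theorem continuous_comp_coe (f : C(Torus, ℂ)) : Continuous fun x : ℝ => f (x : Torus) :=
  f.continuous.comp (AddCircle.continuous_mk' _)

theorem integrable_mul_comp_coe {μ : Measure (ℝ × ℝ)} {w : ℝ × ℝ → ℂ} (hw : Integrable w μ)
    (f : C(Torus, ℂ)) : Integrable (fun z : ℝ × ℝ => w z * f (z.2 : ℝ)) μ :=
  hw.mul_bdd (c := ‖f‖) ((continuous_comp_coe f).comp continuous_snd).aestronglyMeasurable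
    (ae_of_all _ fun _ => f.norm_coe_le_norm _)

theorem integrableOn_comp_coe (f : C(Torus, ℂ)) :
    Integrable (fun x : ℝ => f (x : Torus)) (volume.restrict (Ioc 0 (2 * Real.pi))) :=
  ((continuous_comp_coe f).continuousOn.integrableOn_compact isCompact_Icc).mono_set
    Ioc_subset_Icc_self

theorem deviation_add {μ : Measure (ℝ × ℝ)} {w : ℝ × ℝ → ℂ} (hw : Integrable w μ)
    (f f' : C(Torus, ℂ)) : deviation μ w (f + f') = deviation μ w f + deviation μ w f' := by
  simp only [deviation, torusMean, ContinuousMap.add_apply, mul_add]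
  rw [integral_add (integrable_mul_comp_coe hw f) (integrable_mul_comp_coe hw f'),
    integral_add (integrableOn_comp_coe f) (integrableOn_comp_coe f')]
  ring

theorem deviation_smul (μ : Measure (ℝ × ℝ)) (w : ℝ × ℝ → ℂ) (c : ℂ) (f : C(Torus, ℂ)) :
    deviation μ w (c • f) = c * deviation μ w f := by
  simp only [deviation, torusMean, ContinuousMap.smul_apply, smul_eq_mul, mul_left_comm _ c]
  rw [integral_const_mul, integral_const_mul]
  ring

theorem norm_torusMean_le (f : C(Torus, ℂ)) : ‖torusMean f‖ ≤ ‖f‖ := by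
  have h : ‖∫ x in Ioc 0 (2 * Real.pi), f (x : ℝ)‖ ≤ ‖f‖ * (2 * Real.pi) := by
    refine (norm_setIntegral_le_of_norm_le_const (C := ‖f‖) measure_Ioc_lt_top
      fun x _ => f.norm_coe_le_norm _).trans_eq ?_
    simp [measureReal_def, Real.pi_pos.le]
  rw [torusMean, norm_mul, norm_inv, norm_mul, Complex.norm_real, Real.norm_of_nonneg Real.pi_pos.le,
    Complex.norm_ofNat, inv_mul_le_iff₀ (by positivity), mul_comm _ ‖f‖]
  exact h

theorem norm_deviation_le {μ : Measure (ℝ × ℝ)} {w : ℝ × ℝ → ℂ} (hw : Integrable w μ)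
    (f : C(Torus, ℂ)) : ‖deviation μ w f‖ ≤ 2 * (∫ z, ‖w z‖ ∂μ) * ‖f‖ := by
  have h1 : ‖∫ z, w z * f (z.2 : ℝ) ∂μ‖ ≤ (∫ z, ‖w z‖ ∂μ) * ‖f‖ := by
    rw [← integral_mul_const]
    refine norm_integral_le_of_norm_le (hw.norm.mul_const _) (ae_of_all _ fun z => ?_)
    rw [norm_mul]
    exact mul_le_mul_of_nonneg_left (f.norm_coe_le_norm _) (norm_nonneg _)
  have h2 : ‖(∫ z, w z ∂μ) * torusMean f‖ ≤ (∫ z, ‖w z‖ ∂μ) * ‖f‖ := by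
    rw [norm_mul]
    exact mul_le_mul (norm_integral_le_integral_norm _) (norm_torusMean_le f) (norm_nonneg _)
      (integral_nonneg fun _ => norm_nonneg _)
  calc _ ≤ _ := norm_sub_le _ _
    _ ≤ _ := by linarith

theorem fourier_torus_coe (m : ℤ) (x : ℝ) :
    _root_.fourier m (x : Torus) = Complex.exp (Complex.I * (m * x)) := by
  have : (Real.pi : ℂ) ≠ 0 := by exact_mod_cast Real.pi_ne_zero
  rw [fourier_coe_apply]
  congr 1
  push_cast
  field_simp

theorem torusMean_fourier (m : ℤ) : torusMean (_root_.fourier m) = if m = 0 then 1 else 0 := by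
  have hpi : (Real.pi : ℂ) ≠ 0 := by exact_mod_cast Real.pi_ne_zero
  have h := integral_exp_int (-m)
  have e : ∀ x : ℝ, -(Complex.I * (((-m : ℤ) : ℂ) * x)) = Complex.I * (m * x) := fun x => by
    push_cast; ring
  simp only [e, neg_eq_zero] at h
  simp only [torusMean, fourier_torus_coe, h]
  split_ifs
  · field_simp
  · simp

/-- Bounded densities whose nonzero Fourier coefficients in space tend to zero equidistribute. -/
theorem tendsto_deviation {μ : Measure (ℝ × ℝ)} {w : ℕ → ℝ × ℝ → ℂ} (hw : ∀ n, Integrable (w n) μ)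
    {B : ℝ} (hB : ∀ n, ∫ z, ‖w n z‖ ∂μ ≤ B)
    (hm : ∀ m : ℤ, m ≠ 0 → Tendsto (fun n => ∫ z, w n z * Complex.exp (Complex.I * (m * z.2)) ∂μ)
      atTop (𝓝 0)) (f : C(Torus, ℂ)) : Tendsto (fun n => deviation μ (w n) f) atTop (𝓝 0) := by
  -- On trigonometric polynomials the claim is linear: frequency zero has deviation exactly zero,
  -- and the other frequencies are the hypothesis.
  have hspan : ∀ q ∈ Submodule.span ℂ (range (_root_.fourier : ℤ → C(Torus, ℂ))),
      Tendsto (fun n => deviation μ (w n) q) atTop (𝓝 0) := by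
    intro q hq
    induction hq using Submodule.span_induction with
    | mem q hq =>
      obtain ⟨m, rfl⟩ := hq
      rcases eq_or_ne m 0 with rfl | hm0
      · refine tendsto_const_nhds.congr fun n => ?_
        simp [deviation, torusMean_fourier]
      · refine (hm m hm0).congr fun n => ?_
        rw [deviation, torusMean_fourier, if_neg hm0, mul_zero, sub_zero]
        simp only [fourier_torus_coe]
    | zero =>
      refine tendsto_const_nhds.congr fun n => ?_
      simp [deviation, torusMean]
    | add q q' _ _ h h' =>
      simp only [deviation_add (hw _)]
      simpa using h.add h'
    | smul c q _ h =>
      simp only [deviation_smul]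
      simpa using h.const_mul c
  have hB0 : 0 ≤ B := (integral_nonneg fun _ => norm_nonneg _).trans (hB 0)
  have hf : f ∈ (Submodule.span ℂ (range (_root_.fourier : ℤ → C(Torus, ℂ)))).topologicalClosure := by
    rw [span_fourier_closure_eq_top]; trivial
  rw [← SetLike.mem_coe, Submodule.topologicalClosure_coe, Metric.mem_closure_iff] at hf
  rw [Metric.tendsto_atTop]
  intro ε hε
  -- The deviation is Lipschitz in the test function with constant 2B, so this accuracy costs at
  -- most ε/2; B + 1 avoids dividing by zero.
  obtain ⟨q, hq, hfq⟩ := hf (ε / (4 * (B + 1))) (by positivity)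
  obtain ⟨N, hN⟩ := Metric.tendsto_atTop.1 (hspan q hq) (ε / 2) (by positivity)
  refine ⟨N, fun n hn => ?_⟩
  have h1 := hN n hn
  rw [dist_zero_right] at h1 ⊢
  have h2 : deviation μ (w n) f = deviation μ (w n) q + deviation μ (w n) (f - q) := by
    rw [← deviation_add (hw n), add_sub_cancel]
  have h3 : ‖deviation μ (w n) (f - q)‖ ≤ ε / 2 := by
    refine (norm_deviation_le (hw n) _).trans ?_
    rw [← dist_eq_norm]
    calc _ ≤ 2 * (B + 1) * (ε / (4 * (B + 1))) := by
          gcongr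
          linarith [hB n]
      _ = ε / 2 := by field_simp; ring
  rw [h2]
  exact (norm_add_le _ _).trans_lt (by linarith)

theorem integrable_mul_conj {α : Type*} [MeasurableSpace α] {μ : Measure α} {g : α → ℂ}
    (hg : MemLp g 2 μ) : Integrable (fun z => g z * conj (g z)) μ := hg.integrable_mul hg.star

theorem enorm_integral_mul_conj_eq {α : Type*} [MeasurableSpace α] {μ : Measure α} {g : α → ℂ}
    (hg : MemLp g 2 μ) : ‖∫ z, g z * conj (g z) ∂μ‖ₑ = eLpNorm g 2 μ ^ 2 := by
  have e : ∀ z, g z * conj (g z) = ((‖g z‖ ^ 2 : ℝ) : ℂ) := fun z => by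
    rw [Complex.mul_conj, Complex.normSq_eq_norm_sq]
  simp only [e]
  rw [integral_complex_ofReal, eLpNorm_two_sq, ← ofReal_norm, Complex.norm_real,
    Real.norm_of_nonneg (integral_nonneg fun _ => sq_nonneg _),
    ofReal_integral_eq_lintegral_ofReal hg.norm.integrable_sq (ae_of_all _ fun _ => sq_nonneg _)]
  refine lintegral_congr fun z => ?_
  rw [ENNReal.ofReal_pow (norm_nonneg _), ofReal_norm]

theorem integral_norm_mul_conj {α : Type*} [MeasurableSpace α] {μ : Measure α} {g : α → ℂ}
    (hg : MemLp g 2 μ) : ∫ z, ‖g z * conj (g z)‖ ∂μ = (eLpNorm g 2 μ ^ 2).toReal := by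
  rw [integral_norm_eq_lintegral_enorm (integrable_mul_conj hg).1, eLpNorm_two_sq]
  congr 1
  refine lintegral_congr fun z => ?_
  rw [enorm_mul, RCLike.enorm_conj, sq]

theorem l2Norm_univ_le {T : ℝ} {u : GenFun T} {g : ℝ × ℝ → ℂ}
    (hg : MemLp g 2 (cylinderMeasure T univ))
    (hu : ∀ φ : testSpace T, u φ = ∫ z, g z * (φ : ℝ × ℝ → ℂ) z ∂(cylinderMeasure T univ)) :
    l2Norm univ u ≤ eLpNorm g 2 (cylinderMeasure T univ) :=
  iInf_le_of_le g (iInf_le_of_le hg (iInf_le_of_le (fun φ _ => hu φ) le_rfl))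

theorem exists_extends_of_restrictedNorm_lt {p : ℤ → ℝ} {b s T : ℝ} {u : GenFun T} {C : ℝ≥0∞}
    (h : restrictedNorm p b s u < C) : ∃ F : ℤ → ℝ → ℂ,
      (∀ k, AEStronglyMeasurable (F k) volume) ∧ Extends F u ∧ bourgainNorm p b s F < C := by
  simp only [restrictedNorm, iInf_lt_iff] at h
  obtain ⟨F, h1, h2, h3⟩ := h
  exact ⟨F, h1, h2, h3⟩

/-- The spatial Fourier coefficients of `|uₙ|²` at nonzero frequencies tend to zero. -/
theorem tendsto_density_coeff {p : ℤ → ℝ}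
    (hp : (∀ k : ℤ, p k = -((k : ℝ) ^ 4 + (k : ℝ) ^ 2)) ∨
      (∀ k : ℤ, p k = (k : ℝ) ^ 4 - (k : ℝ) ^ 2)) {T b : ℝ} (hT : 0 < T) (hb0 : 0 ≤ b) (hb1 : b ≤ 1)
    {u f : ℕ → GenFun T} (hL : ∀ n, schrodinger4 (u n) = f n)
    (hu0 : Tendsto (fun n => restrictedNorm p (-b) (-3 + 3 * b) (u n)) atTop (𝓝 0))
    (hf0 : Tendsto (fun n => restrictedNorm p (-b) (-3 + 3 * b) (f n)) atTop (𝓝 0))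
    {F : ℕ → ℤ → ℝ → ℂ} {C : ℝ≥0∞} (hC : C ≠ ∞) (hF : ∀ n, bourgainNorm p b 0 (F n) ≤ C)
    (mF : ∀ n k, AEStronglyMeasurable (F n k) volume) (hE : ∀ n, Extends (F n) (u n))
    {g : ℕ → ℝ × ℝ → ℂ} (hg : ∀ n, MemLp (g n) 2 (cylinderMeasure T univ))
    (hug : ∀ n (φ : testSpace T),
      u n φ = ∫ z, g n z * (φ : ℝ × ℝ → ℂ) z ∂(cylinderMeasure T univ)) {m : ℤ} (hm : m ≠ 0) :
    Tendsto (fun n => ∫ z, g n z * conj (g n z) * Complex.exp (Complex.I * (m * z.2))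
      ∂(cylinderMeasure T univ)) atTop (𝓝 0) := by
  rw [tendsto_zero_iff_enorm_tendsto_zero, ENNReal.tendsto_nhds_zero]
  intro κ hκ
  obtain ⟨η, hη, h⟩ := exists_correlation_le hp hT hb0 hb1 hm hC hκ.ne'
  have hη' : 0 < η := pos_iff_ne_zero.2 hη
  filter_upwards [hu0.eventually_lt_const hη', hf0.eventually_lt_const hη'] with n h1 h2
  -- The small extensions of uₙ and fₙ are picked separately for each n and are unrelated to the
  -- bounded extension F n.
  obtain ⟨F₁, mF₁, hE₁, nF₁⟩ := exists_extends_of_restrictedNorm_lt h1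
  obtain ⟨G, mG, hEG, nG⟩ := exists_extends_of_restrictedNorm_lt h2
  have nF : bourgainNorm p b 0 (F n) < ∞ := (hF n).trans_lt hC.lt_top
  have hmode := isModeSolution_of_extends hb0 hb1 (hL n) (hE n) hE₁ hEG (mF n) mF₁ mG nF
    (lt_top_of_lt nF₁) (lt_top_of_lt nG)
  choose a ha using fun k => exists_isL2Transform ((hmode k).memLp hb0)
  have hS : IsSolutionFamily p T b (F n) F₁ G a := ⟨hmode, ha⟩
  exact (hS.enorm_integral_density_le (hE n) (hg n) (hug n) m).trans
    (h _ _ _ _ hS (hF n) nF₁.le nG.le)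

end FourthOrderNLS

end

/-! ### Conclusion: from equidistribution to strong convergence. -/

open FourthOrderNLS in
theorem proposition5p1
    (p : ℤ → ℝ)
    (hp : (∀ k : ℤ, p k = -((k : ℝ) ^ 4 + (k : ℝ) ^ 2)) ∨
      (∀ k : ℤ, p k = (k : ℝ) ^ 4 - (k : ℝ) ^ 2))
    (T b b' : ℝ) (hT : 0 < T) (hb' : 0 ≤ b') (hb'b : b' ≤ b) (hb : b ≤ 1)
    (u f : ℕ → GenFun T)
    (hu : ∀ n, MemBourgain p b 0 (u n))
    (hf : ∀ n, MemBourgain p (-b) (-3 + 3 * b) (f n))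
    (hL : ∀ n, schrodinger4 (u n) = f n)
    (hbound : ∃ C : ℝ≥0, ∀ n, restrictedNorm p b 0 (u n) ≤ C)
    (hlim : Tendsto (fun n => restrictedNorm p (-b) (-3 + 3 * b) (u n) +
      restrictedNorm p (-b) (-3 + 3 * b) (f n) +
      restrictedNorm p (-b') (-1 + 3 * b') (u n)) atTop (𝓝 0))
    (ω : Set Torus) (hω : IsOpen ω) (hωne : ω.Nonempty)
    (huω : Tendsto (fun n => l2Norm ω (u n)) atTop (𝓝 0)) :
    Tendsto (fun n => l2Norm (univ : Set Torus) (u n)) atTop (𝓝 0) := by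
  have hb0 : 0 ≤ b := hb'.trans hb'b
  have hu0 : Tendsto (fun n => restrictedNorm p (-b) (-3 + 3 * b) (u n)) atTop (𝓝 0) :=
    tendsto_of_tendsto_of_tendsto_of_le_of_le tendsto_const_nhds hlim (fun _ => zero_le)
      fun n => le_self_add.trans le_self_add
  have hf0 : Tendsto (fun n => restrictedNorm p (-b) (-3 + 3 * b) (f n)) atTop (𝓝 0) :=
    tendsto_of_tendsto_of_tendsto_of_le_of_le tendsto_const_nhds hlim (fun _ => zero_le)
      fun n => le_add_self.trans le_self_add
  obtain ⟨C, hC⟩ := hbound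
  -- The infimum need not be attained; a strict inequality is required to select an actual
  -- extension.
  have hC1 : ∀ n, restrictedNorm p b 0 (u n) < (C + 1 : ℝ≥0) := fun n =>
    (hC n).trans_lt (by exact_mod_cast lt_add_one C)
  choose F mF hE nF using fun n => exists_extends_of_restrictedNorm_lt (hC1 n)
  choose g hg hgn hug using fun n =>
    (hE n).exists_density (mF n) hb0 (lt_top_of_lt (nF n))
  set μ := cylinderMeasure T univ with hμ
  set w : ℕ → ℝ × ℝ → ℂ := fun n z => g n z * (starRingEnd ℂ) (g n z) with hw
  have hwi : ∀ n, Integrable (w n) μ := fun n => integrable_mul_conj (hg n)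
  have hwB : ∀ n, ∫ z, ‖w n z‖ ∂μ ≤ ((((C + 1 : ℝ≥0) : ℝ≥0∞)) ^ 2).toReal := fun n => by
    rw [integral_norm_mul_conj (hg n)]
    refine ENNReal.toReal_mono (by finiteness) ?_
    gcongr
    exact (hgn n).trans (nF n).le
  have hdev := tendsto_deviation hwi hwB fun m hm => tendsto_density_coeff hp hT hb0 hb hL hu0 hf0
    ENNReal.coe_ne_top (fun n => (nF n).le) mF hE hg hug hm
  obtain ⟨θ, hθ, hper, hθ1, hθpos, K, hK, hKω, hθK⟩ := exists_periodic_cutoff hω hωne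
  have hper2 : Function.Periodic (fun x => ((θ x ^ 2 : ℝ) : ℂ)) (2 * Real.pi) := fun x => by
    simp only [hper x]
  -- The test function is θ² rather than θ, so that its pairing with |uₙ|² is the squared L² norm of
  -- θuₙ, which is controlled by the norm on ω.
  let h : C(Torus, ℂ) := ⟨hper2.lift, continuous_periodic_lift hper2
    (Complex.continuous_ofReal.comp (hθ.continuous.pow 2))⟩
  have hh : ∀ x : ℝ, h (x : Torus) = ((θ x ^ 2 : ℝ) : ℂ) := fun x => rfl
  have hmean : torusMean h ≠ 0 := by
    simp only [torusMean, hh]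
    rw [integral_complex_ofReal]
    refine mul_ne_zero (inv_ne_zero (by simp [Real.pi_ne_zero])) ?_
    exact_mod_cast hθpos.ne'
  have hloc : Tendsto (fun n => ∫ z, w n z * h (z.2 : ℝ) ∂μ) atTop (𝓝 0) := by
    rw [tendsto_zero_iff_enorm_tendsto_zero]
    have hsq : Tendsto (fun n => l2Norm ω (u n) ^ 2) atTop (𝓝 0) := by
      simpa using ENNReal.Tendsto.pow (n := 2) huω
    refine tendsto_of_tendsto_of_tendsto_of_le_of_le tendsto_const_nhds hsq (fun _ => zero_le)
      fun n => ?_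
    have e : ∀ z : ℝ × ℝ, w n z * h (z.2 : ℝ) =
        (θ z.2 * g n z) * (starRingEnd ℂ) (θ z.2 * g n z) := fun z => by
      rw [hh, map_mul, Complex.conj_ofReal]
      push_cast
      ring
    have hθg : MemLp (fun z : ℝ × ℝ => (θ z.2 : ℂ) * g n z) 2 μ :=
      (hg n).mono ((Complex.continuous_ofReal.comp
        (hθ.continuous.comp continuous_snd)).aestronglyMeasurable.mul (hg n).1)
        (ae_of_all _ fun z => by
          rw [norm_mul, Complex.norm_real]
          exact mul_le_of_le_one_left (norm_nonneg _) (hθ1 _))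
    simp only [e]
    rw [enorm_integral_mul_conj_eq hθg]
    gcongr
    exact eLpNorm_cutoff_mul_le hω hθ hper hθ1 hK hKω hθK (hg n) (hug n)
  have hmass : Tendsto (fun n => ∫ z, w n z ∂μ) atTop (𝓝 0) := by
    -- Total mass times the mean of θ² equals the localised mass minus the deviation; both tend to
    -- zero and the mean is nonzero.
    have h1 := (hloc.sub (hdev h)).mul_const (torusMean h)⁻¹
    rw [sub_zero, zero_mul] at h1
    refine h1.congr fun n => ?_
    rw [deviation, sub_sub_cancel, mul_inv_cancel_right₀ hmean]
  rw [tendsto_zero_iff_enorm_tendsto_zero] at hmass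
  simp only [hw] at hmass
  have h2 : Tendsto (fun n => eLpNorm (g n) 2 μ) atTop (𝓝 0) := by
    have h3 := (ENNReal.continuous_rpow_const (y := 1 / 2)).tendsto 0 |>.comp hmass
    simp only [Function.comp_def, enorm_integral_mul_conj_eq (hg _)] at h3
    rw [ENNReal.zero_rpow_of_pos (by norm_num)] at h3
    refine h3.congr fun n => ?_
    rw [← ENNReal.rpow_natCast, ← ENNReal.rpow_mul]
    norm_num
  exact tendsto_of_tendsto_of_tendsto_of_le_of_le tendsto_const_nhds h2 (fun _ => zero_le)
    fun n => l2Norm_univ_le (hg n) (hug n)
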